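/- Let $S$ be a noetherian scheme, let $U=\operatorname{Spec} R$ be a local henselian noetherian scheme over $S$ with closed point $u$, and let $X$ be a separated scheme of finite type over $S$. For $x\in X$ let $X^h_x$ be the spectrum of the henselization of the local ring $\mathcal O_{X,x}$, with its canonical morphism $c_x\colon X^h_x\to X$. For a morphism of schemes $p\colon Y\to B$ let $\mathcal P(p)$ be the exact category of quasi-coherent sheaves of finite type $\mathcal F$ on $Y$ whose support is finite over $B$ and such that $p_*\mathcal F$ is locally free of finite rank on $B$, with the duality $D_B(\mathcal F)=\mathcal Hom_{\mathcal O_B}(p_*\mathcal F,\mathcal O_B)$, regarded as an $\mathcal O_Y$-module through the action on $\mathcal F$. A quadratic space is an object $\mathcal F$ of $\mathcal P(p)$ with a symmetric isomorphism $q\colon\mathcal F\cong D_B(\mathcal F)$. It is metabolic if there is $j\colon\mathcal L\to\mathcal F$ in $\mathcal P(p)$ such that $0\to\mathcal L\xrightarrow{j}\mathcal F\xrightarrow{D_B(j)q}D_B(\mathcal L)\to0$ is exact. Let $GW$ be the group completion of the monoid of isometry classes of quadratic spaces under orthogonal sum, and let $W$ be the quotient of $GW$ by the subgroup generated by the classes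 of metabolic spaces. Put $$GWCor_S(U,X)=GW(\mathcal P(U\times_SX\to U)),\qquad WCor_S(U,X)=W(\mathcal P(U\times_SX\to U)).$$ Let $GWCor_S(U,X^h_x)$ and $WCor_S(U,X^h_x)$ be the groups $GW$ and $W$ of the full subcategory $\mathcal P^{loc}(U,X^h_x)\subset\mathcal P(U\times_SX^h_x\to U)$ of those $\mathcal F$ for which every point of $\operatorname{Supp}\mathcal F$ over $u$ lies over the closed point of $X^h_x$. Then for each $x\in X$ direct image along $\mathrm{id}_U\times c_x\colon U\times_SX^h_x\to U\times_SX$ takes quadratic spaces in $\mathcal P^{loc}(U,X^h_x)$ to quadratic spaces in $\mathcal P(U\times_SX\to U)$, and the induced homomorphisms, summed over all points $x$ of $X$, are isomorphisms $$\bigoplus_{x\in X}GWCor_S(U,X^h_x)\;\cong\;GWCor_S(U,X),\qquad \bigoplus_{x\in X}WCor_S(U,X^h_x)\;\cong\;WCor_S(U,X).$$ Moreover, if the image $s$ of $u$ in $S$ is a closed point and the residue field extension $\kappa(u)/\kappa(s)$ is algebraic, then $\mathcal P^{loc}(U,X^h_x)=\mathcal P(U\times_SX^h_x\to U)$ for every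 $x\in X$. -/

import Mathlib

universe u

open CategoryTheory CategoryTheory.Limits AlgebraicGeometry

namespace GWCorr

noncomputable section

/-! ### Coherent sheaves with finite support and the exact category `P(Y → X)` -/

/-- A quasi-coherent sheaf of modules of finite type. On a noetherian scheme these are exactly the
coherent sheaves. -/
structure IsCoherent {Y : Scheme.{u}} (F : Y.Modules) : Prop where
  quasicoherent : F.IsQuasicoherent
  finite : ∀ W : Y.Opens, IsAffineOpen W → Module.Finite Γ(Y, W) Γ(F, W)

/-- The support of a sheaf of modules: the points with nonzero stalk. -/
def supp {Y : Scheme.{u}} (F : Y.Modules) : Set Y :=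
  {y | Nontrivial (F.presheaf.stalk y)}

/-- The support of `F` is finite over the target of `p : Y ⟶ X`: there is a closed subscheme of `Y`,
finite over `X`, whose ideal sheaf annihilates `F`. (For a coherent sheaf on a noetherian scheme it
does not matter which closed subscheme structure is put on the support.) -/
def HasFiniteSupport {Y X : Scheme.{u}} (p : Y ⟶ X) (F : Y.Modules) : Prop :=
  ∃ I : Y.IdealSheafData, IsFinite (I.subschemeι ≫ p) ∧
    ∀ (W : Y.affineOpens) (a : Γ(Y, W.1)), a ∈ I.ideal W → ∀ s : Γ(F, W.1), a • s = 0

/-- The sheaf of modules `F` on `X` is locally free of finite rank, for the quasi-coherent sheaves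
for which this is used: on affine opens its sections form a finitely generated projective module. -/
def IsFiniteLocallyFree {X : Scheme.{u}} (F : X.Modules) : Prop :=
  ∀ V : X.Opens, IsAffineOpen V →
    Module.Finite Γ(X, V) Γ(F, V) ∧ Module.Projective Γ(X, V) Γ(F, V)

/-- The objects of `P(p)`, for `p : Y ⟶ X`: coherent sheaves on `Y` whose support is finite over `X`
and whose direct image on `X` is locally free of finite rank. -/
structure MemP {Y X : Scheme.{u}} (p : Y ⟶ X) (F : Y.Modules) : Prop where
  coherent : IsCoherent F
  finiteSupport : HasFiniteSupport p F
  locallyFree : IsFiniteLocallyFree ((Scheme.Modules.pushforward p).obj F)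

/-! ### The duality `D_X` and quadratic spaces -/

/-- On sections of direct images: the map induced by a morphism of `𝒪_Y`-modules. -/
def mapSec {Y X : Scheme.{u}} (p : Y ⟶ X) {F G : Y.Modules} (φ : F ⟶ G) (V : X.Opens)
    (s : Γ((Scheme.Modules.pushforward p).obj F, V)) :
    Γ((Scheme.Modules.pushforward p).obj G, V) :=
  ((Scheme.Modules.pushforward p).map φ).app V s

/-- Sections `s, s'` of `F` and `t, t'` of `G` over `W` such that, locally on `W`, one has
`s' = a s` and `t' = a t` for one and the same section `a` of `𝒪_Y`. -/
def LocallyMultiples {Y : Scheme.{u}} {F G : Y.Modules} {W : Y.Opens}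
    (s s' : Γ(F, W)) (t t' : Γ(G, W)) : Prop :=
  ∀ y ∈ W, ∃ (W' : Y.Opens) (h : W' ≤ W) (a : Γ(Y, W')), y ∈ W' ∧
    F.presheaf.map (homOfLE h).op s' = a • F.presheaf.map (homOfLE h).op s ∧
    G.presheaf.map (homOfLE h).op t' = a • G.presheaf.map (homOfLE h).op t

/-- Morphisms `F ⟶ D_X(G)` of `𝒪_Y`-modules, for `p : Y ⟶ X` and `F`, `G` in `P(p)`. Here `D_X(G)` is
the sheaf of `𝒪_X`-linear maps `p_* G → 𝒪_X`, with the `𝒪_Y`-module structure that comes from the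
action on `G`. Hence such a morphism is an `𝒪_X`-bilinear pairing `p_* F × p_* G → 𝒪_X` with
`⟨a s, t⟩ = ⟨s, a t⟩` for the functions `a` on the (finite, hence affine over `X`) supports. The
latter are only locally restrictions of functions on `Y`, whence the form of `balanced`. -/
structure DualPairing {Y X : Scheme.{u}} (p : Y ⟶ X) (F G : Y.Modules) where
  toFun (V : X.Opens) :
    Γ((Scheme.Modules.pushforward p).obj F, V) →ₗ[Γ(X, V)]
      Γ((Scheme.Modules.pushforward p).obj G, V) →ₗ[Γ(X, V)] Γ(X, V)
  map_res {V' V : X.Opens} (h : V' ≤ V) (s : Γ((Scheme.Modules.pushforward p).obj F, V))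
    (t : Γ((Scheme.Modules.pushforward p).obj G, V)) :
    X.presheaf.map (homOfLE h).op (toFun V s t) =
      toFun V' (((Scheme.Modules.pushforward p).obj F).presheaf.map (homOfLE h).op s)
        (((Scheme.Modules.pushforward p).obj G).presheaf.map (homOfLE h).op t)
  balanced (V : X.Opens) (s s' : Γ(F, p ⁻¹ᵁ V)) (t t' : Γ(G, p ⁻¹ᵁ V)) :
    LocallyMultiples s s' t t' → toFun V s' t = toFun V s t'

/-- The morphism `F ⟶ D_X(G)` given by the pairing is an isomorphism. -/
def DualPairing.IsPerfect {Y X : Scheme.{u}} {p : Y ⟶ X} {F G : Y.Modules}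
    (b : DualPairing p F G) : Prop :=
  ∀ V : X.Opens, IsAffineOpen V → Function.Bijective (b.toFun V)

/-- Non-degenerate quadratic spaces `(F, q)`, `q : F ≅ D_X(F)` with `q` self-dual, in the exact
category with duality `(P(p), D_X)`, `p : Y ⟶ X`; more precisely those with support in the subset
`T` of `Y` (so `T = Set.univ` gives all of them). -/
structure QuadSpace {Y X : Scheme.{u}} (p : Y ⟶ X) (T : Set Y) where
  F : Y.Modules
  memP : MemP p F
  supp_subset : supp F ⊆ T
  form : DualPairing p F F
  symm (V : X.Opens) (s t : Γ((Scheme.Modules.pushforward p).obj F, V)) :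
    form.toFun V s t = form.toFun V t s
  perfect : form.IsPerfect

variable {Y X : Scheme.{u}} {p : Y ⟶ X} {T : Set Y}

/-- Isometry of quadratic spaces. -/
def Isometric (Q Q' : QuadSpace p T) : Prop :=
  ∃ e : Q.F ≅ Q'.F, ∀ (V : X.Opens) (s t : Γ((Scheme.Modules.pushforward p).obj Q.F, V)),
    Q'.form.toFun V (mapSec p e.hom V s) (mapSec p e.hom V t) = Q.form.toFun V s t

/-- `Q` is (isometric to) the orthogonal sum of `Q₁` and `Q₂`. -/
def IsOrthogonalSum (Q Q₁ Q₂ : QuadSpace p T) : Prop :=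
  ∃ e : Q.F ≅ Q₁.F ⊞ Q₂.F,
    ∀ (V : X.Opens) (s t : Γ((Scheme.Modules.pushforward p).obj Q.F, V)),
      Q.form.toFun V s t =
        Q₁.form.toFun V (mapSec p (e.hom ≫ biprod.fst) V s) (mapSec p (e.hom ≫ biprod.fst) V t) +
        Q₂.form.toFun V (mapSec p (e.hom ≫ biprod.snd) V s) (mapSec p (e.hom ≫ biprod.snd) V t)

/-- `Q` is metabolic: it has a Lagrangian, that is, a morphism `j : L ⟶ Q.F` with `L` in `P(p)`
such that `0 → L → Q.F → D_X(L) → 0` is exact, the second map being `D_X(j)` composed with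
`Q.F ≅ D_X(Q.F)`. As all supports are finite over `X`, exactness can be read off
from the sections over the preimages of affine opens of `X`. -/
def IsMetabolic (Q : QuadSpace p T) : Prop :=
  ∃ (L : Y.Modules) (j : L ⟶ Q.F), MemP p L ∧ ∀ V : X.Opens, IsAffineOpen V →
    Function.Injective (mapSec p j V) ∧
    (∀ s : Γ((Scheme.Modules.pushforward p).obj Q.F, V),
      (∀ l, Q.form.toFun V s (mapSec p j V l) = 0) ↔ ∃ l, mapSec p j V l = s) ∧
    (∀ r : Γ((Scheme.Modules.pushforward p).obj L, V) →ₗ[Γ(X, V)] Γ(X, V),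
      ∃ s, ∀ l, Q.form.toFun V s (mapSec p j V l) = r l)

/-! ### Grothendieck–Witt and Witt groups -/

variable (p T) in
/-- The relations of the Grothendieck–Witt group: isometric spaces are equal, and orthogonal sums
are sums. -/
def gwRelations : Set (FreeAbelianGroup (QuadSpace p T)) :=
  {z | ∃ Q Q' : QuadSpace p T, Isometric Q Q' ∧
    z = FreeAbelianGroup.of Q - FreeAbelianGroup.of Q'} ∪
  {z | ∃ Q Q₁ Q₂ : QuadSpace p T, IsOrthogonalSum Q Q₁ Q₂ ∧
    z = FreeAbelianGroup.of Q - (FreeAbelianGroup.of Q₁ + FreeAbelianGroup.of Q₂)}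

variable (p T) in
/-- The Grothendieck–Witt group `GW(P(p), D_X)` (of spaces with support in `T`): the group completion
of the monoid of isometry classes of quadratic spaces under orthogonal sum. -/
def GW : Type (u + 1) :=
  FreeAbelianGroup (QuadSpace p T) ⧸ AddSubgroup.closure (gwRelations p T)

instance : AddCommGroup (GW p T) :=
  inferInstanceAs (AddCommGroup
    (FreeAbelianGroup (QuadSpace p T) ⧸ AddSubgroup.closure (gwRelations p T)))

/-- The class of a quadratic space in the Grothendieck–Witt group. -/
def GW.mk (Q : QuadSpace p T) : GW p T :=
  QuotientAddGroup.mk' (AddSubgroup.closure (gwRelations p T)) (FreeAbelianGroup.of Q)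

variable (p T) in
/-- The Witt group: the quotient of `GW` by the classes of metabolic spaces. -/
def W : Type (u + 1) :=
  GW p T ⧸ AddSubgroup.closure {z : GW p T | ∃ Q, IsMetabolic Q ∧ z = GW.mk Q}

instance : AddCommGroup (W p T) :=
  inferInstanceAs (AddCommGroup
    (GW p T ⧸ AddSubgroup.closure {z : GW p T | ∃ Q, IsMetabolic Q ∧ z = GW.mk Q}))

/-- The class of a quadratic space in the Witt group. -/
def W.mk (Q : QuadSpace p T) : W p T :=
  QuotientAddGroup.mk' (AddSubgroup.closure {z : GW p T | ∃ Q, IsMetabolic Q ∧ z = GW.mk Q})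
    (GW.mk Q)

/-! ### Direct images of quadratic spaces -/

/-- For `h : Y' ⟶ Y` over `X`, the canonical identification of the direct images on `X` of a sheaf
`F'` on `Y'` and of `h_* F'`. -/
def pushIso {Y' : Scheme.{u}} {p' : Y' ⟶ X} (h : Y' ⟶ Y) (hp : h ≫ p = p') (F' : Y'.Modules) :
    (Scheme.Modules.pushforward p').obj F' ≅
      (Scheme.Modules.pushforward p).obj ((Scheme.Modules.pushforward h).obj F') :=
  (Scheme.Modules.pushforwardCongr hp).symm.app F' ≪≫
    (Scheme.Modules.pushforwardComp h p).symm.app F'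

/-- `Q` is the direct image of `Q'` along `h : Y' ⟶ Y` over `X`: up to isometry, the underlying sheaf
of `Q` is `h_* Q'.F`, with the same form. -/
def IsPushforward {Y' : Scheme.{u}} {p' : Y' ⟶ X} {T' : Set Y'} (h : Y' ⟶ Y) (hp : h ≫ p = p')
    (Q' : QuadSpace p' T') (Q : QuadSpace p T) : Prop :=
  ∃ e : (Scheme.Modules.pushforward h).obj Q'.F ≅ Q.F,
    ∀ (V : X.Opens) (s t : Γ((Scheme.Modules.pushforward p').obj Q'.F, V)),
      Q.form.toFun V (mapSec p e.hom V ((pushIso h hp Q'.F).hom.app V s))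
        (mapSec p e.hom V ((pushIso h hp Q'.F).hom.app V t)) = Q'.form.toFun V s t

/-! ### Henselization -/

/-- Étale neighbourhoods of the closed point of `Spec A`: a standard étale `A`-algebra with
an `A`-algebra homomorphism to the residue field of `A`. -/
structure EtaleNhd (A : Type u) [CommRing A] [IsLocalRing A] where
  pair : StandardEtalePair A
  point : pair.Ring →ₐ[A] IsLocalRing.ResidueField A

/-- An étale neighbourhood as an `A`-algebra over the residue field of `A`. -/
def EtaleNhd.toOver (A : Type u) [CommRing A] [IsLocalRing A] (P : EtaleNhd A) :
    Over (CommAlgCat.of A (IsLocalRing.ResidueField A)) :=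
  Over.mk (CommAlgCat.ofHom P.point)

/-- The coordinate rings of the étale neighbourhoods, as a diagram of `A`-algebras; its morphisms are
the homomorphisms of `A`-algebras that respect the points. -/
def EtaleNhd.diagram (A : Type u) [CommRing A] [IsLocalRing A] :
    InducedCategory (Over (CommAlgCat.of A (IsLocalRing.ResidueField A))) (EtaleNhd.toOver A) ⥤
      CommAlgCat.{u} A :=
  inducedFunctor (EtaleNhd.toOver A) ⋙ Over.forget _

/-- The henselization of a local ring `A`: the colimit of the coordinate rings of the étale
neighbourhoods of the closed point (the standard étale ones are cofinal among all). -/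
def henselization (A : Type u) [CommRing A] [IsLocalRing A] : CommAlgCat.{u} A :=
  colimit (EtaleNhd.diagram A)

/-- The henselization `X^h_x` of the scheme `X` at the point `x`: the spectrum of the henselization
of the local ring `𝒪_{X,x}`. -/
def henselAt (X : Scheme.{u}) (x : X) : Scheme.{u} :=
  Spec (CommRingCat.of (henselization (X.presheaf.stalk x)))

/-- The canonical morphism `X^h_x ⟶ X`. -/
def henselAtι (X : Scheme.{u}) (x : X) : henselAt X x ⟶ X :=
  Spec.map (CommRingCat.ofHom
    (algebraMap (X.presheaf.stalk x) (henselization (X.presheaf.stalk x)))) ≫ X.fromSpecStalk x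

/-! ### Correspondences -/

variable {S U : Scheme.{u}} (f : U ⟶ S) (g : X ⟶ S) (u : U) (x : X)

/-- `GWCor_S(U, X) = GW(P(U ×_S X → U), D_U)`. -/
abbrev GWCor : Type (u + 1) := GW (pullback.fst f g) Set.univ

/-- `WCor_S(U, X) = W(P(U ×_S X → U), D_U)`. -/
abbrev WCor : Type (u + 1) := W (pullback.fst f g) Set.univ

/-- The projection `U ×_S X^h_x ⟶ U`. -/
abbrev henselFst : pullback f (henselAtι X x ≫ g) ⟶ U := pullback.fst f (henselAtι X x ≫ g)

/-- For `U` local with closed point `u`: the points of `U ×_S X^h_x` which, if they lie over `u`,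
lie over the closed point of `X^h_x` (the only point of `X^h_x` over `x`). -/
def localLocus : Set ↥(pullback f (henselAtι X x ≫ g)) :=
  {y | henselFst f g x y = u →
    henselAtι X x (pullback.snd f (henselAtι X x ≫ g) y) = x}

/-- The Grothendieck–Witt correspondences `GWCor_S(U, X^h_x)` between local schemes: defined by
quadratic spaces in `P(U ×_S X^h_x → U)` whose support meets the closed fibre only over the closed
point of `X^h_x`. -/
abbrev GWCorAt : Type (u + 1) := GW (henselFst f g x) (localLocus f g u x)

/-- The Witt correspondences `WCor_S(U, X^h_x)` between local schemes. -/
abbrev WCorAt : Type (u + 1) := W (henselFst f g x) (localLocus f g u x)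

/-- The morphism `U ×_S X^h_x ⟶ U ×_S X`. -/
def henselMap : pullback f (henselAtι X x ≫ g) ⟶ pullback f g :=
  pullback.lift (pullback.fst _ _) (pullback.snd _ _ ≫ henselAtι X x)
    (by rw [pullback.condition, Category.assoc])

lemma henselMap_fst : henselMap f g x ≫ pullback.fst f g = henselFst f g x :=
  pullback.lift_fst _ _ _

open scoped Classical in
/-- The family of homomorphisms `φ i : G i → H` identifies `H` with the direct sum of the `G i`. -/
def IsDirectSumVia {ι : Type*} {G : ι → Type*} [∀ i, AddCommGroup (G i)] {H : Type*}
    [AddCommGroup H] (φ : ∀ i, G i →+ H) : Prop :=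
  Function.Bijective (DirectSum.toAddMonoid φ : DirectSum ι G →+ H)

end

end GWCorr

/-! Write `U = Spec R`. A sheaf in `P(U ×_S X → U)` lives on a closed subscheme `Spec B` with `B`
finite over `R`. As `R` is henselian, every set of maximal ideals of `B` is cut out by an idempotent
(`exists_isIdempotentElem_forall_notMem_iff`). Hence the sheaf is a finite direct sum of parts, one
for each point `x` of `X` that is the image of a point of the support over `u`.

These splittings respect all the structure. A closed subset of a finite `U`-scheme that misses the
closed fibre is empty, so morphisms may be compared near the closed fibre only (`MemP.eq_zero`);
this makes the projections to the parts natural. A projection is locally `0` or `1`, that is,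
locally multiplication by a function, so it is self-adjoint for every pairing
(`IsLocalProjection.adjoint`). Quadratic spaces therefore split orthogonally, and isometries,
orthogonal sums and Lagrangians split along with them.

It remains to identify the part at `x` with `P^loc(U, X^h_x)`. Let all closed points of `Spec B` lie
over `x`. Then `Spec B → X` factors through `Spec 𝒪_{X,x}`. A finite algebra over a henselian local
ring is henselian along ideals in its radical (`exists_isRoot_of_finite`), so this factors further
through `X^h_x` (`exists_lift_henselMap`). Conversely, a finite closed subscheme `Spec B` of `U ×_S
X^h_x` whose closed points lie over `x` stays closed in `U ×_S X`
(`isClosedImmersion_comp_henselMap`): a local ring and its henselization have the same image modulo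
powers of the maximal ideal, such a power maps into `m_R B`, and Nakayama applies. So both sides
consist of the same modules on the same finite schemes, and direct image is fully faithful between
them.

`IsLocalPart` records exactly what this comparison must provide, `exists_isDirectSumVia` derives the
decomposition of both groups from it, and `isLocalPart_henselMap` supplies it for `X^h_x`.

For the last claim, a point of the support over `u` has a residue field integral over the closed
point `s`. Its image in `X` is then a closed point that specializes to `x`, hence equals `x`. -/

namespace GWCorr

/-! ### Finite algebras over henselian local rings -/

section

open Polynomial IsLocalRing TensorProduct

/-- An étale algebra over a henselian local ring has a section through every point with trivial
residue field extension. -/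
lemma exists_section_of_etale {R R' K : Type*} [CommRing R] [HenselianLocalRing R] [CommRing R']
    [Algebra R R'] [Algebra.Etale R R'] [Field K] [Algebra R K]
    (hK : Function.Surjective (algebraMap R K)) (ψ : R' →ₐ[R] K) :
    ∃ σ : R' →ₐ[R] R, (Algebra.ofId R K).comp σ = ψ := by
  have : (RingHom.ker ψ.toRingHom).IsPrime := RingHom.ker_isPrime _
  have hker : RingHom.ker (algebraMap R K) = maximalIdeal R := ker_eq_maximalIdeal _ hK
  -- Near the point `ker ψ` the algebra is standard étale, so a section amounts to a root of one
  -- polynomial.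
  obtain ⟨g, hg, hstd⟩ := Algebra.IsEtaleAt.exists_isStandardEtale (R := R)
    (RingHom.ker ψ.toRingHom)
  obtain ⟨⟨P⟩⟩ := hstd
  have hgu : IsUnit (ψ g) := isUnit_iff_ne_zero.mpr hg
  let ψ' : Localization.Away g →ₐ[R] K := IsLocalization.Away.liftAlgHom (f := ψ) g hgu
  have hψ' (r : R') : ψ' (algebraMap R' _ r) = ψ r := IsLocalization.Away.lift_eq g hgu r
  obtain ⟨r₀, hr₀⟩ := hK (ψ' P.x)
  have hm := P.hasMap.map ψ'
  have hd := hm.isUnit_derivative_f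
  have hev (p : R[X]) (r : R) : algebraMap R K (p.eval r) = aeval (algebraMap R K r) p := by
    rw [aeval_algebraMap_apply, aeval_def, Algebra.algebraMap_self, eval₂_id]
  have hunit (r : R) (h : IsUnit (algebraMap R K r)) : IsUnit r := by
    rw [← notMem_maximalIdeal, ← hker, RingHom.mem_ker]
    exact h.ne_zero
  -- The image of the coordinate in `K` is a simple root of `P.f`, because the derivative is
  -- invertible on a standard étale algebra; Hensel's lemma lifts it to `R`.
  obtain ⟨r, hr, hrr⟩ := HenselianLocalRing.is_henselian P.f P.monic_f r₀
    (by rw [← hker, RingHom.mem_ker, hev, hr₀, hm.1])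
    (hunit _ (by rw [hev, hr₀]; exact hd))
  have hrK : algebraMap R K r = ψ' P.x := by
    rw [← hker, RingHom.mem_ker, map_sub, sub_eq_zero] at hrr
    rw [hrr, hr₀]
  have hrm : P.HasMap r := ⟨by rw [aeval_def, Algebra.algebraMap_self, eval₂_id]; exact hr,
    hunit _ (by
      have := hev P.g r
      rw [aeval_def, Algebra.algebraMap_self, eval₂_id, this, hrK]
      exact hm.2)⟩
  let σ' : Localization.Away g →ₐ[R] R := (P.lift r hrm).comp P.equivRing.toAlgHom
  have h2 : (Algebra.ofId R K).comp σ' = ψ' := by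
    apply P.hom_ext
    simp [σ', Algebra.ofId_apply, hrK]
  refine ⟨σ'.comp (IsScalarTower.toAlgHom R R' _), ?_⟩
  ext z
  have := DFunLike.congr_fun h2 (algebraMap R' _ z)
  rw [hψ'] at this
  exact this

/-- A finite algebra over a henselian local ring splits off its local component at each maximal
ideal. -/
lemma exists_isIdempotentElem_notMem_iff {R B : Type u} [CommRing R] [HenselianLocalRing R]
    [CommRing B] [Algebra R B] [Module.Finite R B] (q : Ideal B) [q.IsMaximal] :
    ∃ e : B, IsIdempotentElem e ∧ ∀ q' : Ideal B, q'.IsMaximal → (e ∉ q' ↔ q' = q) := by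
  have hlies (q' : Ideal B) (hq' : q'.IsMaximal) : q'.LiesOver (maximalIdeal R) :=
    ⟨(eq_maximalIdeal (Ideal.isMaximal_comap_of_isIntegral_of_isMaximal (R := R) q')).symm⟩
  have := hlies q inferInstance
  obtain ⟨R', _, _, _, P, _, _, e, he, P', _, _, hP'q, heP', hbij, -, H⟩ :=
    Algebra.exists_etale_isIdempotentElem_forall_liesOver_eq (maximalIdeal R) q
  have hsurj : Function.Surjective (algebraMap R P.ResidueField) := by
    have h1 : Function.Surjective (algebraMap R (maximalIdeal R).ResidueField) :=
      (Ideal.bijective_algebraMap_quotient_residueField (maximalIdeal R)).surjective.comp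
        Ideal.Quotient.mk_surjective
    intro z
    obtain ⟨y, rfl⟩ := hbij.surjective z
    obtain ⟨r, rfl⟩ := h1 y
    exact ⟨r, (AlgHom.commutes _ _).symm⟩
  obtain ⟨σ, hσ⟩ := exists_section_of_etale hsurj (IsScalarTower.toAlgHom R R' P.ResidueField)
  have hPker (r : R') : r ∈ P ↔ σ r ∈ maximalIdeal R := by
    rw [← Ideal.algebraMap_residueField_eq_zero, ← ker_eq_maximalIdeal _ hsurj, RingHom.mem_ker]
    have := DFunLike.congr_fun hσ r
    simp only [AlgHom.comp_apply, Algebra.ofId_apply, IsScalarTower.coe_toAlgHom'] at this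
    rw [this]
  -- The idempotent exists a priori only over the étale neighbourhood `R'`. Base change along the
  -- section `σ` brings it back to `B`.
  let μ : R' ⊗[R] B →ₐ[R] B :=
    Algebra.TensorProduct.lift ((Algebra.ofId R B).comp σ) (AlgHom.id R B) fun _ _ ↦ .all _ _
  have hμr (b : B) : μ (1 ⊗ₜ b) = b := by simp [μ]
  have hμl (r : R') : μ (r ⊗ₜ 1) = algebraMap R B (σ r) := by simp [μ, Algebra.ofId_apply]
  have hμs : Function.Surjective μ := fun b ↦ ⟨_, hμr b⟩
  have hover (q' : Ideal B) (hq' : q'.IsMaximal) : (q'.comap μ).LiesOver P := by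
    refine ⟨?_⟩
    ext r
    rw [hPker, Ideal.mem_comap, Ideal.mem_comap, Algebra.TensorProduct.algebraMap_apply,
      Algebra.algebraMap_self, RingHom.id_apply, hμl, (hlies q' hq').over]
    rfl
  -- Since `r` and `σ r` agree modulo `P`, the kernel of `μ` lies in `P'`. Hence `P'` is the
  -- preimage under `μ` of its restriction `q` to `B`.
  have hP' (z : R' ⊗[R] B) : z - 1 ⊗ₜ μ z ∈ P' := by
    induction z with
    | zero => simp
    | add a b ha hb =>
      rw [map_add, tmul_add, add_sub_add_comm]
      exact add_mem ha hb
    | tmul r b =>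
      have : (r ⊗ₜ b - 1 ⊗ₜ μ (r ⊗ₜ b) : R' ⊗[R] B) =
          algebraMap R' _ (r - algebraMap R R' (σ r)) * (1 ⊗ₜ b) := by
        have hμ : μ (r ⊗ₜ b) = algebraMap R B (σ r) * b := by simp [μ, Algebra.ofId_apply]
        rw [hμ, Algebra.TensorProduct.algebraMap_apply, Algebra.algebraMap_self, RingHom.id_apply,
          Algebra.TensorProduct.tmul_mul_tmul, mul_one, one_mul, sub_tmul,
          ← Algebra.smul_def, Algebra.algebraMap_eq_smul_one, smul_tmul]
      rw [this]
      refine Ideal.mul_mem_right _ _ ?_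
      rw [← Ideal.mem_comap, ← Ideal.under_def, ← Ideal.over_def P' P, hPker, map_sub,
        AlgHom.commutes, Algebra.algebraMap_self, RingHom.id_apply, sub_self]
      exact zero_mem _
  have hq : q.comap μ = P' := by
    ext z
    have h1 : (1 ⊗ₜ μ z : R' ⊗[R] B) ∈ P' ↔ μ z ∈ q := by
      rw [← hP'q]; rfl
    rw [Ideal.mem_comap, ← h1]
    constructor
    · intro h
      simpa using add_mem (hP' z) h
    · intro h
      simpa using sub_mem h (hP' z)
  refine ⟨μ e, he.map μ, fun q' hq' ↦ ⟨fun h ↦ ?_, ?_⟩⟩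
  · have := H (q'.comap μ) inferInstance (hover q' hq') h
    rw [← hq] at this
    exact Ideal.comap_injective_of_surjective μ hμs this
  · rintro rfl h
    exact heP' (hq ▸ h)

/-- In a finite algebra over a henselian local ring, every set of maximal ideals is cut out by an
idempotent. -/
lemma exists_isIdempotentElem_forall_notMem_iff (R : Type u) {B : Type u} [CommRing R]
    [HenselianLocalRing R] [CommRing B] [Algebra R B] [Module.Finite R B] (Sg : Set (Ideal B)) :
    ∃ e : B, IsIdempotentElem e ∧ ∀ q : Ideal B, q.IsMaximal → (e ∉ q ↔ q ∈ Sg) := by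
  have hfin : {q : Ideal B | q.IsMaximal}.Finite := by
    refine (Algebra.QuasiFinite.finite_primesOver (S := B) (maximalIdeal R)).subset ?_
    intro q (hq : q.IsMaximal)
    exact ⟨hq.isPrime,
      ⟨(eq_maximalIdeal (Ideal.isMaximal_comap_of_isIntegral_of_isMaximal (R := R) q)).symm⟩⟩
  choose e he heq using fun q : {q : Ideal B // q.IsMaximal} ↦
    have := q.2
    exists_isIdempotentElem_notMem_iff (R := R) q.1
  have hs : {q : {q : Ideal B // q.IsMaximal} | q.1 ∈ Sg}.Finite := by
    have : Finite {q : Ideal B // q.IsMaximal} := hfin.to_subtype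
    exact Set.toFinite _
  -- The union of the idempotents `e q`: it avoids a maximal ideal exactly when one of them does.
  refine ⟨1 - ∏ q ∈ hs.toFinset, (1 - e q), IsIdempotentElem.one_sub ?_, fun q hq ↦ ?_⟩
  · rw [IsIdempotentElem, ← Finset.prod_mul_distrib]
    exact Finset.prod_congr rfl fun q _ ↦ (he q).one_sub
  · by_cases hqS : q ∈ Sg
    · have h1 : 1 - e ⟨q, hq⟩ ∈ q := by
        refine (hq.isPrime.mem_or_mem (x := e ⟨q, hq⟩) ?_).resolve_left ((heq ⟨q, hq⟩ q hq).mpr rfl)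
        rw [mul_sub, mul_one, (he _).eq, sub_self]
        exact zero_mem _
      have h2 : ∏ q ∈ hs.toFinset, (1 - e q) ∈ q :=
        Ideal.mem_of_dvd _ (Finset.dvd_prod_of_mem (fun q ↦ 1 - e q)
          (a := ⟨q, hq⟩) (by simpa using hqS)) h1
      simp only [hqS, iff_true]
      intro h
      exact hq.ne_top ((Ideal.eq_top_iff_one _).mpr (by simpa using add_mem h h2))
    · simp only [hqS, iff_false, not_not]
      rw [← Ideal.Quotient.eq_zero_iff_mem, map_sub, map_one, map_prod, sub_eq_zero, eq_comm]
      refine Finset.prod_eq_one fun q' hq' ↦ ?_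
      have : e q' ∈ q := by
        by_contra h
        have := (heq q' q hq).mp h
        exact hqS (this ▸ by simpa using hq')
      rw [map_sub, map_one, Ideal.Quotient.eq_zero_iff_mem.mpr this, sub_zero]

/-- A simple root is determined by its residue classes. -/
lemma eq_of_eval_eq_zero_of_sub_mem_jacobson {B : Type*} [CommRing B] {f : B[X]} {a b : B}
    (ha : f.eval a = 0) (hb : f.eval b = 0) (h : b - a ∈ Ideal.jacobson (⊥ : Ideal B))
    (h' : IsUnit (f.derivative.eval a)) : a = b := by
  -- Taylor expansion gives `0 = f(b) - f(a) = (f'(a) + c (b - a)) (b - a)`, whose first factor is a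
  -- unit modulo the radical.
  obtain ⟨c, hc⟩ := exists_mul_sq_add_linear_part_eq_eval_add f a (b - a)
  have h1 : IsUnit (f.derivative.eval a + c * (b - a)) := by
    obtain ⟨v, hv⟩ := h'
    rw [← hv]
    have := Ideal.mem_jacobson_bot.mp h (c * ↑v⁻¹)
    have h2 : (v : B) + c * (b - a) = v * ((b - a) * (c * ↑v⁻¹) + 1) := by
      have := v.mul_inv
      linear_combination (-(c * (b - a))) * this
    rw [h2]
    exact v.isUnit.mul this
  have h2 : (f.derivative.eval a + c * (b - a)) * (b - a) = 0 := by
    have : a + (b - a) = b := by ring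
    rw [this] at hc
    grind
  exact (sub_eq_zero.mp (h1.mul_right_eq_zero.mp h2)).symm

/-- A surjection onto a projective module algebra is an isomorphism if its kernel lies in the
Jacobson radical. -/
lemma injective_of_projective_of_ker_le_jacobson {B D : Type*} [CommRing B] [CommRing D]
    [Algebra B D] [Module.Projective B D] (hs : Function.Surjective (algebraMap B D))
    (hk : RingHom.ker (algebraMap B D) ≤ Ideal.jacobson ⊥) :
    Function.Injective (algebraMap B D) := by
  -- For a splitting `σ`, the element `σ 1` is `1` modulo the kernel, hence a unit. A kernel element
  -- `k` satisfies `k * σ 1 = σ (k • 1) = 0`.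
  obtain ⟨σ, hσ⟩ := Module.projective_lifting_property (Algebra.linearMap B D) LinearMap.id hs
  have h1 : algebraMap B D (σ 1) = 1 := DFunLike.congr_fun hσ 1
  have h2 : 1 - σ 1 ∈ RingHom.ker (algebraMap B D) := by
    rw [RingHom.mem_ker, map_sub, h1, map_one, sub_self]
  have h3 : IsUnit (σ 1) := by
    simpa using Ideal.mem_jacobson_bot.mp (hk h2) (-1)
  rw [injective_iff_map_eq_zero]
  intro k hk0
  have : k * σ 1 = 0 := by
    rw [← smul_eq_mul, ← map_smul, Algebra.smul_def, hk0, zero_mul, map_zero]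
  exact h3.mul_left_eq_zero.mp this

/-- A direct factor of an algebra that is projective as a module is projective. -/
lemma exists_projective_quotient_of_isIdempotentElem {B A : Type u} [CommRing B] [CommRing A]
    [Algebra B A] [Module.Projective B A] [Module.Finite B A] {e : A} (he : IsIdempotentElem e) :
    ∃ (D : Type u) (_ : CommRing D) (_ : Algebra B D) (π : A →ₐ[B] D), Function.Surjective π ∧
      RingHom.ker π.toRingHom = Ideal.span {1 - e} ∧ Module.Projective B D ∧
      Module.Finite B D := by
  have hs : Function.Surjective (Ideal.Quotient.mkₐ B (Ideal.span {1 - e})) :=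
    Ideal.Quotient.mk_surjective
  refine ⟨A ⧸ Ideal.span {1 - e}, inferInstance, inferInstance, Ideal.Quotient.mkₐ B _,
    hs, Ideal.mk_ker, ?_, .of_surjective (Ideal.Quotient.mkₐ B (Ideal.span {1 - e})).toLinearMap hs⟩
  -- Multiplication by `e` kills `1 - e` and splits the projection.
  let s : (A ⧸ Ideal.span {1 - e}) →ₗ[B] A := Submodule.liftQ
    ((Ideal.span {1 - e}).restrictScalars B) (LinearMap.mulLeft B e) (by
      intro z (hz : z ∈ Ideal.span {1 - e})
      obtain ⟨w, rfl⟩ := Ideal.mem_span_singleton'.mp hz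
      rw [LinearMap.mem_ker, LinearMap.mulLeft_apply, mul_left_comm, mul_sub, mul_one, he.eq,
        sub_self, mul_zero])
  refine Module.Projective.of_split s (Ideal.Quotient.mkₐ B _).toLinearMap ?_
  refine LinearMap.ext fun z ↦ ?_
  obtain ⟨z, rfl⟩ := Ideal.Quotient.mk_surjective z
  change Ideal.Quotient.mk _ (e * z) = Ideal.Quotient.mk _ z
  rw [Ideal.Quotient.eq, Ideal.mem_span_singleton]
  exact ⟨-z, by ring⟩

/-- A finite algebra over a henselian local ring is henselian along every ideal in its Jacobson
radical. -/
lemma exists_isRoot_of_finite (R : Type u) {B : Type u} [CommRing R] [HenselianLocalRing R]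
    [CommRing B] [Algebra R B] [Module.Finite R B] {J : Ideal B} (hJ : J ≤ Ideal.jacobson ⊥)
    {f : B[X]} (hf : f.Monic) {b₀ : B} (h0 : f.eval b₀ ∈ J) (h1 : IsUnit (f.derivative.eval b₀)) :
    ∃ b, f.IsRoot b ∧ b - b₀ ∈ J := by
  have := hf.finite_adjoinRoot
  have := hf.free_adjoinRoot
  have : Module.Finite R (AdjoinRoot f) := .trans B _
  -- `D` will be the factor of `AdjoinRoot f` on which the tautological root and `b₀` agree at all
  -- maximal ideals. The aim is to show that `B → D` is bijective; the tautological root then lies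
  -- in `B`.
  let t : AdjoinRoot f := AdjoinRoot.root f - algebraMap B _ b₀
  obtain ⟨e, he, heq⟩ := exists_isIdempotentElem_forall_notMem_iff R
    {n : Ideal (AdjoinRoot f) | t ∈ n}
  obtain ⟨D, _, _, π, hπ, hπk, hproj, hfinD⟩ :=
    exists_projective_quotient_of_isIdempotentElem (B := B) he
  have hπe : π e = 1 := by
    have : 1 - e ∈ RingHom.ker π.toRingHom := hπk ▸ Ideal.mem_span_singleton_self _
    have : π (1 - e) = 0 := this
    rw [map_sub, map_one, sub_eq_zero] at this
    exact this.symm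
  have htj : π t ∈ Ideal.jacobson (⊥ : Ideal D) := by
    rw [Ideal.jacobson, Ideal.mem_sInf]
    rintro n ⟨-, hn⟩
    have : (n.comap π).IsMaximal := Ideal.comap_isMaximal_of_surjective π hπ
    refine (heq (n.comap π) this).mp fun h ↦ hn.ne_top ?_
    rw [Ideal.mem_comap, hπe] at h
    exact (Ideal.eq_top_iff_one _).mpr h
  -- Expanding `f` at `b₀` and evaluating at the root gives `0 = f(b₀) + π t * (f'(b₀) + c * π t)`,
  -- with the bracket a unit since `π t` is in the radical. So `π t` lies in `J D`.
  have hrel : ∃ w : D, IsUnit w ∧ algebraMap B D (f.eval b₀) = - (π t * w) := by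
    obtain ⟨c, hc⟩ := exists_mul_sq_add_linear_part_eq_eval_add (f.map (algebraMap B D))
      (algebraMap B D b₀) (π t)
    have hroot : algebraMap B D b₀ + π t = π (AdjoinRoot.root f) := by
      simp only [t, map_sub, AlgHom.commutes]
      ring
    have hz : (f.map (algebraMap B D)).eval (π (AdjoinRoot.root f)) = 0 := by
      rw [eval_map_algebraMap, aeval_algHom_apply, AdjoinRoot.aeval_eq, AdjoinRoot.mk_self,
        map_zero]
    rw [hroot, hz, derivative_map, eval_map_algebraMap, eval_map_algebraMap,
      aeval_algebraMap_apply_eq_algebraMap_eval, aeval_algebraMap_apply_eq_algebraMap_eval] at hc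
    obtain ⟨v, hv⟩ := h1.map (algebraMap B D)
    refine ⟨v + c * π t, ?_, ?_⟩
    · have := Ideal.mem_jacobson_bot.mp htj (c * ↑v⁻¹)
      have h2 : (v : D) + c * π t = v * (π t * (c * ↑v⁻¹) + 1) := by
        have := v.mul_inv
        linear_combination (-(c * π t)) * this
      rw [h2]
      exact v.isUnit.mul this
    · rw [← hv] at hc
      linear_combination hc
  obtain ⟨w, hw, hrel⟩ := hrel
  have htJ : π t ∈ J.map (algebraMap B D) := by
    have : π t = - algebraMap B D (f.eval b₀) * ↑hw.unit⁻¹ := by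
      rw [hrel, neg_neg, mul_assoc, hw.mul_val_inv, mul_one]
    rw [this]
    exact Ideal.mul_mem_right _ _ (neg_mem (Ideal.mem_map_of_mem _ h0))
  -- Modulo `J D` the root is `b₀`, so `D` is spanned by `1`, and Nakayama applies.
  have hsurj : Function.Surjective (algebraMap B D) := by
    let N : Submodule B D := LinearMap.range (Algebra.linearMap B D)
    have hN : N = ⊤ := by
      refine top_le_iff.mp (Submodule.le_of_le_smul_of_le_jacobson_bot (I := J) (N := N)
        hfinD.fg_top hJ fun z _ ↦ ?_)
      obtain ⟨z, rfl⟩ := hπ z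
      obtain ⟨p, rfl⟩ := AdjoinRoot.mk_surjective z
      have h2 : AdjoinRoot.mk f p - algebraMap B _ (p.eval b₀) ∈ Ideal.span {t} := by
        rw [Ideal.mem_span_singleton, ← AdjoinRoot.aeval_eq,
          ← aeval_algebraMap_apply_eq_algebraMap_eval]
        simp only [← eval_map_algebraMap]
        exact sub_dvd_eval_sub _ _ _
      have h3 : π (AdjoinRoot.mk f p) - algebraMap B D (p.eval b₀) ∈ J.map (algebraMap B D) := by
        obtain ⟨y, hy⟩ := Ideal.mem_span_singleton'.mp h2
        have : π (AdjoinRoot.mk f p) - algebraMap B D (p.eval b₀) = π y * π t := by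
          rw [← map_mul, hy, map_sub, AlgHom.commutes]
        rw [this]
        exact Ideal.mul_mem_left _ _ htJ
      rw [Submodule.mem_sup]
      refine ⟨algebraMap B D (p.eval b₀), ⟨_, rfl⟩,
        π (AdjoinRoot.mk f p) - algebraMap B D (p.eval b₀), ?_, add_sub_cancel _ _⟩
      rwa [Ideal.smul_top_eq_map]
    intro z
    obtain ⟨b, hb⟩ := (hN.ge : ⊤ ≤ N) (x := z) trivial
    exact ⟨b, hb⟩
  -- For a maximal ideal `q`, which contains `J`, sending the root to `b₀` defines a point of
  -- `AdjoinRoot f` over `q`. There `t` vanishes, so the point lies on the component `D`, and an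
  -- element of `B` that dies in `D` must be in `q`.
  have hker : RingHom.ker (algebraMap B D) ≤ Ideal.jacobson ⊥ := by
    rw [Ideal.jacobson, le_sInf_iff]
    rintro q ⟨-, hq⟩ b hb
    let φ : AdjoinRoot f →+* B ⧸ q := AdjoinRoot.lift (Ideal.Quotient.mk q)
      (Ideal.Quotient.mk q b₀) (by
        rw [eval₂_at_apply, Ideal.Quotient.eq_zero_iff_mem]
        have := hJ h0
        rw [Ideal.jacobson, Ideal.mem_sInf] at this
        exact this ⟨bot_le, hq⟩)
    have hφs : Function.Surjective φ := by
      intro z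
      obtain ⟨b, rfl⟩ := Ideal.Quotient.mk_surjective z
      exact ⟨algebraMap B _ b, AdjoinRoot.lift_of _⟩
    have hmax : (RingHom.ker φ).IsMaximal := by
      let := Ideal.Quotient.field q
      exact RingHom.ker_isMaximal_of_surjective φ hφs
    have he' : e ∉ RingHom.ker φ := by
      refine (heq _ hmax).mpr ?_
      change φ (AdjoinRoot.root f - AdjoinRoot.of f b₀) = 0
      rw [map_sub, AdjoinRoot.lift_root, AdjoinRoot.lift_of, sub_self]
    have he'' : 1 - e ∈ RingHom.ker φ := by
      refine (hmax.isPrime.mem_or_mem (x := e) ?_).resolve_left he'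
      rw [mul_sub, mul_one, he.eq, sub_self]
      exact zero_mem _
    have hb' : algebraMap B (AdjoinRoot f) b ∈ Ideal.span {1 - e} := by
      rw [← hπk]
      exact (π.commutes b).trans hb
    have := (Ideal.span_singleton_le_iff_mem (RingHom.ker φ)).mpr he'' hb'
    rw [RingHom.mem_ker] at this
    rw [← Ideal.Quotient.eq_zero_iff_mem, ← this]
    exact (AdjoinRoot.lift_of _).symm
  have hinj := injective_of_projective_of_ker_le_jacobson hsurj hker
  obtain ⟨b, hb⟩ := hsurj (π (AdjoinRoot.root f))
  refine ⟨b, hinj ?_, ?_⟩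
  · rw [map_zero, ← aeval_algebraMap_apply_eq_algebraMap_eval, hb, aeval_algHom_apply,
      AdjoinRoot.aeval_eq, AdjoinRoot.mk_self, map_zero]
  · have : π t = algebraMap B D (b - b₀) := by
      simp only [t, map_sub, AlgHom.commutes, hb]
    rw [this] at htJ
    obtain ⟨j, hj, hjb⟩ := (Ideal.mem_map_iff_of_surjective _ hsurj).mp htJ
    exact hinj hjb ▸ hj

end

/-! ### The henselization of a local ring -/

section Henselization

open Polynomial IsLocalRing

variable {A : Type u} [CommRing A] [IsLocalRing A]

/-- The map from the residue field induced by an algebra killed by the maximal ideal. -/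
noncomputable def residueFieldToQuotient (B : Type u) [CommRing B] [Algebra A B] :
    ResidueField A →ₐ[A] B ⧸ (maximalIdeal A).map (algebraMap A B) :=
  Ideal.Quotient.liftₐ (maximalIdeal A) (Algebra.ofId A _) fun a ha ↦ by
    rw [Algebra.ofId_apply, IsScalarTower.algebraMap_apply A B, Ideal.Quotient.algebraMap_eq,
      Ideal.Quotient.eq_zero_iff_mem]
    exact Ideal.mem_map_of_mem _ ha

lemma residueFieldToQuotient_residue (B : Type u) [CommRing B] [Algebra A B] (a : A) :
    residueFieldToQuotient B (residue A a) = Ideal.Quotient.mk _ (algebraMap A B a) := rfl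

variable (P : EtaleNhd A)

lemma EtaleNhd.hasMap_point : P.pair.HasMap (P.point P.pair.X) :=
  StandardEtalePair.hasMap_X.map P.point

lemma residue_eval (p : A[X]) (c : A) : residue A (p.eval c) = aeval (residue A c) p := by
  rw [← ResidueField.algebraMap_eq, aeval_algebraMap_apply, aeval_def, Algebra.algebraMap_self,
    eval₂_id]

/-- Translates the point with values in the residue field into an approximate simple root `c` in
`A`, the form that Hensel's lemma accepts. -/
lemma EtaleNhd.exists_residue : ∃ c : A, residue A c = P.point P.pair.X ∧
    P.pair.f.eval c ∈ maximalIdeal A ∧ IsUnit (P.pair.f.derivative.eval c) ∧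
    IsUnit (P.pair.g.eval c) := by
  obtain ⟨c, hc⟩ := residue_surjective (P.point P.pair.X)
  have hm := P.hasMap_point
  refine ⟨c, hc, ?_, ?_, ?_⟩
  · rw [← residue_eq_zero_iff, residue_eval, hc, hm.1]
  · rw [← isUnit_map_iff (residue A), residue_eval, hc]
    exact hm.isUnit_derivative_f
  · rw [← isUnit_map_iff (residue A), residue_eval, hc]
    exact hm.2

/-- An étale neighbourhood maps uniquely, compatibly with the residue fields, to every finite
algebra over a henselian local ring. -/
lemma EtaleNhd.existsUnique_lift (R : Type u) [CommRing R] [HenselianLocalRing R] {B : Type u}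
    [CommRing B] [Algebra R B] [Module.Finite R B] [Algebra A B]
    (hJ : (maximalIdeal A).map (algebraMap A B) ≤ Ideal.jacobson ⊥) :
    ∃! ρ : P.pair.Ring →ₐ[A] B,
      (Ideal.Quotient.mkₐ A _).comp ρ = (residueFieldToQuotient B).comp P.point := by
  obtain ⟨c, hc, hc0, hc1, hc2⟩ := P.exists_residue
  have hev (p : A[X]) (a : A) : (p.map (algebraMap A B)).eval (algebraMap A B a) =
      algebraMap A B (p.eval a) := by rw [eval_map_algebraMap,
        aeval_algebraMap_apply_eq_algebraMap_eval]
  have hunit (b : B) (h : b - algebraMap A B c ∈ (maximalIdeal A).map (algebraMap A B))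
      (p : A[X]) (hp : IsUnit (p.eval c)) : IsUnit (aeval b p) := by
    have := isLocalHom_of_le_jacobson_bot _ hJ
    rw [← isUnit_map_iff (Ideal.Quotient.mk ((maximalIdeal A).map (algebraMap A B)))]
    have h2 : Ideal.Quotient.mk ((maximalIdeal A).map (algebraMap A B)) (aeval b p) =
        Ideal.Quotient.mk _ (algebraMap A B (p.eval c)) := by
      rw [Ideal.Quotient.eq, ← hev, ← eval_map_algebraMap]
      exact Ideal.mem_of_dvd _ (sub_dvd_eval_sub _ _ _) h
    rw [h2]
    exact (hp.map _).map _
  have hcomp (ρ : P.pair.Ring →ₐ[A] B)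
      (h : (Ideal.Quotient.mkₐ A _).comp ρ = (residueFieldToQuotient B).comp P.point) :
      ρ P.pair.X - algebraMap A B c ∈ (maximalIdeal A).map (algebraMap A B) := by
    have := DFunLike.congr_fun h P.pair.X
    rw [AlgHom.comp_apply, AlgHom.comp_apply, ← hc, residueFieldToQuotient_residue] at this
    exact Ideal.Quotient.eq.mp this
  -- Compatibility with the points prescribes the image of the coordinate modulo the maximal ideal
  -- of `A`. It lifts to a root by the henselian property of `B`, and to only one because the root
  -- is simple.
  obtain ⟨b, hb, hbc⟩ := exists_isRoot_of_finite R hJ (P.pair.monic_f.map (algebraMap A B))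
    (b₀ := algebraMap A B c) (by rw [hev]; exact Ideal.mem_map_of_mem _ hc0)
    (by rw [derivative_map, hev]; exact hc1.map _)
  have hbm : P.pair.HasMap b :=
    ⟨by rw [← eval_map_algebraMap]; exact hb, hunit b hbc _ hc2⟩
  refine ⟨P.pair.lift b hbm, StandardEtalePair.hom_ext ?_, fun ρ hρ ↦ StandardEtalePair.hom_ext ?_⟩
  · rw [AlgHom.comp_apply, AlgHom.comp_apply, ← hc, residueFieldToQuotient_residue,
      StandardEtalePair.lift_X]
    exact Ideal.Quotient.eq.mpr hbc
  · rw [StandardEtalePair.lift_X]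
    refine eq_of_eval_eq_zero_of_sub_mem_jacobson (f := P.pair.f.map (algebraMap A B)) ?_ hb
      (hJ ?_) ?_
    · rw [eval_map_algebraMap]
      exact (StandardEtalePair.hasMap_X.map ρ).1
    · have := sub_mem hbc (hcomp ρ hρ)
      rwa [sub_sub_sub_cancel_right] at this
    · rw [derivative_map, eval_map_algebraMap]
      exact hunit _ (hcomp ρ hρ) _ hc1

/-- The henselization maps to every finite algebra over a henselian local ring in which the maximal
ideal generates an ideal inside the Jacobson radical. -/
lemma nonempty_henselization_algHom (R : Type u) [CommRing R] [HenselianLocalRing R] {B : Type u}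
    [CommRing B] [Algebra R B] [Module.Finite R B] [Algebra A B]
    (hJ : (maximalIdeal A).map (algebraMap A B) ≤ Ideal.jacobson ⊥) :
    Nonempty (henselization A →ₐ[A] B) := by
  choose ρ hρ hu using fun P : EtaleNhd A ↦ P.existsUnique_lift R hJ
  let s : Cocone (EtaleNhd.diagram A) :=
    { pt := CommAlgCat.of A B
      ι :=
        { app P := CommAlgCat.ofHom (ρ P)
          naturality P P' φ := by
            ext1
            -- Uniqueness of the lifts makes them compatible with the transition maps.
            refine hu P _ ?_
            let ψ : P.pair.Ring →ₐ[A] P'.pair.Ring := ((EtaleNhd.diagram A).map φ).hom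
            have h1 : P'.point.comp ψ = P.point := congr(($(Over.w φ.hom)).hom)
            have h2 : (Ideal.Quotient.mkₐ A _).comp ((ρ P').comp ψ) =
                (residueFieldToQuotient B).comp P.point := by
              rw [← AlgHom.comp_assoc, hρ P', AlgHom.comp_assoc, h1]
            exact h2 } }
  exact ⟨(colimit.desc (EtaleNhd.diagram A) s).hom⟩

/-- The étale neighbourhood obtained by removing the other points of the closed fibre. -/
lemma EtaleNhd.exists_shrink : ∃ (P' : EtaleNhd A) (φ : P.pair.Ring →ₐ[A] P'.pair.Ring),
    P'.point.comp φ = P.point ∧ ∀ w : P'.pair.Ring, ∃ c : A,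
      w - algebraMap A _ c ∈ (maximalIdeal A).map (algebraMap A P'.pair.Ring) := by
  obtain ⟨c, hc, hc0, hc1, hc2⟩ := P.exists_residue
  -- The cofactor `k` of the root `c` cuts out the other points of the closed fibre, and `k(c) =
  -- f'(c)` is a unit. Once `k` is inverted, `(X - c) k(X) = -f(c)` puts `X - c` in the ideal
  -- generated by the maximal ideal.
  obtain ⟨k, hk⟩ : ∃ k : A[X], P.pair.f = (X - C c) * k + C (P.pair.f.eval c) := by
    refine ⟨P.pair.f /ₘ (X - C c), ?_⟩
    have := modByMonic_add_div P.pair.f (X - C c)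
    rw [modByMonic_X_sub_C_eq_C_eval] at this
    rw [add_comm]
    exact this.symm
  have hkc : IsUnit (k.eval c) := by
    have := congr((derivative $hk).eval c)
    simp only [derivative_add, derivative_mul, derivative_sub, derivative_X, derivative_C, eval_add,
      eval_mul, eval_sub, eval_X, eval_C, sub_self, zero_mul, add_zero, sub_zero, one_mul] at this
    exact this ▸ hc1
  have hmk (x : ResidueField A) (hx : x = residue A c) : IsUnit (aeval x k) := by
    rw [hx, ← residue_eval]
    exact hkc.map _
  let pr : StandardEtalePair A :=
    { f := P.pair.f
      monic_f := P.pair.monic_f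
      g := P.pair.g * k
      cond := by
        obtain ⟨p₁, p₂, n, h⟩ := P.pair.cond
        exact ⟨p₁ * k ^ n, p₂ * k ^ n, n, by rw [mul_pow, ← h]; ring⟩ }
  have hpt : pr.HasMap (P.point P.pair.X) :=
    ⟨P.hasMap_point.1, by
      change IsUnit (aeval _ (P.pair.g * k))
      rw [map_mul]
      exact P.hasMap_point.2.mul (hmk _ hc.symm)⟩
  have hX : P.pair.HasMap pr.X :=
    ⟨StandardEtalePair.hasMap_X.1, by
      have : IsUnit (aeval pr.X (P.pair.g * k)) := StandardEtalePair.hasMap_X.2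
      rw [map_mul] at this
      exact isUnit_of_mul_isUnit_left this⟩
  have hkX : IsUnit (aeval pr.X k) := by
    have : IsUnit (aeval pr.X (P.pair.g * k)) := StandardEtalePair.hasMap_X.2
    rw [map_mul] at this
    exact isUnit_of_mul_isUnit_right this
  have hXc : pr.X - algebraMap A _ c ∈ (maximalIdeal A).map (algebraMap A pr.Ring) := by
    have h1 : aeval pr.X P.pair.f = 0 := StandardEtalePair.hasMap_X.1
    rw [hk, map_add, map_mul, map_sub, aeval_X, aeval_C, aeval_C] at h1
    have h2 : pr.X - algebraMap A _ c = - algebraMap A _ (P.pair.f.eval c) * ↑hkX.unit⁻¹ := by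
      rw [← eq_neg_iff_add_eq_zero] at h1
      rw [← h1, mul_assoc, hkX.mul_val_inv, mul_one]
    rw [h2]
    exact Ideal.mul_mem_right _ _ (neg_mem (Ideal.mem_map_of_mem _ hc0))
  refine ⟨⟨pr, pr.lift _ hpt⟩, P.pair.lift pr.X hX, StandardEtalePair.hom_ext ?_, fun w ↦ ?_⟩
  · rw [AlgHom.comp_apply, StandardEtalePair.lift_X, StandardEtalePair.lift_X]
  · obtain ⟨d, hd⟩ := residue_surjective (pr.lift _ hpt w)
    refine ⟨d, ?_⟩
    have h : (Ideal.Quotient.mkₐ A _) = (residueFieldToQuotient pr.Ring).comp (pr.lift _ hpt) := by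
      refine StandardEtalePair.hom_ext ?_
      rw [AlgHom.comp_apply, StandardEtalePair.lift_X, ← hc, residueFieldToQuotient_residue]
      exact Ideal.Quotient.eq.mpr hXc
    have := DFunLike.congr_fun h w
    rw [AlgHom.comp_apply, ← hd, residueFieldToQuotient_residue] at this
    exact Ideal.Quotient.eq.mp this

/-- The structure map from an étale neighbourhood to the henselization. -/
noncomputable def EtaleNhd.toHenselization : P.pair.Ring →ₐ[A] henselization A :=
  (colimit.ι (EtaleNhd.diagram A) P).hom

variable (A) in
/-- The closed fibre of the henselization is the residue field. -/
lemma henselization_sub_mem (a : henselization A) : ∃ c : A,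
    a - algebraMap A _ c ∈ (maximalIdeal A).map (algebraMap A (henselization A)) := by
  let I := (maximalIdeal A).map (algebraMap A (henselization A))
  -- `E` consists of the elements congruent to an element of `A`. It contains the image of every
  -- étale neighbourhood, after shrinking, and so is everything by the universal property of the
  -- colimit.
  let E : Subalgebra A (henselization A) :=
    (AlgHom.range (Algebra.ofId A (henselization A ⧸ I))).comap (Ideal.Quotient.mkₐ A I)
  have hE (a : henselization A) : a ∈ E ↔ ∃ c : A, a - algebraMap A _ c ∈ I := by
    refine exists_congr fun c ↦ ?_
    rw [← Ideal.Quotient.eq, eq_comm]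
    rfl
  have hmem (P : EtaleNhd A) (w : P.pair.Ring) : P.toHenselization w ∈ E := by
    obtain ⟨P', φ, hφ, hP'⟩ := P.exists_shrink
    let φ' : EtaleNhd.toOver A P ⟶ EtaleNhd.toOver A P' :=
      Over.homMk (CommAlgCat.ofHom φ) (by ext1; exact hφ)
    let P₁ : InducedCategory (Over (CommAlgCat.of A (ResidueField A))) (EtaleNhd.toOver A) := P
    let P₂ : InducedCategory (Over (CommAlgCat.of A (ResidueField A))) (EtaleNhd.toOver A) := P'
    have h1 : P'.toHenselization (φ w) = P.toHenselization w :=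
      congr(($(colimit.w (EtaleNhd.diagram A) (InducedCategory.homMk φ' : P₁ ⟶ P₂))).hom w)
    obtain ⟨c, hc⟩ := hP' (φ w)
    refine (hE _).mpr ⟨c, ?_⟩
    have h2 := Ideal.mem_map_of_mem P'.toHenselization hc
    rw [map_sub, AlgHom.commutes, h1] at h2
    refine (Ideal.map_le_iff_le_comap.mpr ?_ : _ ≤ I) h2
    rw [Ideal.map_le_iff_le_comap]
    intro a ha
    rw [Ideal.mem_comap, Ideal.mem_comap, AlgHom.commutes]
    exact Ideal.mem_map_of_mem _ ha
  let s : Cocone (EtaleNhd.diagram A) :=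
    { pt := CommAlgCat.of A E
      ι :=
        { app P := CommAlgCat.ofHom (P.toHenselization.codRestrict E (hmem P))
          naturality P P' φ := by
            ext1
            refine AlgHom.ext fun w ↦ Subtype.ext ?_
            exact congr(($(colimit.w (EtaleNhd.diagram A) φ)).hom w) } }
  -- The induced map from the colimit to `E` is a section of the inclusion, so each element equals
  -- its image in `E`.
  have hid : colimit.desc (EtaleNhd.diagram A) s ≫ CommAlgCat.ofHom E.val = 𝟙 _ := by
    refine colimit.hom_ext fun P ↦ ?_
    rw [colimit.ι_desc_assoc]
    exact (Category.comp_id (colimit.ι (EtaleNhd.diagram A) P)).symm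
  rw [← hE]
  have := congr(($hid).hom a)
  have h2 : ((colimit.desc (EtaleNhd.diagram A) s).hom a : E).1 = a := this
  rw [← h2]
  exact ((colimit.desc (EtaleNhd.diagram A) s).hom a).2

end Henselization

/-! ### Algebras acting on finite modules -/

section Algebra

open IsLocalRing

/-- The image of an algebra in the endomorphisms of a finite module over a noetherian ring is
finite. -/
lemma finite_quotient_annihilator (R : Type*) [CommRing R] [IsNoetherianRing R] {E M : Type*}
    [CommRing E] [Algebra R E] [AddCommGroup M] [Module R M] [Module E M] [IsScalarTower R E M]
    [Module.Finite R M] : Module.Finite R (E ⧸ Module.annihilator E M) := by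
  obtain ⟨n, s, hs⟩ := Module.Finite.exists_fin (R := R) (M := M)
  -- Evaluation on generators embeds the quotient in `M ^ n`, a noetherian `R`-module.
  let φ : E →ₗ[R] (Fin n → M) :=
    { toFun e i := e • s i
      map_add' a b := by ext i; exact add_smul a b _
      map_smul' r a := by ext i; exact smul_assoc r a _ }
  have hφ : LinearMap.ker φ = (Module.annihilator E M).restrictScalars R := by
    ext e
    simp only [LinearMap.mem_ker, Submodule.restrictScalars_mem, Module.mem_annihilator]
    refine ⟨fun h m ↦ ?_, fun h ↦ funext fun i ↦ h _⟩
    have hm : m ∈ Submodule.span R (Set.range s) := hs ▸ Submodule.mem_top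
    induction hm using Submodule.span_induction with
    | mem x hx => obtain ⟨i, rfl⟩ := hx; exact congr_fun h i
    | zero => exact smul_zero e
    | add x y _ _ hx hy => rw [smul_add, hx, hy, add_zero]
    | smul r x _ hx => rw [smul_algebra_smul_comm, hx, smul_zero]
  have h : Module.Finite R (E ⧸ LinearMap.ker φ) :=
    Module.Finite.equiv φ.quotKerEquivRange.symm
  rw [hφ] at h
  exact h

/-- Modulo `m_R` the algebra is finite over a field, hence artinian, and its radical is nilpotent.
-/
lemma exists_pow_le_map_maximalIdeal (R : Type*) [CommRing R] [IsLocalRing R] {B : Type*}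
    [CommRing B] [Algebra R B] [Module.Finite R B] {J : Ideal B} (hJ : J ≤ Ideal.jacobson ⊥) :
    ∃ n, J ^ n ≤ (maximalIdeal R).map (algebraMap R B) := by
  set I := (maximalIdeal R).map (algebraMap R B) with hI
  have : Module.Finite (R ⧸ maximalIdeal R) (B ⧸ I) := Module.Finite.of_restrictScalars_finite R _ _
  let := Ideal.Quotient.field (maximalIdeal R)
  have : IsArtinianRing (B ⧸ I) := IsArtinianRing.of_finite (R ⧸ maximalIdeal R) _
  obtain ⟨n, hn⟩ := IsArtinianRing.isNilpotent_jacobson_bot (R := B ⧸ I)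
  refine ⟨n, ?_⟩
  rw [← Ideal.mk_ker (I := I), RingHom.ker_eq_comap_bot, ← Ideal.map_le_iff_le_comap,
    Ideal.map_pow]
  refine (Ideal.pow_right_mono ?_ n).trans hn.le
  rw [Ideal.map_le_iff_le_comap, Ideal.comap_jacobson_of_surjective Ideal.Quotient.mk_surjective]
  exact hJ.trans (Ideal.jacobson_mono bot_le)

/-- A finite algebra generated by the image of the henselization of `A` is generated by the image
of `A`. -/
lemma adjoin_range_algebraMap_eq_top (R : Type*) [CommRing R] [IsLocalRing R] {A : Type u}
    [CommRing A] [IsLocalRing A] {B : Type u}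
    [CommRing B] [Algebra R B] [Module.Finite R B] [Algebra A B]
    (hJ : (maximalIdeal A).map (algebraMap A B) ≤ Ideal.jacobson ⊥) (σ : henselization A →ₐ[A] B)
    (h : Algebra.adjoin R (Set.range σ) = ⊤) :
    Algebra.adjoin R (Set.range (algebraMap A B)) = ⊤ := by
  obtain ⟨n, hn⟩ := exists_pow_le_map_maximalIdeal R hJ
  set I := (maximalIdeal R).map (algebraMap R B) with hI
  set C := Algebra.adjoin R (Set.range (algebraMap A B)) with hC
  let N : Subalgebra R B := (C.map (Ideal.Quotient.mkₐ R I)).comap (Ideal.Quotient.mkₐ R I)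
  have hN (b : B) : b ∈ N ↔ ∃ c ∈ C, c - b ∈ I := by
    refine exists_congr fun c ↦ and_congr_right fun _ ↦ ?_
    rw [← Ideal.Quotient.eq]
    rfl
  -- Iterating `henselization_sub_mem`: every element of the henselization is in the image of `A` up
  -- to `m_A ^ k`.
  have htop (k : ℕ) : (⊤ : Submodule A (henselization A)) ≤
      LinearMap.range (Algebra.linearMap A (henselization A)) ⊔ maximalIdeal A ^ k • ⊤ := by
    induction k with
    | zero => rw [pow_zero, Ideal.one_eq_top, Submodule.top_smul]; exact le_sup_right
    | succ k ih =>
      have h1 : (⊤ : Submodule A (henselization A)) ≤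
          LinearMap.range (Algebra.linearMap A (henselization A)) ⊔ maximalIdeal A • ⊤ := by
        intro a _
        obtain ⟨c, hc⟩ := henselization_sub_mem A a
        rw [← sub_add_cancel a (algebraMap A _ c), add_comm]
        refine Submodule.add_mem_sup ⟨c, rfl⟩ ?_
        rwa [Ideal.smul_top_eq_map]
      refine ih.trans (sup_le le_sup_left ?_)
      refine (smul_mono_right _ h1).trans ?_
      rw [Submodule.smul_sup, ← mul_smul, ← pow_succ]
      exact sup_le_sup_right Submodule.smul_le_right _
  -- The error term in `m_A ^ n` lands in `m_R B` by the choice of `n`.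
  have hσ : ∀ a, σ a ∈ N := by
    intro a
    obtain ⟨_, ⟨c, rfl⟩, y, hy, rfl⟩ := Submodule.mem_sup.mp (htop n (Submodule.mem_top (x := a)))
    rw [hN]
    refine ⟨algebraMap A B c, Algebra.subset_adjoin ⟨c, rfl⟩, ?_⟩
    rw [map_add, Algebra.linearMap_apply, AlgHom.commutes, sub_add_cancel_left]
    refine neg_mem (hn ?_)
    rw [← Ideal.map_pow]
    rw [Ideal.smul_top_eq_map] at hy
    have h2 := Ideal.mem_map_of_mem σ hy
    refine (Ideal.map_le_iff_le_comap.mpr ?_ : _ ≤ _) h2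
    rw [Ideal.map_le_iff_le_comap]
    intro a ha
    rw [Ideal.mem_comap, Ideal.mem_comap, AlgHom.commutes]
    exact Ideal.mem_map_of_mem _ ha
  have h3 : N = ⊤ := by
    rw [eq_top_iff, ← h, Algebra.adjoin_le_iff]
    rintro _ ⟨a, rfl⟩
    exact hσ a
  -- Now `C` generates `B` modulo `m_R B`, and Nakayama over `R` concludes.
  have h4 : (⊤ : Submodule R B) ≤ Subalgebra.toSubmodule C := by
    refine Submodule.le_of_le_smul_of_le_jacobson_bot Module.Finite.fg_top
      (maximalIdeal_le_jacobson _) ?_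
    intro b _
    obtain ⟨c, hc, hcb⟩ := (hN b).mp (h3 ▸ Algebra.mem_top)
    rw [← sub_sub_cancel c b, sub_eq_add_neg]
    refine Submodule.add_mem_sup hc (neg_mem ?_)
    rwa [Ideal.smul_top_eq_map]
  rw [eq_top_iff]
  exact fun b _ ↦ h4 (Submodule.mem_top (x := b))

end Algebra

/-! ### Sections of sheaves of modules -/

section Sections

open TopologicalSpace Opposite

variable {Y : Scheme.{u}} {F G H : Y.Modules} {V V' W : Y.Opens}

/-- Restriction of functions. -/
def resO (h : V ≤ W) : Γ(Y, W) →+* Γ(Y, V) := (Y.presheaf.map (homOfLE h).op).hom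

variable (F) in
/-- Restriction of sections. -/
noncomputable def res (h : V ≤ W) : Γ(F, W) →+ Γ(F, V) := (F.presheaf.map (homOfLE h).op).hom

lemma map_eq_res (h : V ≤ W) (s : Γ(F, W)) : F.presheaf.map (homOfLE h).op s = res F h s := rfl

lemma res_res (h : V ≤ W) (h' : V' ≤ V) (s : Γ(F, W)) :
    res F h' (res F h s) = res F (h'.trans h) s := by
  unfold res
  have := congr($(F.presheaf.map_comp (homOfLE h).op (homOfLE h').op) s)
  exact this.symm

lemma resO_resO (h : V ≤ W) (h' : V' ≤ V) (a : Γ(Y, W)) :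
    resO h' (resO h a) = resO (h'.trans h) a := by
  have := congr($(Y.presheaf.map_comp (homOfLE h).op (homOfLE h').op) a)
  exact this.symm

lemma res_self (h : V ≤ V) (s : Γ(F, V)) : res F h s = s := by
  have := congr($(F.presheaf.map_id (op V)) s)
  exact this

lemma resO_self (h : V ≤ V) (a : Γ(Y, V)) : resO h a = a := by
  have := congr($(Y.presheaf.map_id (op V)) a)
  exact this

lemma res_smul (h : V ≤ W) (a : Γ(Y, W)) (s : Γ(F, W)) :
    res F h (a • s) = resO h a • res F h s :=
  F.map_smul (homOfLE h) a s

lemma res_bijective (h : V ≤ W) (h' : W ≤ V) : Function.Bijective (res F h) := by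
  refine Function.bijective_iff_has_inverse.mpr ⟨res F h', fun s ↦ ?_, fun s ↦ ?_⟩ <;>
    rw [res_res, res_self]

lemma app_res (φ : F ⟶ G) (h : V ≤ W) (s : Γ(F, W)) :
    φ.app V (res F h s) = res G h (φ.app W s) :=
  congr($(φ.mapPresheaf.naturality (homOfLE h).op) s)

lemma comp_app_apply (φ : F ⟶ G) (ψ : G ⟶ H) (s : Γ(F, V)) :
    (φ ≫ ψ).app V s = ψ.app V (φ.app V s) := rfl

lemma sub_app_apply (φ ψ : F ⟶ G) (s : Γ(F, V)) : (φ - ψ).app V s = φ.app V s - ψ.app V s := rfl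

lemma id_app_apply (s : Γ(F, V)) : (𝟙 F : F ⟶ F).app V s = s := rfl

lemma hom_ext_apply {φ ψ : F ⟶ G} (h : ∀ V s, φ.app V s = ψ.app V s) : φ = ψ := by
  ext V s
  exact h V s

lemma section_ext {s t : Γ(F, W)}
    (h : ∀ y ∈ W, ∃ (V : Y.Opens) (hV : V ≤ W), y ∈ V ∧ res F hV s = res F hV t) : s = t :=
  TopCat.Presheaf.IsSheaf.section_ext F.isSheaf h

lemma section_ext_of_sup {s t : Γ(F, W)} {V₁ V₂ : Y.Opens} (h₁ : V₁ ≤ W) (h₂ : V₂ ≤ W)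
    (h : W ≤ V₁ ⊔ V₂) (e₁ : res F h₁ s = res F h₁ t) (e₂ : res F h₂ s = res F h₂ t) : s = t := by
  refine section_ext fun y hy ↦ ?_
  obtain hy | hy := h hy
  exacts [⟨V₁, h₁, hy, e₁⟩, ⟨V₂, h₂, hy, e₂⟩]

lemma exists_glue {V₁ V₂ : Y.Opens} (h₁ : V₁ ≤ W) (h₂ : V₂ ≤ W) (h : W ≤ V₁ ⊔ V₂)
    (s₁ : Γ(F, V₁)) (s₂ : Γ(F, V₂))
    (e : res F (inf_le_left : V₁ ⊓ V₂ ≤ V₁) s₁ = res F (inf_le_right : V₁ ⊓ V₂ ≤ V₂) s₂) :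
    ∃ s : Γ(F, W), res F h₁ s = s₁ ∧ res F h₂ s = s₂ := by
  obtain ⟨s, hs, -⟩ := TopCat.Sheaf.existsUnique_gluing' ⟨F.presheaf, F.isSheaf⟩
    (fun b : Bool ↦ bif b then V₁ else V₂) W
    (fun b ↦ homOfLE (by cases b; exacts [h₂, h₁])) (by
      rw [iSup_bool_eq]; exact h)
    (fun b ↦ match b with | true => s₁ | false => s₂) (by
      rintro (_ | _) (_ | _)
      · rfl
      · change res F _ s₂ = res F _ s₁
        have := congr(res F (inf_comm V₁ V₂).ge $e)
        rw [res_res, res_res] at this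
        exact this.symm
      · exact e
      · rfl)
  exact ⟨s, hs true, hs false⟩

lemma bijective_app (φ : F ⟶ G) [IsIso φ] (V : Y.Opens) : Function.Bijective (φ.app V) :=
  ConcreteCategory.bijective_of_isIso _

end Sections

/-! ### Quasi-coherence in terms of sections -/

section Quasicoherent

open TopologicalSpace Opposite

variable {Y : Scheme.{u}}

/-- Sections over principal opens of affine opens are fractions. -/
def HasFractions (F : Y.Modules) : Prop :=
  ∀ (W : Y.Opens), IsAffineOpen W → ∀ a : Γ(Y, W),
    (∀ s : Γ(F, Y.basicOpen a), ∃ (n : ℕ) (t : Γ(F, W)),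
      res F (Y.basicOpen_le a) t = resO (Y.basicOpen_le a) a ^ n • s) ∧
    ∀ t : Γ(F, W), res F (Y.basicOpen_le a) t = 0 → ∃ n : ℕ, a ^ n • t = 0

variable (F : Y.Modules) {W : Y.Opens} (hW : IsAffineOpen W)

/-- The sections of `F` over an affine open set, as sections over its spectrum. -/
noncomputable def specSections (V : (Spec Γ(Y, W)).Opens) (V' : Y.Opens)
    (h : V' = hW.fromSpec ''ᵁ V) : Γ(F, V') →+ Γ(F.restrict hW.fromSpec, V) :=
  res F (V := hW.fromSpec ''ᵁ V) h.ge

lemma specSections_bijective (V : (Spec Γ(Y, W)).Opens) (V' : Y.Opens)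
    (h : V' = hW.fromSpec ''ᵁ V) : Function.Bijective (specSections F hW V V' h) :=
  res_bijective h.ge h.le

lemma appIso_fromSpec_inv (V : (Spec Γ(Y, W)).Opens) (hV : hW.fromSpec ''ᵁ V ≤ W) (a : Γ(Y, W)) :
    (hW.fromSpec.appIso V).inv ((Spec Γ(Y, W)).presheaf.map V.leTop.op
      ((Scheme.ΓSpecIso Γ(Y, W)).inv a)) = resO hV a := by
  have h : Y.presheaf.map (homOfLE hV).op ≫ (hW.fromSpec.appIso V).hom =
      (Scheme.ΓSpecIso Γ(Y, W)).inv ≫ (Spec Γ(Y, W)).presheaf.map V.leTop.op := by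
    rw [Scheme.Hom.appIso_hom', Scheme.Hom.map_appLE, Scheme.Hom.appLE, hW.fromSpec_app_self,
      Category.assoc, ← Functor.map_comp]
    rfl
  have h2 := congr($h ≫ (hW.fromSpec.appIso V).inv)
  rw [Category.assoc, Iso.hom_inv_id, Category.comp_id] at h2
  exact congr($h2.symm a)

lemma specSections_smul (V : (Spec Γ(Y, W)).Opens) (V' : Y.Opens)
    (h : V' = hW.fromSpec ''ᵁ V) (hV : V' ≤ W) (a : Γ(Y, W)) (s : Γ(F, V')) :
    specSections F hW V V' h (resO hV a • s) = a • specSections F hW V V' h s := by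
  rw [Scheme.Modules.smul_Spec_def]
  have := res_smul (F := F) h.ge (resO hV a) s
  rw [resO_resO, ← appIso_fromSpec_inv hW] at this
  exact this

lemma specSections_res (V₁ V₂ : (Spec Γ(Y, W)).Opens) (V₁' V₂' : Y.Opens)
    (h₁ : V₁' = hW.fromSpec ''ᵁ V₁) (h₂ : V₂' = hW.fromSpec ''ᵁ V₂) (h : V₁ ≤ V₂) (h' : V₁' ≤ V₂')
    (s : Γ(F, V₂')) :
    specSections F hW V₁ V₁' h₁ (res F h' s) =
      (F.restrict hW.fromSpec).presheaf.map (homOfLE h).op (specSections F hW V₂ V₂' h₂ s) := by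
  have := res_res (F := F) h₂.ge (Scheme.Hom.image_mono hW.fromSpec h) s
  refine Eq.trans ?_ this.symm
  exact res_res _ _ _

lemma image_top_fromSpec : W = hW.fromSpec ''ᵁ ⊤ := by
  rw [Scheme.Hom.image_top_eq_opensRange, hW.opensRange_fromSpec]

/-- The principal open subset of a spectrum. -/
def specBasicOpen {R : CommRingCat.{u}} (a : R) : (Spec R).Opens := PrimeSpectrum.basicOpen a

/-- Of the three axioms of a localized module, invertibility of `a` on its principal open set holds
for every sheaf of modules, which leaves the two conditions on numerators. -/
lemma isLocalizing_iff {R : CommRingCat.{u}} (M : (Spec R).Modules) :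
    IsLocalizing (modulesSpecToSheaf.obj M) ↔ ∀ a : R,
    (∀ s : Γ(M, specBasicOpen a), ∃ (n : ℕ) (t : Γ(M, ⊤)),
      res M le_top t = a ^ n • s) ∧
    ∀ t : Γ(M, ⊤), res M (le_top : specBasicOpen a ≤ ⊤) t = 0 →
      ∃ n : ℕ, a ^ n • t = 0 := by
  refine forall_congr' fun a ↦ ?_
  let r := ((modulesSpecToSheaf.obj M).obj.map (PrimeSpectrum.basicOpen a).leTop.op).hom
  refine ⟨fun (h : IsLocalizedModule.Away a r) ↦ ⟨fun s ↦ ?_, fun t ht ↦ ?_⟩,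
    fun ⟨h₁, h₂⟩ ↦ IsLocalizedModule.Away.mk_of_addCommGroup ?_ ?_ ?_⟩
  · obtain ⟨n, y, hy⟩ := h.surj _ _ s
    exact ⟨n, y, hy.symm⟩
  · obtain ⟨⟨_, n, rfl⟩, hn⟩ := (IsLocalizedModule.eq_zero_iff (.powers a) r).mp ht
    exact ⟨n, hn⟩
  · exact Scheme.Modules.isUnit_algebraMap_end_of_le_basicOpen a le_rfl
  · intro x
    obtain ⟨n, t, ht⟩ := h₁ x
    exact ⟨n, t, ht.symm⟩
  · intro x hx
    obtain ⟨n, hn⟩ := h₂ x hx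
    exact ⟨n, hn⟩

lemma isLocalizing_restrict_iff :
    IsLocalizing (modulesSpecToSheaf.obj (F.restrict hW.fromSpec)) ↔ ∀ a : Γ(Y, W),
    (∀ s : Γ(F, Y.basicOpen a), ∃ (n : ℕ) (t : Γ(F, W)),
      res F (Y.basicOpen_le a) t = resO (Y.basicOpen_le a) a ^ n • s) ∧
    ∀ t : Γ(F, W), res F (Y.basicOpen_le a) t = 0 → ∃ n : ℕ, a ^ n • t = 0 := by
  rw [isLocalizing_iff]
  refine forall_congr' fun a ↦ ?_
  let N := F.restrict hW.fromSpec
  let D : (Spec Γ(Y, W)).Opens := specBasicOpen a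
  let e : Γ(F, W) →+ Γ(N, ⊤) := specSections F hW ⊤ W (image_top_fromSpec hW)
  let e' : Γ(F, Y.basicOpen a) →+ Γ(N, D) :=
    specSections F hW D (Y.basicOpen a) (hW.fromSpec_image_basicOpen a).symm
  have he : Function.Bijective e := specSections_bijective ..
  have he' : Function.Bijective e' := specSections_bijective ..
  have hsq (t : Γ(F, W)) : e' (res F (Y.basicOpen_le a) t) = res N le_top (e t) :=
    specSections_res F hW _ _ _ _ _ _ le_top _ t
  have hs (n : ℕ) (t : Γ(F, W)) : e (a ^ n • t) = a ^ n • e t := by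
    have := specSections_smul F hW ⊤ W (image_top_fromSpec hW) le_rfl (a ^ n) t
    rwa [resO_self] at this
  have hs' (n : ℕ) (s : Γ(F, Y.basicOpen a)) :
      e' (resO (Y.basicOpen_le a) a ^ n • s) = a ^ n • e' s := by
    rw [← map_pow]
    exact specSections_smul F hW _ _ _ (Y.basicOpen_le a) (a ^ n) s
  refine and_congr ?_ ?_
  · refine he'.2.forall.trans (forall_congr' fun s ↦ exists_congr fun n ↦
      he.2.exists.trans (exists_congr fun t ↦ ?_))
    rw [← hsq, ← hs', he'.1.eq_iff]
  · refine he.2.forall.trans (forall_congr' fun t ↦ imp_congr ?_ (exists_congr fun n ↦ ?_))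
    · rw [← hsq, map_eq_zero_iff _ he'.1]
    · rw [← hs, map_eq_zero_iff _ he.1]

/-- On a spectrum, quasi-coherent means associated to the module of global sections, that is,
localizing. -/
lemma hasFractions_iff_forall_restrict : HasFractions F ↔
    ∀ (W : Y.Opens) (hW : IsAffineOpen W), (F.restrict hW.fromSpec).IsQuasicoherent := by
  refine forall₂_congr fun W hW ↦ ?_
  rw [isQuasicoherent_iff_isIso_fromTildeΓ, isIso_fromTildeΓ_iff_isLocalizing,
    isLocalizing_restrict_iff]

/-- Presentations carry over along isomorphisms. -/
noncomputable def presentationOfIso {M N : Y.Modules} (e : M ≅ N) (P : M.Presentation) :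
    N.Presentation :=
  have : @IsIso (SheafOfModules Y.ringCatSheaf) _ M N e.hom := e.isIso_hom
  @SheafOfModules.Presentation.ofIsIso _ _ _ _ _ _ M N e.hom this P

lemma nonempty_presentation {R : CommRingCat.{u}} (N : (Spec R).Modules) (h : N.IsQuasicoherent) :
    Nonempty N.Presentation :=
  have := (isQuasicoherent_iff_isIso_fromTildeΓ N).mp h
  ⟨presentationOfIso (asIso N.fromTildeΓ)
    (presentationTilde.{u} _ .univ (by simp) _ (Submodule.span_eq _))⟩

lemma nonempty_presentation_restrict (h : (F.restrict hW.fromSpec).IsQuasicoherent) :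
    Nonempty (F.restrict W.ι).Presentation := by
  obtain ⟨P⟩ := nonempty_presentation _ h
  let e : (F.restrict hW.fromSpec).restrict hW.isoSpec.hom ≅ F.restrict W.ι :=
    (Scheme.Modules.restrictFunctorComp _ _).symm.app F ≪≫
      (Scheme.Modules.restrictFunctorCongr hW.isoSpec_hom_fromSpec).app F
  exact ⟨presentationOfIso e (Scheme.Modules.presentationRestrict hW.isoSpec.hom P)⟩

/-- Modules over the slice site of `W` are equivalent to modules on the scheme `W`. The equivalence
preserves colimits and the structure sheaf, hence carries presentations over. -/
lemma isQuasicoherent_over (P : (F.restrict W.ι).Presentation) :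
    (SheafOfModules.over F W).IsQuasicoherent := by
  let Φ := Scheme.Modules.overEquiv W
  let e : Φ.inverse.obj (F.restrict W.ι) ≅ SheafOfModules.over F W :=
    Φ.inverse.mapIso ((Scheme.Modules.overFunctorEquiv W).app F).symm ≪≫
      Φ.unitIso.symm.app _
  let e₁ : SheafOfModules.unit (Y.ringCatSheaf.over W) ≅
      Φ.inverse.obj (SheafOfModules.unit W.toScheme.ringCatSheaf) :=
    Φ.unitIso.app _ ≪≫ Φ.inverse.mapIso
      ((Scheme.Modules.overFunctorEquiv W).app (SheafOfModules.unit Y.ringCatSheaf) ≪≫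
        Scheme.Modules.restrictUnitIso W.ι)
  let Ψ : SheafOfModules W.toScheme.ringCatSheaf ⥤ SheafOfModules (Y.ringCatSheaf.over W) :=
    Φ.inverse
  have : PreservesColimitsOfSize.{u, u} Ψ := Φ.symm.toAdjunction.leftAdjoint_preservesColimits
  exact (SheafOfModules.Presentation.ofIsIso.{u, u, u} e.hom (P.map Ψ e₁)).isQuasicoherent

/-- Quasi-coherence can be checked on the affine open sets. -/
lemma isQuasicoherent_of_forall_restrict
    (h : ∀ (W : Y.Opens) (hW : IsAffineOpen W), (F.restrict hW.fromSpec).IsQuasicoherent) :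
    F.IsQuasicoherent := by
  have hq (W : Y.affineOpens) : (SheafOfModules.over F W.1).IsQuasicoherent := by
    obtain ⟨P⟩ := nonempty_presentation_restrict F W.2 (h W.1 W.2)
    exact isQuasicoherent_over F P
  refine SheafOfModules.IsQuasicoherent.of_coversTop (J := Opens.grothendieckTopology Y)
    (R := Y.ringCatSheaf) F (fun W : Y.affineOpens ↦ W.1) ?_
  rw [Opens.coversTop_iff]
  exact iSup_affineOpens_eq_top Y

/-- This criterion replaces presentations from here on: it passes to retracts and to direct images
along affine morphisms by direct computation with sections. -/
lemma isQuasicoherent_iff_hasFractions : F.IsQuasicoherent ↔ HasFractions F := by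
  rw [hasFractions_iff_forall_restrict]
  exact ⟨fun _ _ _ ↦ inferInstance, isQuasicoherent_of_forall_restrict F⟩

end Quasicoherent

/-! ### Coherent sheaves -/

section Coherent

open TopologicalSpace Opposite

variable {Y Y' : Scheme.{u}} {F G : Y.Modules}

lemma isUnit_resO_basicOpen {W : Y.Opens} (a : Γ(Y, W)) : IsUnit (resO (Y.basicOpen_le a) a) :=
  RingedSpace.isUnit_res_basicOpen _ a

lemma res_smul_eq_zero_iff {W : Y.Opens} (a : Γ(Y, W)) (n : ℕ) (s : Γ(F, Y.basicOpen a)) :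
    resO (Y.basicOpen_le a) a ^ n • s = 0 ↔ s = 0 :=
  ((isUnit_resO_basicOpen a).pow n).smul_eq_zero

lemma HasFractions.of_retract (h : HasFractions F) (i : G ⟶ F) (r : F ⟶ G) (hir : i ≫ r = 𝟙 G) :
    HasFractions G := by
  have hr {V : Y.Opens} (s : Γ(G, V)) : r.app V (i.app V s) = s := by
    rw [← comp_app_apply, hir, id_app_apply]
  refine fun W hW a ↦ ⟨fun s ↦ ?_, fun t ht ↦ ?_⟩
  · obtain ⟨n, t, ht⟩ := (h W hW a).1 (i.app _ s)
    refine ⟨n, r.app _ t, ?_⟩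
    rw [← app_res, ht, Scheme.Modules.Hom.app_smul, hr]
  · obtain ⟨n, hn⟩ := (h W hW a).2 (i.app _ t) (by rw [← app_res, ht, map_zero])
    refine ⟨n, ?_⟩
    rw [← hr (a ^ n • t), Scheme.Modules.Hom.app_smul, hn, map_zero]

lemma IsCoherent.hasFractions (h : IsCoherent F) : HasFractions F :=
  (isQuasicoherent_iff_hasFractions F).mp h.quasicoherent

lemma IsCoherent.of_retract (h : IsCoherent F) (i : G ⟶ F) (r : F ⟶ G) (hir : i ≫ r = 𝟙 G) :
    IsCoherent G where
  quasicoherent := (isQuasicoherent_iff_hasFractions G).mpr (h.hasFractions.of_retract i r hir)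
  finite W hW := by
    have := h.finite W hW
    let φ : Γ(F, W) →ₗ[Γ(Y, W)] Γ(G, W) :=
      { toFun := r.app W, map_add' := map_add _, map_smul' := Scheme.Modules.Hom.app_smul r }
    refine Module.Finite.of_surjective φ fun s ↦ ⟨i.app W s, ?_⟩
    change r.app W (i.app W s) = s
    rw [← comp_app_apply, hir, id_app_apply]

/-- The direct image of a sheaf of modules. -/
noncomputable abbrev push (q : Y' ⟶ Y) (G : Y'.Modules) : Y.Modules :=
  (Scheme.Modules.pushforward q).obj G

/-- The sections of a direct image. -/
noncomputable def toPush (q : Y' ⟶ Y) (G : Y'.Modules) (W : Y.Opens) :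
    Γ(G, q ⁻¹ᵁ W) ≃+ Γ(push q G, W) := AddEquiv.refl _

lemma smul_toPush (q : Y' ⟶ Y) (G : Y'.Modules) (W : Y.Opens) (a : Γ(Y, W)) (s : Γ(G, q ⁻¹ᵁ W)) :
    a • toPush q G W s = toPush q G W (q.app W a • s) := rfl

lemma res_toPush (q : Y' ⟶ Y) (G : Y'.Modules) {V W : Y.Opens} (h : V ≤ W) (s : Γ(G, q ⁻¹ᵁ W)) :
    res (push q G) h (toPush q G W s) = toPush q G V (res G (q.preimage_mono h) s) := rfl

lemma map_app_toPush (q : Y' ⟶ Y) {G G' : Y'.Modules} (φ : G ⟶ G') {W : Y.Opens}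
    (s : Γ(G, q ⁻¹ᵁ W)) : ((Scheme.Modules.pushforward q).map φ).app W (toPush q G W s) =
      toPush q G' W (φ.app _ s) := rfl

lemma app_resO (q : Y' ⟶ Y) {V W : Y.Opens} (h : V ≤ W) (a : Γ(Y, W)) :
    q.app V (resO h a) = resO (q.preimage_mono h) (q.app W a) :=
  congr($(q.naturality (homOfLE h).op) a)

lemma HasFractions.push (q : Y' ⟶ Y) [IsAffineHom q] {G : Y'.Modules} (h : HasFractions G) :
    HasFractions (push q G) := by
  intro W hW a
  have hb : q ⁻¹ᵁ Y.basicOpen a = Y'.basicOpen (q.app W a) := Scheme.preimage_basicOpen q a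
  have hk := h _ (hW.preimage q) (q.app W a)
  have hnat (n : ℕ) : resO hb.ge (q.app _ (resO (Y.basicOpen_le a) a ^ n)) =
      resO (Y'.basicOpen_le (q.app W a)) (q.app W a) ^ n := by
    rw [map_pow, map_pow, app_resO, resO_resO]
  refine ⟨(toPush q G _).surjective.forall.mpr fun s ↦ ?_,
    (toPush q G _).surjective.forall.mpr fun t ht ↦ ?_⟩
  · obtain ⟨n, t, ht⟩ := hk.1 (res G hb.ge s)
    refine ⟨n, toPush q G W t, ?_⟩
    rw [res_toPush, smul_toPush, EmbeddingLike.apply_eq_iff_eq]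
    refine (res_bijective (F := G) hb.ge hb.le).1 ?_
    rw [res_res, res_smul, hnat, ht]
  · rw [res_toPush, map_eq_zero_iff _ (toPush q G _).injective] at ht
    obtain ⟨n, hn⟩ := hk.2 t (by
      have := congr(res G hb.ge $ht)
      rwa [map_zero, res_res] at this)
    refine ⟨n, ?_⟩
    rw [smul_toPush, map_pow, hn, map_zero]

lemma IsCoherent.push (q : Y' ⟶ Y) [IsClosedImmersion q] {G : Y'.Modules} (h : IsCoherent G) :
    IsCoherent (push q G) where
  quasicoherent := (isQuasicoherent_iff_hasFractions _).mpr (h.hasFractions.push q)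
  finite W hW := by
    obtain ⟨t, ht⟩ := (h.finite _ (hW.preimage q)).fg_top
    classical
    refine ⟨⟨t.image (toPush q G W), eq_top_iff.mpr ?_⟩⟩
    rw [Finset.coe_image]
    rintro s -
    obtain ⟨s, rfl⟩ := (toPush q G W).surjective s
    have hs : s ∈ Submodule.span Γ(Y', q ⁻¹ᵁ W) (t : Set Γ(G, q ⁻¹ᵁ W)) := by
      rw [ht]; exact Submodule.mem_top
    induction hs using Submodule.span_induction with
    | mem x hx => exact Submodule.subset_span ⟨x, hx, rfl⟩
    | zero => rw [map_zero]; exact zero_mem _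
    | add x y _ _ hx hy => rw [map_add]; exact add_mem hx hy
    | smul r x _ hx =>
      obtain ⟨r', rfl⟩ := q.app_surjective W hW r
      rw [← smul_toPush]
      exact Submodule.smul_mem _ r' hx

lemma finite_basicOpen (h : HasFractions F) {W : Y.Opens} (hW : IsAffineOpen W)
    [Module.Finite Γ(Y, W) Γ(F, W)] (a : Γ(Y, W)) :
    Module.Finite Γ(Y, Y.basicOpen a) Γ(F, Y.basicOpen a) := by
  classical
  obtain ⟨t, ht⟩ := Module.Finite.fg_top (R := Γ(Y, W)) (M := Γ(F, W))
  refine ⟨⟨t.image (res F (Y.basicOpen_le a)), eq_top_iff.mpr fun s _ ↦ ?_⟩⟩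
  rw [Finset.coe_image]
  have hmem (x : Γ(F, W)) : res F (Y.basicOpen_le a) x ∈
      Submodule.span Γ(Y, Y.basicOpen a) (res F (Y.basicOpen_le a) '' (t : Set Γ(F, W))) := by
    have hx : x ∈ Submodule.span Γ(Y, W) (t : Set Γ(F, W)) := by rw [ht]; exact Submodule.mem_top
    induction hx using Submodule.span_induction with
    | mem x hx => exact Submodule.subset_span ⟨x, hx, rfl⟩
    | zero => rw [map_zero]; exact zero_mem _
    | add x y _ _ hx hy => rw [map_add]; exact add_mem hx hy
    | smul r x _ hx => rw [res_smul]; exact Submodule.smul_mem _ _ hx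
  obtain ⟨n, x, hx⟩ := (h W hW a).1 s
  replace hmem := hmem x
  rw [hx] at hmem
  obtain ⟨b, hb⟩ := ((isUnit_resO_basicOpen a).pow n)
  rw [← hb] at hmem
  have := Submodule.smul_mem _ (↑b⁻¹ : Γ(Y, Y.basicOpen a)) hmem
  rwa [smul_smul, Units.inv_mul, one_smul] at this

/-- The principal open sets on which the sections are finite generate the unit ideal, and finiteness
of a module descends from finitely many such localizations. -/
lemma finite_of_forall_basicOpen (h : HasFractions F) {W : Y.Opens} (hW : IsAffineOpen W)
    (hloc : ∀ y ∈ W, ∃ a : Γ(Y, W), y ∈ Y.basicOpen a ∧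
      Module.Finite Γ(Y, Y.basicOpen a) Γ(F, Y.basicOpen a)) :
    Module.Finite Γ(Y, W) Γ(F, W) := by
  let s : Set Γ(Y, W) := {a | Module.Finite Γ(Y, Y.basicOpen a) Γ(F, Y.basicOpen a)}
  have hs : Ideal.span s = ⊤ := by
    rw [← hW.iSup_basicOpen_eq_self_iff]
    refine le_antisymm (iSup_le fun a ↦ Y.basicOpen_le _) fun y hy ↦ ?_
    obtain ⟨a, hya, ha⟩ := hloc y hy
    exact Opens.mem_iSup.mpr ⟨⟨a, ha⟩, hya⟩
  obtain ⟨t, hts, ht⟩ := (Ideal.span_eq_top_iff_finite s).mp hs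
  let alg (g : t) : Algebra Γ(Y, W) Γ(Y, Y.basicOpen g.1) := (resO (Y.basicOpen_le g.1)).toAlgebra
  let mod (g : t) : Module Γ(Y, W) Γ(F, Y.basicOpen g.1) :=
    Module.compHom _ (resO (Y.basicOpen_le g.1))
  have (g : t) : IsScalarTower Γ(Y, W) Γ(Y, Y.basicOpen g.1) Γ(F, Y.basicOpen g.1) :=
    .of_algebraMap_smul fun _ _ ↦ rfl
  have (g : t) : IsLocalization.Away g.1 Γ(Y, Y.basicOpen g.1) := hW.isLocalization_basicOpen g.1
  let f (g : t) : Γ(F, W) →ₗ[Γ(Y, W)] Γ(F, Y.basicOpen g.1) :=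
    { toFun := res F (Y.basicOpen_le g.1)
      map_add' := map_add _
      map_smul' := res_smul _ }
  have (g : t) : IsLocalizedModule.Away g.1 (f g) := by
    refine IsLocalizedModule.Away.mk_of_addCommGroup ?_ (fun x ↦ ?_) fun x hx ↦ ?_
    · rw [Module.End.isUnit_iff]
      obtain ⟨b, hb⟩ := isUnit_resO_basicOpen g.1
      have h1 (x : Γ(F, Y.basicOpen g.1)) :
        algebraMap Γ(Y, W) (Module.End Γ(Y, W) Γ(F, Y.basicOpen g.1)) g.1 x = b • x := by
        rw [Units.smul_def, hb]; rfl
      refine (Function.bijective_iff_has_inverse.mpr ⟨fun x ↦ b⁻¹ • x, fun x ↦ ?_, fun x ↦ ?_⟩)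
      · exact (congr_arg _ (h1 x)).trans (inv_smul_smul b x)
      · exact (h1 _).trans (smul_inv_smul b x)
    · obtain ⟨n, y, hy⟩ := (h W hW g.1).1 x
      refine ⟨n, y, Eq.trans ?_ hy.symm⟩
      rw [← map_pow]
      rfl
    · exact (h W hW g.1).2 x hx
  exact Module.Finite.of_localizationSpan_finite' t ht f fun g ↦ hts g.2

/-- Near each point, `V` contains a principal open set of `W`, which is then also principal in `V`.
-/
lemma finite_of_le (h : HasFractions F) {V W : Y.Opens} (hW : IsAffineOpen W) (hV : IsAffineOpen V)
    (hVW : V ≤ W) [Module.Finite Γ(Y, W) Γ(F, W)] : Module.Finite Γ(Y, V) Γ(F, V) := by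
  refine finite_of_forall_basicOpen h hV fun y hy ↦ ?_
  obtain ⟨a, ha, hya⟩ := hW.exists_basicOpen_le ⟨y, hy⟩ (hVW hy)
  have he : Y.basicOpen (resO hVW a) = Y.basicOpen a :=
    (Scheme.basicOpen_res Y a (homOfLE hVW).op).trans (inf_eq_right.mpr ha)
  refine ⟨resO hVW a, he.symm ▸ hya, ?_⟩
  rw [he]
  exact finite_basicOpen h hW a

lemma isCoherent_of_finite_top [IsAffine Y] (h : F.IsQuasicoherent)
    [Module.Finite Γ(Y, ⊤) Γ(F, ⊤)] : IsCoherent F where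
  quasicoherent := h
  finite _ hW := finite_of_le ((isQuasicoherent_iff_hasFractions F).mp h)
    (isAffineOpen_top Y) hW le_top

end Coherent

/-! ### Morphisms that vanish near a point -/

section ZeroNear

open TopologicalSpace Opposite

variable {Y : Scheme.{u}} {F G H : Y.Modules}

/-- The morphism `φ` vanishes in a neighbourhood of `y`. -/
def ZeroNear (φ : F ⟶ G) (y : Y) : Prop :=
  ∃ O : Y.Opens, y ∈ O ∧ ∀ V ≤ O, ∀ s : Γ(F, V), φ.app V s = 0

lemma ZeroNear.comp_left {φ : F ⟶ G} {y : Y} (h : ZeroNear φ y) (ψ : H ⟶ F) :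
    ZeroNear (ψ ≫ φ) y := by
  obtain ⟨O, hy, hO⟩ := h
  exact ⟨O, hy, fun V hV s ↦ hO V hV _⟩

lemma ZeroNear.comp_right {φ : F ⟶ G} {y : Y} (h : ZeroNear φ y) (ψ : G ⟶ H) :
    ZeroNear (φ ≫ ψ) y := by
  obtain ⟨O, hy, hO⟩ := h
  exact ⟨O, hy, fun V hV s ↦ by rw [comp_app_apply, hO V hV, map_zero]⟩

lemma ZeroNear.sub {φ ψ : F ⟶ G} {y : Y} (h : ZeroNear φ y) (h' : ZeroNear ψ y) :
    ZeroNear (φ - ψ) y := by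
  obtain ⟨O, hy, hO⟩ := h
  obtain ⟨O', hy', hO'⟩ := h'
  refine ⟨O ⊓ O', ⟨hy, hy'⟩, fun V hV s ↦ ?_⟩
  rw [sub_app_apply, hO V (hV.trans inf_le_left), hO' V (hV.trans inf_le_right), sub_zero]

lemma ZeroNear.zero (y : Y) : ZeroNear (0 : F ⟶ G) y := ⟨⊤, trivial, fun _ _ _ ↦ rfl⟩

lemma ZeroNear.of_id_left {φ : F ⟶ G} {y : Y} (h : ZeroNear (𝟙 F) y) : ZeroNear φ y := by
  have := h.comp_right φ
  rwa [Category.id_comp] at this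

lemma ZeroNear.of_id_right {φ : F ⟶ G} {y : Y} (h : ZeroNear (𝟙 G) y) : ZeroNear φ y := by
  have := h.comp_left φ
  rwa [Category.comp_id] at this

lemma isOpen_setOf_zeroNear (φ : F ⟶ G) : IsOpen {y | ZeroNear φ y} := by
  rw [isOpen_iff_forall_mem_open]
  rintro y ⟨O, hy, hO⟩
  exact ⟨O, fun z hz ↦ ⟨O, hz, hO⟩, O.2, hy⟩

lemma app_eq_zero_of_zeroNear {φ : F ⟶ G} {W : Y.Opens} (h : ∀ y ∈ W, ZeroNear φ y)
    (s : Γ(F, W)) : φ.app W s = 0 := by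
  refine section_ext fun y hy ↦ ?_
  obtain ⟨O, hyO, hO⟩ := h y hy
  refine ⟨W ⊓ O, inf_le_left, ⟨hy, hyO⟩, ?_⟩
  rw [← app_res, hO _ inf_le_right, map_zero]

lemma eq_zero_of_zeroNear {φ : F ⟶ G} (h : ∀ y, ZeroNear φ y) : φ = 0 :=
  hom_ext_apply fun _ s ↦ app_eq_zero_of_zeroNear (fun y _ ↦ h y) s

lemma section_eq_zero_of_zeroNear {W : Y.Opens} (h : ∀ y ∈ W, ZeroNear (𝟙 F) y)
    (s : Γ(F, W)) : s = 0 := app_eq_zero_of_zeroNear h s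

lemma ZeroNear.of_retract {i : G ⟶ F} {r : F ⟶ G} (hir : i ≫ r = 𝟙 G) {y : Y}
    (h : ZeroNear (𝟙 F) y) : ZeroNear (𝟙 G) y := by
  have := (h.of_id_left (φ := r)).comp_left i
  rwa [hir] at this

/-- If all sections over an affine open set `W` vanish on `O`, then the sheaf vanishes on `O`. -/
lemma HasFractions.eq_zero_of_res (h : HasFractions F) {W O : Y.Opens} (hW : IsAffineOpen W)
    (hO : O ≤ W) (h0 : ∀ s : Γ(F, W), res F hO s = 0) {V : Y.Opens} (hV : V ≤ O) (s : Γ(F, V)) :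
    s = 0 := by
  refine section_ext fun y hy ↦ ?_
  obtain ⟨a, ha, hya⟩ := hW.exists_basicOpen_le ⟨y, hy⟩ (hO (hV hy))
  refine ⟨_, ha, hya, ?_⟩
  rw [map_zero]
  obtain ⟨n, t, ht⟩ := (h W hW a).1 (res F ha s)
  rw [← res_smul_eq_zero_iff a n, ← ht, ← res_res (hO) (ha.trans hV), h0, map_zero]

lemma notMem_supp_of_zeroNear {y : Y} (h : ZeroNear (𝟙 F) y) : y ∉ supp F := by
  obtain ⟨O, hy, hO⟩ := h
  change ¬ Nontrivial _
  rw [not_nontrivial_iff_subsingleton]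
  refine subsingleton_of_forall_eq 0 fun t ↦ ?_
  obtain ⟨V, hV, s, rfl⟩ := F.presheaf.exists_germ_eq t
  have := F.presheaf.germ_res_apply (homOfLE (inf_le_left : V ⊓ O ≤ V)) y ⟨hV, hy⟩ s
  have h0 : F.presheaf.map (homOfLE (inf_le_left : V ⊓ O ≤ V)).op s = 0 := hO _ inf_le_right _
  rw [← this, h0, map_zero]

/-- Each of finitely many generators over an affine open set vanishes near `y`, hence all do on a
common neighbourhood. Sections over smaller open sets are locally fractions of those over the affine
one. -/
lemma IsCoherent.zeroNear_of_notMem_supp (h : IsCoherent F) {y : Y} (hy : y ∉ supp F) :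
    ZeroNear (𝟙 F) y := by
  obtain ⟨_, ⟨W, hW, rfl⟩, hyW, -⟩ :=
    Y.isBasis_affineOpens.exists_subset_of_mem_open (Set.mem_univ y) isOpen_univ
  have hss : Subsingleton (F.presheaf.stalk y) := not_nontrivial_iff_subsingleton.mp hy
  have hz (s : Γ(F, W)) : ∃ (O : Y.Opens) (hO : O ≤ W), y ∈ O ∧ res F hO s = 0 := by
    obtain ⟨O, hyO, i, j, hij⟩ := F.presheaf.germ_eq y hyW hyW s 0 (Subsingleton.elim _ _)
    refine ⟨O, leOfHom i, hyO, hij.trans (map_zero _)⟩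
  have := h.finite W hW
  obtain ⟨t, ht⟩ := Module.Finite.fg_top (R := Γ(Y, W)) (M := Γ(F, W))
  have hfin : ∃ (O : Y.Opens) (hO : O ≤ W), y ∈ O ∧ ∀ s ∈ t, res F hO s = 0 := by
    clear ht
    classical
    induction t using Finset.induction_on with
    | empty => exact ⟨W, le_rfl, hyW, fun s hs ↦ absurd hs (Finset.notMem_empty s)⟩
    | insert a t _ ih =>
      obtain ⟨O, hO, hyO, h0⟩ := ih
      obtain ⟨O', hO', hyO', h0'⟩ := hz a
      refine ⟨O ⊓ O', inf_le_left.trans hO, ⟨hyO, hyO'⟩, fun s hs ↦ ?_⟩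
      obtain rfl | hs := Finset.mem_insert.mp hs
      · rw [← res_res hO' inf_le_right, h0', map_zero]
      · rw [← res_res hO inf_le_left, h0 s hs, map_zero]
  obtain ⟨O, hO, hyO, h0⟩ := hfin
  refine ⟨O, hyO, fun V hV s ↦ h.hasFractions.eq_zero_of_res hW hO (fun x ↦ ?_) hV _⟩
  have hx : x ∈ Submodule.span Γ(Y, W) (t : Set Γ(F, W)) := by rw [ht]; exact Submodule.mem_top
  induction hx using Submodule.span_induction with
  | mem x hx => exact h0 x hx
  | zero => exact map_zero _
  | add x y _ _ hx hy => rw [map_add, hx, hy, add_zero]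
  | smul r x _ hx => rw [res_smul, hx, smul_zero]

lemma IsCoherent.mem_supp_iff (h : IsCoherent F) {y : Y} : y ∈ supp F ↔ ¬ ZeroNear (𝟙 F) y :=
  ⟨fun hy h' ↦ notMem_supp_of_zeroNear h' hy, fun h' ↦ by
    by_contra hy; exact h' (h.zeroNear_of_notMem_supp hy)⟩

lemma IsCoherent.supp_subset_of_retract (h : IsCoherent F) {i : G ⟶ F} {r : F ⟶ G}
    (hir : i ≫ r = 𝟙 G) : supp G ⊆ supp F := fun _ hy ↦ by
  by_contra hy'
  exact notMem_supp_of_zeroNear ((h.zeroNear_of_notMem_supp hy').of_retract hir) hy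

end ZeroNear

/-! ### Sheaves with finite support over a local base -/

section MemP

open TopologicalSpace Opposite

variable {Y X : Scheme.{u}} {p : Y ⟶ X} {F G : Y.Modules}

lemma MemP.of_retract (h : MemP p F) (i : G ⟶ F) (r : F ⟶ G) (hir : i ≫ r = 𝟙 G) : MemP p G where
  coherent := h.coherent.of_retract i r hir
  finiteSupport := by
    obtain ⟨I, hI, h0⟩ := h.finiteSupport
    refine ⟨I, hI, fun W a ha s ↦ ?_⟩
    have hr : r.app W.1 (i.app W.1 (a • s)) = a • s := by
      rw [← comp_app_apply, hir, id_app_apply]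
    rw [← hr, Scheme.Modules.Hom.app_smul, h0 W a ha, map_zero]
  locallyFree V hV := by
    obtain ⟨h₁, h₂⟩ := h.locallyFree V hV
    let i' : Γ(push p G, V) →ₗ[Γ(X, V)] Γ(push p F, V) :=
      { toFun := ((Scheme.Modules.pushforward p).map i).app V
        map_add' := map_add _
        map_smul' := Scheme.Modules.Hom.app_smul _ }
    let r' : Γ(push p F, V) →ₗ[Γ(X, V)] Γ(push p G, V) :=
      { toFun := ((Scheme.Modules.pushforward p).map r).app V
        map_add' := map_add _
        map_smul' := Scheme.Modules.Hom.app_smul _ }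
    have hir' : r'.comp i' = LinearMap.id := by
      ext s
      change ((Scheme.Modules.pushforward p).map r).app V
        (((Scheme.Modules.pushforward p).map i).app V s) = s
      rw [← comp_app_apply, ← Functor.map_comp, hir, CategoryTheory.Functor.map_id, id_app_apply]
    exact ⟨Module.Finite.of_surjective r' fun s ↦ ⟨i' s, LinearMap.congr_fun hir' s⟩,
      Module.Projective.of_split i' r' hir'⟩

lemma MemP.of_iso (h : MemP p F) (e : G ≅ F) : MemP p G := h.of_retract e.hom e.inv e.hom_inv_id

/-- A sheaf killed by an ideal sheaf vanishes off the closed subscheme. -/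
lemma zeroNear_of_notMem_range (h : HasFractions F) {I : Y.IdealSheafData}
    (h0 : ∀ (W : Y.affineOpens) (a : Γ(Y, W.1)), a ∈ I.ideal W → ∀ s : Γ(F, W.1), a • s = 0)
    {y : Y} (hy : y ∉ Set.range I.subschemeι) : ZeroNear (𝟙 F) y := by
  rw [I.range_subschemeι] at hy
  obtain ⟨_, ⟨W, hW, rfl⟩, hyW, -⟩ :=
    Y.isBasis_affineOpens.exists_subset_of_mem_open (Set.mem_univ y) isOpen_univ
  have hy2 : y ∉ Y.zeroLocus (U := W) (I.ideal ⟨W, hW⟩) := fun h ↦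
    hy ((I.mem_support_iff_of_mem (U := ⟨W, hW⟩) hyW).mpr h)
  rw [Scheme.mem_zeroLocus_iff] at hy2
  push Not at hy2
  obtain ⟨a, ha, hya⟩ := hy2
  refine ⟨_, hya, fun V hV s ↦ h.eq_zero_of_res hW (Y.basicOpen_le a) (fun t ↦ ?_) hV _⟩
  rw [← res_smul_eq_zero_iff a 1, pow_one, ← res_smul, h0 ⟨W, hW⟩ a ha, map_zero]

variable {R : CommRingCat.{u}} [IsLocalRing R]

lemma closedPoint_mem_of_isClosed {C : Set (Spec R)} (hC : IsClosed C) (h : C.Nonempty) :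
    IsLocalRing.closedPoint R ∈ C := by
  obtain ⟨x, hx⟩ := h
  exact (IsLocalRing.specializes_closedPoint x).mem_closed hC hx

/-- An open set containing the closed fibre of a closed morphism to a local scheme is everything. -/
lemma eq_univ_of_closedFibre_subset {T : Scheme.{u}} (f : T ⟶ Spec R) [UniversallyClosed f]
    {O : Set T} (hO : IsOpen O) (h : ∀ t, f t = IsLocalRing.closedPoint R → t ∈ O) :
    O = Set.univ := by
  by_contra hne
  obtain ⟨t, ht, htu⟩ := closedPoint_mem_of_isClosed (f.isClosedMap _ hO.isClosed_compl)
    ((Set.nonempty_compl.mpr hne).image f)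
  exact ht (h t htu)

/-- An open condition that holds where `F` vanishes and on the closed fibre holds everywhere. -/
lemma MemP.forall_of_closedFibre {p : Y ⟶ Spec R} (h : MemP p F) {P : Y → Prop}
    (hP : IsOpen {y | P y}) (h0 : ∀ y, ZeroNear (𝟙 F) y → P y)
    (hu : ∀ y, p y = IsLocalRing.closedPoint R → P y) (y : Y) : P y := by
  obtain ⟨I, hI, hF⟩ := h.finiteSupport
  by_cases hy : y ∈ Set.range I.subschemeι
  · obtain ⟨z, rfl⟩ := hy
    have := eq_univ_of_closedFibre_subset (I.subschemeι ≫ p)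
      (hP.preimage I.subschemeι.continuous) fun t ht ↦ hu _ ht
    exact (this ▸ Set.mem_univ z : z ∈ I.subschemeι ⁻¹' {y | P y})
  · exact h0 y (zeroNear_of_notMem_range h.coherent.hasFractions hF hy)

/-- This reduces every identity between morphisms out of an object of `P(p)` to a check along the
closed fibre. The calculus of components rests on it. -/
lemma MemP.eq_zero {p : Y ⟶ Spec R} (h : MemP p F) {φ : F ⟶ G}
    (hu : ∀ y, p y = IsLocalRing.closedPoint R → ZeroNear φ y) : φ = 0 :=
  eq_zero_of_zeroNear (h.forall_of_closedFibre (isOpen_setOf_zeroNear φ)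
    (fun _ hy ↦ hy.of_id_left) hu)

lemma MemP.eq_of_sub {p : Y ⟶ Spec R} (h : MemP p F) {φ ψ : F ⟶ G}
    (hu : ∀ y, p y = IsLocalRing.closedPoint R → ZeroNear (φ - ψ) y) : φ = ψ :=
  sub_eq_zero.mp (h.eq_zero hu)

/-- Only finitely many points of the closed fibre lie in the support. -/
lemma MemP.finite_closedFibre {p : Y ⟶ Spec R} (h : MemP p F) :
    {y | p y = IsLocalRing.closedPoint R ∧ ¬ ZeroNear (𝟙 F) y}.Finite := by
  obtain ⟨I, hI, hF⟩ := h.finiteSupport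
  refine ((Scheme.Hom.finite_preimage_singleton (I.subschemeι ≫ p)
    (IsLocalRing.closedPoint R)).image I.subschemeι).subset ?_
  rintro y ⟨hy, hy'⟩
  obtain ⟨z, rfl⟩ : y ∈ Set.range I.subschemeι := by
    by_contra h'
    exact hy' (zeroNear_of_notMem_range h.coherent.hasFractions hF h')
  exact ⟨z, hy, rfl⟩

end MemP

/-! ### Pairings -/

section Pairing

open TopologicalSpace Opposite

variable {Y X : Scheme.{u}} {p : Y ⟶ X} {F G H F' G' : Y.Modules} {V : X.Opens}

lemma mapSec_add (φ : F ⟶ G) (s t : Γ(push p F, V)) :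
    mapSec p φ V (s + t) = mapSec p φ V s + mapSec p φ V t := map_add _ _ _

lemma mapSec_zero (φ : F ⟶ G) : mapSec p φ V 0 = 0 := map_zero _

lemma mapSec_smul (φ : F ⟶ G) (a : Γ(X, V)) (s : Γ(push p F, V)) :
    mapSec p φ V (a • s) = a • mapSec p φ V s := Scheme.Modules.Hom.app_smul _ _ _

lemma mapSec_comp (φ : F ⟶ G) (ψ : G ⟶ H) (s : Γ(push p F, V)) :
    mapSec p (φ ≫ ψ) V s = mapSec p ψ V (mapSec p φ V s) := rfl

lemma mapSec_id (s : Γ(push p F, V)) : mapSec p (𝟙 F) V s = s := rfl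

lemma mapSec_zero_hom (s : Γ(push p F, V)) : mapSec p (0 : F ⟶ G) V s = 0 := rfl

lemma mapSec_add_hom (φ ψ : F ⟶ G) (s : Γ(push p F, V)) :
    mapSec p (φ + ψ) V s = mapSec p φ V s + mapSec p ψ V s := rfl

lemma mapSec_res (φ : F ⟶ G) {V' : X.Opens} (h : V' ≤ V) (s : Γ(push p F, V)) :
    mapSec p φ V' (res (push p F) h s) = res (push p G) h (mapSec p φ V s) :=
  app_res _ _ _

variable (p V) in
/-- The linear map on sections induced by a morphism. -/
noncomputable def mapSecₗ (φ : F ⟶ G) : Γ(push p F, V) →ₗ[Γ(X, V)] Γ(push p G, V) where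
  toFun := mapSec p φ V
  map_add' := mapSec_add φ
  map_smul' := mapSec_smul φ

lemma LocallyMultiples.map {W : Y.Opens} {s s' : Γ(F, W)} {t t' : Γ(G, W)}
    (h : LocallyMultiples s s' t t') (φ : F ⟶ F') (ψ : G ⟶ G') :
    LocallyMultiples (φ.app W s) (φ.app W s') (ψ.app W t) (ψ.app W t') := by
  intro y hy
  obtain ⟨W', hW, a, hy', hs, ht⟩ := h y hy
  refine ⟨W', hW, a, hy', ?_, ?_⟩
  · rw [map_eq_res, map_eq_res, ← app_res, ← app_res, ← Scheme.Modules.Hom.app_smul]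
    exact congr_arg _ hs
  · rw [map_eq_res, map_eq_res, ← app_res, ← app_res, ← Scheme.Modules.Hom.app_smul]
    exact congr_arg _ ht

/-- The pull-back of a pairing along morphisms. -/
noncomputable def DualPairing.comap (b : DualPairing p F G) (φ : F' ⟶ F) (ψ : G' ⟶ G) :
    DualPairing p F' G' where
  toFun V := (b.toFun V).compl₁₂ (mapSecₗ p V φ) (mapSecₗ p V ψ)
  map_res h s t := by
    change _ = b.toFun _ (mapSec p φ _ (res _ h s)) (mapSec p ψ _ (res _ h t))
    rw [mapSec_res, mapSec_res]
    exact b.map_res h _ _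
  balanced V s s' t t' h := b.balanced V _ _ _ _ (h.map φ ψ)

lemma DualPairing.comap_apply (b : DualPairing p F G) (φ : F' ⟶ F) (ψ : G' ⟶ G)
    (s : Γ(push p F', V)) (t : Γ(push p G', V)) :
    (b.comap φ ψ).toFun V s t = b.toFun V (mapSec p φ V s) (mapSec p ψ V t) := rfl

/-- An endomorphism that is locally the identity or zero. -/
def IsLocalProjection (e : F ⟶ F) : Prop := ∀ y, ZeroNear e y ∨ ZeroNear (𝟙 F - e) y

/-- The local multiplier is `0` or `1`, the same for both sections, as the axiom `balanced` of
pairings requires. -/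
lemma IsLocalProjection.locallyMultiples {e : F ⟶ F} (he : IsLocalProjection e) {W : Y.Opens}
    (s t : Γ(F, W)) : LocallyMultiples s (e.app W s) t (e.app W t) := by
  intro y hy
  obtain ⟨O, hyO, hO⟩ | ⟨O, hyO, hO⟩ := he y
  · have (s : Γ(F, W)) : res F (inf_le_left : W ⊓ O ≤ W) (e.app W s) =
        (0 : Γ(Y, W ⊓ O)) • res F inf_le_left s := by
      rw [← app_res, hO _ inf_le_right, zero_smul]
    exact ⟨W ⊓ O, inf_le_left, 0, ⟨hy, hyO⟩, this s, this t⟩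
  · have (s : Γ(F, W)) : res F (inf_le_left : W ⊓ O ≤ W) (e.app W s) =
        (1 : Γ(Y, W ⊓ O)) • res F inf_le_left s := by
      have := hO _ inf_le_right (res F (inf_le_left : W ⊓ O ≤ W) s)
      rw [sub_app_apply, id_app_apply, sub_eq_zero] at this
      rw [← app_res, ← this, one_smul]
    exact ⟨W ⊓ O, inf_le_left, 1, ⟨hy, hyO⟩, this s, this t⟩

lemma IsLocalProjection.one_sub {e : F ⟶ F} (he : IsLocalProjection e) :
    IsLocalProjection (𝟙 F - e) := fun y ↦ by
  rw [sub_sub_cancel]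
  exact (he y).symm

/-- Local projections are self-adjoint. -/
lemma IsLocalProjection.adjoint {e : F ⟶ F} (he : IsLocalProjection e) (b : DualPairing p F F)
    (s t : Γ(push p F, V)) :
    b.toFun V (mapSec p e V s) t = b.toFun V s (mapSec p e V t) :=
  b.balanced V _ _ _ _ (he.locallyMultiples (W := p ⁻¹ᵁ V) s t)

lemma mapSec_mapSec_of_eq {φ : F ⟶ G} {ψ : G ⟶ H} {χ : F ⟶ H} (h : φ ≫ ψ = χ)
    (s : Γ(push p F, V)) : mapSec p ψ V (mapSec p φ V s) = mapSec p χ V s := by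
  rw [← mapSec_comp, h]

lemma mapSec_mapSec_id {φ : F ⟶ G} {ψ : G ⟶ F} (h : φ ≫ ψ = 𝟙 F)
    (s : Γ(push p F, V)) : mapSec p ψ V (mapSec p φ V s) = s := mapSec_mapSec_of_eq h s

variable {T T' : Set Y}

/-- The quadratic space on a direct summand that is the image of a local projection. -/
noncomputable def QuadSpace.ofRetract (Q : QuadSpace p T) (i : G ⟶ Q.F) (r : Q.F ⟶ G)
    (hir : i ≫ r = 𝟙 G) (he : IsLocalProjection (r ≫ i)) (hT : supp G ⊆ T') : QuadSpace p T' where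
  F := G
  memP := Q.memP.of_retract i r hir
  supp_subset := hT
  form := Q.form.comap i i
  symm _ _ _ := Q.symm _ _ _
  perfect V hV := by
    -- Because `r ≫ i` is self-adjoint and fixes the image of `i`, pairing with that image only sees
    -- the projection. Perfectness then restricts to the summand.
    have hadj (s : Γ(push p G, V)) (t : Γ(push p Q.F, V)) :
        Q.form.toFun V (mapSec p i V s) (mapSec p i V (mapSec p r V t)) =
          Q.form.toFun V (mapSec p i V s) t := by
      rw [← mapSec_comp, ← he.adjoint, mapSec_comp, mapSec_mapSec_id hir]
    refine ⟨(injective_iff_map_eq_zero _).mpr fun s hs ↦ ?_, fun l ↦ ?_⟩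
    · have : mapSec p i V s = 0 := by
        refine (injective_iff_map_eq_zero _).mp (Q.perfect V hV).1 _ (LinearMap.ext fun t ↦ ?_)
        rw [← hadj]
        exact LinearMap.congr_fun hs (mapSec p r V t)
      rw [← mapSec_mapSec_id hir s, this, mapSec_zero]
    · obtain ⟨s, hs⟩ := (Q.perfect V hV).2 (l.comp (mapSecₗ p V r))
      refine ⟨mapSec p r V s, LinearMap.ext fun t ↦ ?_⟩
      rw [DualPairing.comap_apply, ← mapSec_comp, he.adjoint, mapSec_comp,
        mapSec_mapSec_id hir, hs]
      change l (mapSec p r V (mapSec p i V t)) = _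
      rw [mapSec_mapSec_id hir]

lemma IsLocalProjection.form_retract {Q : QuadSpace p T} {i : G ⟶ Q.F} {r : Q.F ⟶ G}
    (hir : i ≫ r = 𝟙 G) (he : IsLocalProjection (r ≫ i)) (s t : Γ(push p Q.F, V)) :
    Q.form.toFun V (mapSec p i V (mapSec p r V s)) (mapSec p i V (mapSec p r V t)) =
      Q.form.toFun V (mapSec p (r ≫ i) V s) t := by
  rw [← mapSec_comp, ← mapSec_comp, ← he.adjoint, ← mapSec_comp, Category.assoc,
    ← Category.assoc i, hir, Category.id_comp]

/-- Only equations between composites and sums of morphisms remain, so orthogonal sums can be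
carried along direct images and components without a comparison of biproducts. -/
lemma isOrthogonalSum_iff {Q Q₁ Q₂ : QuadSpace p T} : IsOrthogonalSum Q Q₁ Q₂ ↔
    ∃ (i₁ : Q₁.F ⟶ Q.F) (i₂ : Q₂.F ⟶ Q.F) (r₁ : Q.F ⟶ Q₁.F) (r₂ : Q.F ⟶ Q₂.F),
      i₁ ≫ r₁ = 𝟙 _ ∧ i₂ ≫ r₂ = 𝟙 _ ∧ i₁ ≫ r₂ = 0 ∧ i₂ ≫ r₁ = 0 ∧ r₁ ≫ i₁ + r₂ ≫ i₂ = 𝟙 _ ∧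
      ∀ (V : X.Opens) (s t : Γ(push p Q.F, V)), Q.form.toFun V s t =
        Q₁.form.toFun V (mapSec p r₁ V s) (mapSec p r₁ V t) +
        Q₂.form.toFun V (mapSec p r₂ V s) (mapSec p r₂ V t) := by
  constructor
  · rintro ⟨e, he⟩
    refine ⟨biprod.inl ≫ e.inv, biprod.inr ≫ e.inv, e.hom ≫ biprod.fst, e.hom ≫ biprod.snd,
      by simp, by simp, by simp, by simp, ?_, he⟩
    have := congr(e.hom ≫ $(biprod.total (X := Q₁.F) (Y := Q₂.F)) ≫ e.inv)
    rw [Preadditive.add_comp, Preadditive.comp_add, Category.id_comp, e.hom_inv_id] at this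
    simpa only [Category.assoc] using this
  · rintro ⟨i₁, i₂, r₁, r₂, h₁₁, h₂₂, h₁₂, h₂₁, hs, hf⟩
    refine ⟨⟨biprod.lift r₁ r₂, biprod.desc i₁ i₂, ?_, ?_⟩, fun V s t ↦ ?_⟩
    · rw [biprod.lift_desc, hs]
    · refine biprod.hom_ext _ _ (biprod.hom_ext' _ _ ?_ ?_) (biprod.hom_ext' _ _ ?_ ?_) <;>
        simp [h₁₁, h₂₂, h₁₂, h₂₁]
    · have e₁ : biprod.lift r₁ r₂ ≫ biprod.fst = r₁ := biprod.lift_fst _ _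
      have e₂ : biprod.lift r₁ r₂ ≫ biprod.snd = r₂ := biprod.lift_snd _ _
      change _ = Q₁.form.toFun V (mapSec p (biprod.lift r₁ r₂ ≫ biprod.fst) V s)
          (mapSec p (biprod.lift r₁ r₂ ≫ biprod.fst) V t) +
        Q₂.form.toFun V (mapSec p (biprod.lift r₁ r₂ ≫ biprod.snd) V s)
          (mapSec p (biprod.lift r₁ r₂ ≫ biprod.snd) V t)
      rw [e₁, e₂]
      exact hf V s t

lemma isometric_iff {Q Q' : QuadSpace p T} : Isometric Q Q' ↔
    ∃ (i : Q.F ⟶ Q'.F) (r : Q'.F ⟶ Q.F), i ≫ r = 𝟙 _ ∧ r ≫ i = 𝟙 _ ∧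
      ∀ (V : X.Opens) (s t : Γ(push p Q.F, V)),
        Q'.form.toFun V (mapSec p i V s) (mapSec p i V t) = Q.form.toFun V s t :=
  ⟨fun ⟨e, he⟩ ↦ ⟨e.hom, e.inv, e.hom_inv_id, e.inv_hom_id, he⟩,
    fun ⟨i, r, h, h', hf⟩ ↦ ⟨⟨i, r, h, h'⟩, hf⟩⟩

lemma Isometric.refl (Q : QuadSpace p T) : Isometric Q Q := ⟨Iso.refl _, fun _ _ _ ↦ rfl⟩

end Pairing

/-! ### The component of a sheaf over a part of the closed fibre -/

section Component

open TopologicalSpace Opposite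

variable {R : CommRingCat.{u}} [IsLocalRing R] {Y : Scheme.{u}} {p : Y ⟶ Spec R} {C : Set Y}
  {F F' G G' L M : Y.Modules} {T : Set Y}

variable (p C) in
/-- The direct summand `G` of `F` is the part of `F` concentrated, over the closed point, in `C`. -/
structure IsSheafComponent (i : G ⟶ F) (r : F ⟶ G) : Prop where
  retract : i ≫ r = 𝟙 G
  zeroNear_sub : ∀ y, p y = IsLocalRing.closedPoint R → y ∈ C → ZeroNear (𝟙 F - r ≫ i) y
  zeroNear_id : ∀ y, p y = IsLocalRing.closedPoint R → y ∉ C → ZeroNear (𝟙 G) y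

namespace IsSheafComponent

variable {i : G ⟶ F} {r : F ⟶ G} {i' : G' ⟶ F'} {r' : F' ⟶ G'}

lemma zeroNear_proj (h : IsSheafComponent p C i r) (y : Y)
    (hy : p y = IsLocalRing.closedPoint R) (hC : y ∉ C) : ZeroNear (r ≫ i) y :=
  ((h.zeroNear_id y hy hC).of_id_left (φ := i)).comp_left r

/-- Being locally `0` or `1` is an open condition. It holds where `F` vanishes, and on the closed
fibre by definition of a component, hence everywhere. -/
lemma isLocalProjection (hF : MemP p F) (h : IsSheafComponent p C i r) :
    IsLocalProjection (r ≫ i) := by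
  refine hF.forall_of_closedFibre
    ((isOpen_setOf_zeroNear (r ≫ i)).union (isOpen_setOf_zeroNear (𝟙 F - r ≫ i)))
    (fun y hy ↦ Or.inl hy.of_id_left) fun y hy ↦ ?_
  by_cases hC : y ∈ C
  · exact Or.inr (h.zeroNear_sub y hy hC)
  · exact Or.inl (h.zeroNear_proj y hy hC)

/-- The projections to the components are natural. -/
lemma comm (hF : MemP p F) (h : IsSheafComponent p C i r) (h' : IsSheafComponent p C i' r')
    (α : F ⟶ F') : (r ≫ i) ≫ α = α ≫ r' ≫ i' := by
  refine hF.eq_of_sub fun y hy ↦ ?_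
  by_cases hC : y ∈ C
  · have : (r ≫ i) ≫ α - α ≫ r' ≫ i' = α ≫ (𝟙 F' - r' ≫ i') - (𝟙 F - r ≫ i) ≫ α := by
      rw [Preadditive.comp_sub, Preadditive.sub_comp, Category.comp_id, Category.id_comp]
      abel
    rw [this]
    exact ((h'.zeroNear_sub y hy hC).comp_left α).sub ((h.zeroNear_sub y hy hC).comp_right α)
  · exact ((h.zeroNear_proj y hy hC).comp_right α).sub ((h'.zeroNear_proj y hy hC).comp_left α)

lemma inl_comm (hF : MemP p F) (h : IsSheafComponent p C i r) (h' : IsSheafComponent p C i' r')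
    (α : F ⟶ F') : i ≫ α ≫ r' ≫ i' = i ≫ α := by
  rw [← h.comm hF h' α, Category.assoc, ← Category.assoc i, h.retract, Category.id_comp]

lemma comm_inr (hF : MemP p F) (h : IsSheafComponent p C i r) (h' : IsSheafComponent p C i' r')
    (α : F ⟶ F') : r ≫ i ≫ α ≫ r' = α ≫ r' := by
  have := congr($(h.comm hF h' α) ≫ r')
  simp only [Category.assoc, h'.retract, Category.comp_id] at this
  exact this

lemma inl_comm_assoc (hF : MemP p F) (h : IsSheafComponent p C i r)
    (h' : IsSheafComponent p C i' r') (α : F ⟶ F') (β : F' ⟶ L) :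
    i ≫ α ≫ r' ≫ i' ≫ β = i ≫ α ≫ β := by
  have := congr($(h.inl_comm hF h' α) ≫ β)
  simpa only [Category.assoc] using this

end IsSheafComponent

variable (C) in
/-- The quadratic space `P` is the part of `Q` concentrated, over the closed point, in `C`. -/
def IsComponent (Q P : QuadSpace p T) : Prop :=
  ∃ (i : P.F ⟶ Q.F) (r : Q.F ⟶ P.F), IsSheafComponent p C i r ∧
    ∀ (V : (Spec R).Opens) (s : Γ(push p P.F, V)) (t : Γ(push p Q.F, V)),
      Q.form.toFun V (mapSec p i V s) t = P.form.toFun V s (mapSec p r V t)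

variable {Q Q₁ Q₂ P P₁ P₂ : QuadSpace p T}

/-- The isometry commutes with the projections to the components, so it restricts to them. For `Q₁ =
Q₂` this is uniqueness of the component. -/
lemma IsComponent.isometric (h₁ : IsComponent C Q₁ P₁) (h₂ : IsComponent C Q₂ P₂)
    (h : Isometric Q₁ Q₂) : Isometric P₁ P₂ := by
  obtain ⟨i₁, r₁, h₁, f₁⟩ := h₁
  obtain ⟨i₂, r₂, h₂, f₂⟩ := h₂
  obtain ⟨α, β, hαβ, hβα, f⟩ := isometric_iff.mp h
  refine isometric_iff.mpr ⟨i₁ ≫ α ≫ r₂, i₂ ≫ β ≫ r₁, ?_, ?_, fun V s t ↦ ?_⟩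
  · simp only [Category.assoc, h₁.inl_comm_assoc Q₁.memP h₂]
    rw [reassoc_of% hαβ, h₁.retract]
  · simp only [Category.assoc, h₂.inl_comm_assoc Q₂.memP h₁]
    rw [reassoc_of% hβα, h₂.retract]
  · rw [mapSec_comp i₁, mapSec_comp i₁, mapSec_comp α, mapSec_comp α, ← f₂, ← mapSec_comp α,
      ← mapSec_comp i₁, ← mapSec_comp (i₁ ≫ α ≫ r₂)]
    simp only [Category.assoc, h₁.inl_comm Q₁.memP h₂]
    rw [mapSec_comp, f, f₁, mapSec_mapSec_id h₁.retract]

/-- By naturality of the projections, the inclusions and projections of the sum restrict to the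
components with all their relations. -/
lemma IsComponent.isOrthogonalSum (h : IsComponent C Q P) (h₁ : IsComponent C Q₁ P₁)
    (h₂ : IsComponent C Q₂ P₂) (hQ : IsOrthogonalSum Q Q₁ Q₂) : IsOrthogonalSum P P₁ P₂ := by
  obtain ⟨i, r, h, f⟩ := h
  obtain ⟨j₁, q₁, h₁, f₁⟩ := h₁
  obtain ⟨j₂, q₂, h₂, f₂⟩ := h₂
  obtain ⟨i₁, i₂, r₁, r₂, h₁₁, h₂₂, h₁₂, h₂₁, hs, hf⟩ := isOrthogonalSum_iff.mp hQ
  refine isOrthogonalSum_iff.mpr ⟨j₁ ≫ i₁ ≫ r, j₂ ≫ i₂ ≫ r, i ≫ r₁ ≫ q₁, i ≫ r₂ ≫ q₂,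
    ?_, ?_, ?_, ?_, ?_, fun V s t ↦ ?_⟩
  · simp only [Category.assoc, h₁.inl_comm_assoc Q₁.memP h]
    rw [reassoc_of% h₁₁, h₁.retract]
  · simp only [Category.assoc, h₂.inl_comm_assoc Q₂.memP h]
    rw [reassoc_of% h₂₂, h₂.retract]
  · simp only [Category.assoc, h₁.inl_comm_assoc Q₁.memP h]
    rw [reassoc_of% h₁₂, zero_comp, comp_zero]
  · simp only [Category.assoc, h₂.inl_comm_assoc Q₂.memP h]
    rw [reassoc_of% h₂₁, zero_comp, comp_zero]
  · simp only [Category.assoc, h.inl_comm_assoc Q.memP h₁, h.inl_comm_assoc Q.memP h₂]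
    have := congr(i ≫ $hs ≫ r)
    rw [Category.id_comp, h.retract, Preadditive.add_comp, Preadditive.comp_add] at this
    simpa only [Category.assoc] using this
  · have key {K N : Y.Modules} {j : K ⟶ N} {q : N ⟶ K} (hj : IsSheafComponent p C j q)
        (α : Q.F ⟶ N) (s : Γ(push p P.F, V)) :
        mapSec p j V (mapSec p (i ≫ α ≫ q) V s) = mapSec p α V (mapSec p i V s) := by
      rw [← mapSec_comp, ← mapSec_comp, Category.assoc, Category.assoc, h.inl_comm Q.memP hj]
    have e₁ := f₁ V (mapSec p (i ≫ r₁ ≫ q₁) V s) (mapSec p r₁ V (mapSec p i V t))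
    have e₂ := f₂ V (mapSec p (i ≫ r₂ ≫ q₂) V s) (mapSec p r₂ V (mapSec p i V t))
    rw [key h₁] at e₁
    rw [key h₂] at e₂
    simp only [← mapSec_comp] at e₁ e₂
    have e := f V s (mapSec p i V t)
    rw [mapSec_mapSec_id h.retract, hf] at e
    simp only [← mapSec_comp] at e
    simp only [Category.assoc] at e e₁ e₂ ⊢
    rw [← e, e₁, e₂]

/-- The component of a Lagrangian is a Lagrangian of the component. The conclusion keeps the
Lagrangian's vanishing off `C` on the closed fibre, which is needed to lift it along the direct
image. -/
lemma IsComponent.isMetabolic (h : IsComponent C Q P) (hQ : IsMetabolic Q)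
    (hC : ∀ L : Y.Modules, MemP p L → ∃ (G : Y.Modules) (i : G ⟶ L) (r : L ⟶ G),
      IsSheafComponent p C i r) :
    ∃ (L : Y.Modules) (j : L ⟶ P.F), MemP p L ∧
      (∀ y, p y = IsLocalRing.closedPoint R → y ∉ C → ZeroNear (𝟙 L) y) ∧
      ∀ V : (Spec R).Opens, IsAffineOpen V →
        Function.Injective (mapSec p j V) ∧
        (∀ s : Γ(push p P.F, V),
          (∀ l, P.form.toFun V s (mapSec p j V l) = 0) ↔ ∃ l, mapSec p j V l = s) ∧
        (∀ l : Γ(push p L, V) →ₗ[Γ(Spec R, V)] Γ(Spec R, V),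
          ∃ s, ∀ t, P.form.toFun V s (mapSec p j V t) = l t) := by
  obtain ⟨i, r, h, f⟩ := h
  obtain ⟨L, j, hL, hj⟩ := hQ
  obtain ⟨G, k, q, hk⟩ := hC L hL
  have hr (V : (Spec R).Opens) (s : Γ(push p P.F, V)) : mapSec p r V (mapSec p i V s) = s :=
    mapSec_mapSec_id h.retract s
  have hq (V : (Spec R).Opens) (s : Γ(push p G, V)) : mapSec p q V (mapSec p k V s) = s :=
    mapSec_mapSec_id hk.retract s
  have hi (V : (Spec R).Opens) (l : Γ(push p G, V)) :
      mapSec p i V (mapSec p (k ≫ j ≫ r) V l) = mapSec p j V (mapSec p k V l) := by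
    rw [← mapSec_comp, ← mapSec_comp, Category.assoc, Category.assoc, hk.inl_comm hL h]
  have hkq (V : (Spec R).Opens) (l : Γ(push p L, V)) :
      mapSec p (k ≫ j ≫ r) V (mapSec p q V l) = mapSec p r V (mapSec p j V l) := by
    rw [← mapSec_comp, ← mapSec_comp, hk.comm_inr hL h]
  have hf (V : (Spec R).Opens) (s : Γ(push p P.F, V)) (l : Γ(push p L, V)) :
      P.form.toFun V s (mapSec p (k ≫ j ≫ r) V (mapSec p q V l)) =
        Q.form.toFun V (mapSec p i V s) (mapSec p j V l) := by
    rw [hkq, f]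
  refine ⟨G, k ≫ j ≫ r, hL.of_retract k q hk.retract, hk.zeroNear_id, fun V hV ↦ ⟨?_, ?_, ?_⟩⟩
  · intro l l' hl
    have := congr(mapSec p i V $hl)
    rw [hi, hi] at this
    rw [← hq V l, ← hq V l', (hj V hV).1 this]
  · refine fun s ↦ ⟨fun hs ↦ ?_, ?_⟩
    · obtain ⟨l, hl⟩ := ((hj V hV).2.1 (mapSec p i V s)).mp fun l ↦ by rw [← hf, hs]
      exact ⟨mapSec p q V l, by rw [hkq, hl, hr]⟩
    · rintro ⟨l, rfl⟩ l'
      rw [← hq V l', hf, hi]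
      exact ((hj V hV).2.1 _).mpr ⟨_, rfl⟩ _
  · intro l
    obtain ⟨s, hs⟩ := (hj V hV).2.2 (l.comp (mapSecₗ p V q))
    refine ⟨mapSec p r V s, fun t ↦ ?_⟩
    have e₁ : P.form.toFun V (mapSec p r V s) (mapSec p (k ≫ j ≫ r) V t) =
        Q.form.toFun V s (mapSec p j V (mapSec p k V t)) := by
      rw [P.symm, ← f, Q.symm, hi]
    rw [e₁, hs]
    exact congr_arg l (hq V t)

/-- A sheaf component carries a quadratic space. -/
lemma IsSheafComponent.isComponent {T : Set Y} {Q : QuadSpace p T} {i : G ⟶ Q.F} {r : Q.F ⟶ G}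
    (h : IsSheafComponent p C i r) :
    IsComponent C Q (Q.ofRetract i r h.retract (h.isLocalProjection Q.memP)
      ((Q.memP.coherent.supp_subset_of_retract h.retract).trans Q.supp_subset)) := by
  refine ⟨i, r, h, fun V s t ↦ ?_⟩
  have (s : Γ(push p G, V)) : Q.form.toFun V (mapSec p i V s) t =
      Q.form.toFun V (mapSec p i V s) (mapSec p i V (mapSec p r V t)) := by
    rw [← mapSec_comp r, ← (h.isLocalProjection Q.memP).adjoint,
      ← mapSec_comp, ← Category.assoc, h.retract, Category.id_comp]
  exact this s

/-- A quadratic space is the orthogonal sum of the component over `C` and of a space that vanishes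
along `C`. -/
lemma IsSheafComponent.exists_complement {i : G ⟶ Q.F} {r : Q.F ⟶ G}
    (h : IsSheafComponent p C i r) : ∃ P₂ : QuadSpace p T,
      IsOrthogonalSum Q (Q.ofRetract i r h.retract (h.isLocalProjection Q.memP)
        ((Q.memP.coherent.supp_subset_of_retract h.retract).trans Q.supp_subset)) P₂ ∧
      (∀ y, ZeroNear (𝟙 Q.F) y → ZeroNear (𝟙 P₂.F) y) ∧
      ∀ y, p y = IsLocalRing.closedPoint R → y ∈ C → ZeroNear (𝟙 P₂.F) y := by
  have h0 : (𝟙 Q.F - r ≫ i) ≫ r = 0 := by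
    rw [Preadditive.sub_comp, Category.assoc, h.retract, Category.id_comp, Category.comp_id,
      sub_self]
  -- The complement is the kernel of `r`, split off by the complementary projection `𝟙 - r ≫ i`,
  -- which is again a local projection.
  let r₂ : Q.F ⟶ kernel r := kernel.lift r (𝟙 Q.F - r ≫ i) h0
  have hr₂ : r₂ ≫ kernel.ι r = 𝟙 Q.F - r ≫ i := kernel.lift_ι _ _ _
  have hir₂ : kernel.ι r ≫ r₂ = 𝟙 _ := by
    rw [← cancel_mono (kernel.ι r), Category.assoc, hr₂, Preadditive.comp_sub, Category.comp_id,
      kernel.condition_assoc, zero_comp, sub_zero, Category.id_comp]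
  have hproj : IsLocalProjection (r₂ ≫ kernel.ι r) := by
    rw [hr₂]
    exact (h.isLocalProjection Q.memP).one_sub
  have hi₂ : i ≫ r₂ = 0 := by
    rw [← cancel_mono (kernel.ι r), Category.assoc, hr₂, zero_comp, Preadditive.comp_sub,
      Category.comp_id, ← Category.assoc, h.retract, Category.id_comp, sub_self]
  have htot : r ≫ i + r₂ ≫ kernel.ι r = 𝟙 Q.F := by rw [hr₂, add_sub_cancel]
  have hz (y : Y) (hy : p y = IsLocalRing.closedPoint R) (hC : y ∈ C) :
      ZeroNear (𝟙 (kernel r)) y := by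
    have := ((h.zeroNear_sub y hy hC).comp_left (kernel.ι r)).comp_right r₂
    rwa [← hr₂, Category.assoc, Category.assoc, hir₂, Category.comp_id, hir₂] at this
  have hform (V : (Spec R).Opens) (s t : Γ(push p Q.F, V)) : Q.form.toFun V s t =
      Q.form.toFun V (mapSec p i V (mapSec p r V s)) (mapSec p i V (mapSec p r V t)) +
      Q.form.toFun V (mapSec p (kernel.ι r) V (mapSec p r₂ V s))
        (mapSec p (kernel.ι r) V (mapSec p r₂ V t)) := by
    rw [(h.isLocalProjection Q.memP).form_retract h.retract, hproj.form_retract hir₂,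
      ← LinearMap.add_apply, ← map_add, ← mapSec_add_hom, htot, mapSec_id]
  exact ⟨Q.ofRetract (kernel.ι r) r₂ hir₂ hproj
    ((Q.memP.coherent.supp_subset_of_retract hir₂).trans Q.supp_subset),
    isOrthogonalSum_iff.mpr ⟨i, kernel.ι r, r, r₂, h.retract, hir₂, hi₂, kernel.condition r,
      htot, hform⟩, fun y hy ↦ hy.of_retract hir₂, hz⟩

lemma IsComponent.of_isometric (h : Isometric P Q)
    (hP : ∀ y, p y = IsLocalRing.closedPoint R → y ∉ C → ZeroNear (𝟙 P.F) y) :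
    IsComponent C Q P := by
  obtain ⟨i, r, hir, hri, f⟩ := isometric_iff.mp h
  refine ⟨i, r, ⟨hir, fun y _ _ ↦ ?_, hP⟩, fun V s t ↦ ?_⟩
  · rw [hri, sub_self]
    exact .zero y
  · rw [← f, mapSec_mapSec_id hri]

/-- Responsible for the vanishing of the off-diagonal terms between disjoint parts. -/
lemma IsComponent.id_eq_zero (h : IsComponent C Q P)
    (hQ : ∀ y, p y = IsLocalRing.closedPoint R → y ∈ C → ZeroNear (𝟙 Q.F) y) : 𝟙 P.F = 0 := by
  obtain ⟨i, r, h, -⟩ := h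
  refine P.memP.eq_zero fun y hy ↦ ?_
  by_cases hC : y ∈ C
  · exact (hQ y hy hC).of_retract h.retract
  · exact h.zeroNear_id y hy hC

end Component

/-! ### Direct images of quadratic spaces -/

section Push

open TopologicalSpace Opposite

variable {Y Y' X : Scheme.{u}} (p : Y ⟶ X) (h : Y' ⟶ Y) {F' G' : Y'.Modules} {V : X.Opens}

variable (F' V) in
/-- The sections of the direct image along a composition. -/
noncomputable def pushComp : Γ(push (h ≫ p) F', V) ≃ₗ[Γ(X, V)] Γ(push p (push h F'), V) where
  toFun s := s
  invFun s := s
  left_inv _ := rfl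
  right_inv _ := rfl
  map_add' _ _ := rfl
  map_smul' _ _ := rfl

/-- Functoriality of the direct image. -/
noncomputable abbrev pushMap (φ : F' ⟶ G') : push h F' ⟶ push h G' :=
  (Scheme.Modules.pushforward h).map φ

lemma pushMap_comp {H' : Y'.Modules} (φ : F' ⟶ G') (ψ : G' ⟶ H') :
    pushMap h (φ ≫ ψ) = pushMap h φ ≫ pushMap h ψ := CategoryTheory.Functor.map_comp _ _ _

lemma pushMap_id : pushMap h (𝟙 F') = 𝟙 (push h F') := CategoryTheory.Functor.map_id _ _

lemma pushMap_zero : pushMap h (0 : F' ⟶ G') = 0 := rfl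

lemma pushMap_add (φ ψ : F' ⟶ G') : pushMap h (φ + ψ) = pushMap h φ + pushMap h ψ := rfl

/-- On sections the canonical identification is the identity, so forms on the two sides can be
compared directly. -/
lemma pushIso_hom_app (s : Γ(push (h ≫ p) F', V)) :
    (pushIso h rfl F').hom.app V s = pushComp p h F' V s := by
  have : (pushIso h rfl F').hom.app V s = F'.presheaf.map (eqToHom rfl).op s := by
    simp [pushIso]
    rfl
  rw [this]
  exact congr($(F'.presheaf.map_id _) s)

variable {p h}

/-- Multipliers on `Y` pull back to `Y'`. The opposite direction is not automatic and is isolated as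
`ReflectsMultiples`. -/
lemma LocallyMultiples.of_push {W : Y.Opens} {s s' : Γ(F', h ⁻¹ᵁ W)} {t t' : Γ(G', h ⁻¹ᵁ W)}
    (hst : LocallyMultiples (toPush h F' W s) (toPush h F' W s') (toPush h G' W t)
      (toPush h G' W t')) : LocallyMultiples s s' t t' := by
  intro y hy
  obtain ⟨W', hW, a, hy', hs, ht⟩ := hst (h y) hy
  exact ⟨h ⁻¹ᵁ W', fun z hz ↦ hW hz, h.app W' a, hy', hs, ht⟩

/-- The direct image of a pairing. -/
noncomputable def DualPairing.push (b : DualPairing (h ≫ p) F' G') :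
    DualPairing p (GWCorr.push h F') (GWCorr.push h G') where
  toFun V := (b.toFun V).compl₁₂ (pushComp p h F' V).symm.toLinearMap
    (pushComp p h G' V).symm.toLinearMap
  map_res {_ V} hV s t :=
    b.map_res hV ((pushComp p h F' V).symm s) ((pushComp p h G' V).symm t)
  balanced V s s' t t' hst := b.balanced V s s' t t'
    (LocallyMultiples.of_push (h := h) (W := p ⁻¹ᵁ V) hst)

/-- Sections upstairs that are locally multiples remain so downstairs. -/
def ReflectsMultiples (h : Y' ⟶ Y) (F' G' : Y'.Modules) : Prop :=
  ∀ (W : Y.Opens) (s s' : Γ(F', h ⁻¹ᵁ W)) (t t' : Γ(G', h ⁻¹ᵁ W)), LocallyMultiples s s' t t' →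
    LocallyMultiples (toPush h F' W s) (toPush h F' W s') (toPush h G' W t) (toPush h G' W t')

/-- A pairing of direct images as a pairing upstairs. -/
noncomputable def DualPairing.ofPush (hl : ReflectsMultiples h F' G')
    (b : DualPairing p (GWCorr.push h F') (GWCorr.push h G')) : DualPairing (h ≫ p) F' G' where
  toFun V := (b.toFun V).compl₁₂ (pushComp p h F' V).toLinearMap (pushComp p h G' V).toLinearMap
  map_res {_ V} hV s t := b.map_res hV (pushComp p h F' V s) (pushComp p h G' V t)
  balanced V s s' t t' hst := b.balanced V s s' t t' (hl (p ⁻¹ᵁ V) s s' t t' hst)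

variable {T' : Set Y'}

lemma bijective_of_comp_linearEquiv {A M N M' N' P : Type*} [CommRing A] [AddCommGroup M]
    [AddCommGroup N] [AddCommGroup M'] [AddCommGroup N'] [AddCommGroup P] [Module A M] [Module A N]
    [Module A M'] [Module A N'] [Module A P] {b : M →ₗ[A] N →ₗ[A] P}
    (hb : Function.Bijective b) (e : M' ≃ₗ[A] M) (e' : N' ≃ₗ[A] N) :
    Function.Bijective (b.compl₁₂ e.toLinearMap e'.toLinearMap) :=
  ((e'.congrLeft P A).symm.bijective.comp hb).comp e.bijective

/-- The direct image of a quadratic space. -/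
noncomputable def QuadSpace.push (Q : QuadSpace (h ≫ p) T') (hQ : MemP p (GWCorr.push h Q.F)) :
    QuadSpace p Set.univ where
  F := GWCorr.push h Q.F
  memP := hQ
  supp_subset := Set.subset_univ _
  form := Q.form.push
  symm V _ _ := Q.symm V _ _
  perfect V hV := bijective_of_comp_linearEquiv (Q.perfect V hV) _ _

/-- A quadratic space on a direct image as a quadratic space upstairs. -/
noncomputable def QuadSpace.ofPush (F' : Y'.Modules) (hF' : MemP (h ≫ p) F') (hT : supp F' ⊆ T')
    (hl : ReflectsMultiples h F' F')
    (b : DualPairing p (GWCorr.push h F') (GWCorr.push h F'))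
    (hs : ∀ (V : X.Opens) (s t : Γ(GWCorr.push p (GWCorr.push h F'), V)),
      b.toFun V s t = b.toFun V t s) (hb : b.IsPerfect) : QuadSpace (h ≫ p) T' where
  F := F'
  memP := hF'
  supp_subset := hT
  form := b.ofPush hl
  symm V _ _ := hs V _ _
  perfect V hV := bijective_of_comp_linearEquiv (hb V hV) _ _

end Push

/-! ### Local parts and the transfer of quadratic spaces -/

section LocalPart

variable {R : CommRingCat.{u}} [IsLocalRing R] {Y Y' : Scheme.{u}}

/-- Direct image along `h` identifies the sheaves upstairs with support in `T'` with the sheaves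
downstairs that are concentrated, over the closed point, in `C`; and every sheaf downstairs has a
component of this kind. -/
structure IsLocalPart (p : Y ⟶ Spec R) (h : Y' ⟶ Y) (T' : Set Y') (C : Set Y) : Prop where
  bijective (F' G' : Y'.Modules) : MemP (h ≫ p) F' → supp F' ⊆ T' → MemP (h ≫ p) G' →
    supp G' ⊆ T' → Function.Bijective (pushMap h : (F' ⟶ G') → (push h F' ⟶ push h G'))
  memP (F' : Y'.Modules) : MemP (h ≫ p) F' → supp F' ⊆ T' → MemP p (push h F')
  reflectsMultiples (F' : Y'.Modules) : MemP (h ≫ p) F' → supp F' ⊆ T' →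
    ReflectsMultiples h F' F'
  zeroNear (F' : Y'.Modules) : MemP (h ≫ p) F' → supp F' ⊆ T' →
    ∀ y, p y = IsLocalRing.closedPoint R → y ∉ C → ZeroNear (𝟙 (push h F')) y
  exists_component (F : Y.Modules) : MemP p F → ∃ F' : Y'.Modules, MemP (h ≫ p) F' ∧
    supp F' ⊆ T' ∧ ∃ (i : push h F' ⟶ F) (r : F ⟶ push h F'), IsSheafComponent p C i r
  -- A Lagrangian is only required to lie in `P(h ≫ p)`; this field makes it inherit the support
  -- condition from the ambient space.
  supp_subset (L F' : Y'.Modules) (j : L ⟶ F') : MemP (h ≫ p) L → MemP (h ≫ p) F' →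
    supp F' ⊆ T' →
    (∀ V : (Spec R).Opens, IsAffineOpen V → Function.Injective (mapSec (h ≫ p) j V)) → supp L ⊆ T'

namespace IsLocalPart

variable {p : Y ⟶ Spec R} {h : Y' ⟶ Y} {T' : Set Y'} {C : Set Y} (D : IsLocalPart p h T' C)
include D

/-- The direct image of a quadratic space. -/
noncomputable abbrev push (Q : QuadSpace (h ≫ p) T') : QuadSpace p Set.univ :=
  Q.push (D.memP _ Q.memP Q.supp_subset)

variable {Q Q₁ Q₂ : QuadSpace (h ≫ p) T'}

lemma exists_pushMap_eq {F' G' : Y'.Modules} (hF : MemP (h ≫ p) F') (hF' : supp F' ⊆ T')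
    (hG : MemP (h ≫ p) G') (hG' : supp G' ⊆ T') (φ : GWCorr.push h F' ⟶ GWCorr.push h G') :
    ∃ ψ : F' ⟶ G', pushMap h ψ = φ := (D.bijective F' G' hF hF' hG hG').2 φ

lemma pushMap_injective {F' G' : Y'.Modules} (hF : MemP (h ≫ p) F') (hF' : supp F' ⊆ T')
    (hG : MemP (h ≫ p) G') (hG' : supp G' ⊆ T') {φ ψ : F' ⟶ G'}
    (hφ : pushMap h φ = pushMap h ψ) : φ = ψ := (D.bijective F' G' hF hF' hG hG').1 hφ

lemma isometric_push (hQ : Isometric Q₁ Q₂) : Isometric (D.push Q₁) (D.push Q₂) := by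
  obtain ⟨i, r, hir, hri, f⟩ := isometric_iff.mp hQ
  have h₁ : pushMap h i ≫ pushMap h r = 𝟙 _ := by rw [← pushMap_comp, hir, pushMap_id]
  have h₂ : pushMap h r ≫ pushMap h i = 𝟙 _ := by rw [← pushMap_comp, hri, pushMap_id]
  exact isometric_iff.mpr ⟨pushMap h i, pushMap h r, h₁, h₂, f⟩

lemma isometric_of_push (hQ : Isometric (D.push Q₁) (D.push Q₂)) : Isometric Q₁ Q₂ := by
  obtain ⟨i, r, hir, hri, f⟩ := isometric_iff.mp hQ
  obtain ⟨i, rfl⟩ := D.exists_pushMap_eq Q₁.memP Q₁.supp_subset Q₂.memP Q₂.supp_subset i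
  obtain ⟨r, rfl⟩ := D.exists_pushMap_eq Q₂.memP Q₂.supp_subset Q₁.memP Q₁.supp_subset r
  refine isometric_iff.mpr ⟨i, r, ?_, ?_, f⟩
  · exact D.pushMap_injective Q₁.memP Q₁.supp_subset Q₁.memP Q₁.supp_subset
      ((pushMap_comp h i r).trans (hir.trans (pushMap_id h).symm))
  · exact D.pushMap_injective Q₂.memP Q₂.supp_subset Q₂.memP Q₂.supp_subset
      ((pushMap_comp h r i).trans (hri.trans (pushMap_id h).symm))

lemma isOrthogonalSum_push (hQ : IsOrthogonalSum Q Q₁ Q₂) :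
    IsOrthogonalSum (D.push Q) (D.push Q₁) (D.push Q₂) := by
  obtain ⟨i₁, i₂, r₁, r₂, h₁₁, h₂₂, h₁₂, h₂₁, hs, hf⟩ := isOrthogonalSum_iff.mp hQ
  have k₁₁ : pushMap h i₁ ≫ pushMap h r₁ = 𝟙 _ := by rw [← pushMap_comp, h₁₁, pushMap_id]
  have k₂₂ : pushMap h i₂ ≫ pushMap h r₂ = 𝟙 _ := by rw [← pushMap_comp, h₂₂, pushMap_id]
  have k₁₂ : pushMap h i₁ ≫ pushMap h r₂ = 0 := by rw [← pushMap_comp, h₁₂, pushMap_zero]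
  have k₂₁ : pushMap h i₂ ≫ pushMap h r₁ = 0 := by rw [← pushMap_comp, h₂₁, pushMap_zero]
  have ks : pushMap h r₁ ≫ pushMap h i₁ + pushMap h r₂ ≫ pushMap h i₂ = 𝟙 _ := by
    rw [← pushMap_comp, ← pushMap_comp, ← pushMap_add, hs, pushMap_id]
  exact isOrthogonalSum_iff.mpr ⟨_, _, _, _, k₁₁, k₂₂, k₁₂, k₂₁, ks, hf⟩

lemma isOrthogonalSum_of_push (hQ : IsOrthogonalSum (D.push Q) (D.push Q₁) (D.push Q₂)) :
    IsOrthogonalSum Q Q₁ Q₂ := by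
  obtain ⟨i₁, i₂, r₁, r₂, h₁₁, h₂₂, h₁₂, h₂₁, hs, hf⟩ := isOrthogonalSum_iff.mp hQ
  obtain ⟨i₁, rfl⟩ := D.exists_pushMap_eq Q₁.memP Q₁.supp_subset Q.memP Q.supp_subset i₁
  obtain ⟨i₂, rfl⟩ := D.exists_pushMap_eq Q₂.memP Q₂.supp_subset Q.memP Q.supp_subset i₂
  obtain ⟨r₁, rfl⟩ := D.exists_pushMap_eq Q.memP Q.supp_subset Q₁.memP Q₁.supp_subset r₁
  obtain ⟨r₂, rfl⟩ := D.exists_pushMap_eq Q.memP Q.supp_subset Q₂.memP Q₂.supp_subset r₂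
  refine isOrthogonalSum_iff.mpr ⟨i₁, i₂, r₁, r₂, ?_, ?_, ?_, ?_, ?_, hf⟩
  · exact D.pushMap_injective Q₁.memP Q₁.supp_subset Q₁.memP Q₁.supp_subset
      ((pushMap_comp h i₁ r₁).trans (h₁₁.trans (pushMap_id h).symm))
  · exact D.pushMap_injective Q₂.memP Q₂.supp_subset Q₂.memP Q₂.supp_subset
      ((pushMap_comp h i₂ r₂).trans (h₂₂.trans (pushMap_id h).symm))
  · exact D.pushMap_injective Q₁.memP Q₁.supp_subset Q₂.memP Q₂.supp_subset
      ((pushMap_comp h i₁ r₂).trans h₁₂)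
  · exact D.pushMap_injective Q₂.memP Q₂.supp_subset Q₁.memP Q₁.supp_subset
      ((pushMap_comp h i₂ r₁).trans h₂₁)
  · refine D.pushMap_injective Q.memP Q.supp_subset Q.memP Q.supp_subset ?_
    rw [pushMap_add, pushMap_comp, pushMap_comp, pushMap_id]
    exact hs

lemma isMetabolic_push (hQ : IsMetabolic Q) : IsMetabolic (D.push Q) := by
  obtain ⟨L, j, hL, hj⟩ := hQ
  have hT := D.supp_subset L Q.F j hL Q.memP Q.supp_subset fun V hV ↦ (hj V hV).1
  exact ⟨GWCorr.push h L, pushMap h j, D.memP L hL hT, hj⟩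

lemma zeroNear_push (Q : QuadSpace (h ≫ p) T') (y : Y) (hy : p y = IsLocalRing.closedPoint R)
    (hC : y ∉ C) : ZeroNear (𝟙 (D.push Q).F) y :=
  D.zeroNear _ Q.memP Q.supp_subset y hy hC

lemma isComponent_push (Q : QuadSpace (h ≫ p) T') : IsComponent C (D.push Q) (D.push Q) :=
  .of_isometric (Isometric.refl _) (D.zeroNear_push Q)

/-- The sheaf component is a direct image by hypothesis, and its restricted form moves upstairs
because multiples are reflected. -/
lemma exists_isComponent (Q : QuadSpace p Set.univ) :
    ∃ Q' : QuadSpace (h ≫ p) T', IsComponent C Q (D.push Q') := by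
  obtain ⟨F', hF', hT, i, r, hc⟩ := D.exists_component Q.F Q.memP
  let P := Q.ofRetract (T' := Set.univ) i r hc.retract (hc.isLocalProjection Q.memP)
    (Set.subset_univ _)
  obtain ⟨j, q, hP⟩ := hc.isComponent (Q := Q)
  exact ⟨.ofPush F' hF' hT (D.reflectsMultiples F' hF' hT) P.form P.symm P.perfect, j, q, hP⟩

/-- The Lagrangian of the component vanishes off `C` on the closed fibre, so it coincides with its
own component, which is a direct image. Full faithfulness lifts its inclusion upstairs. -/
lemma isMetabolic_of_isComponent {P : QuadSpace p Set.univ} (hP : IsMetabolic P)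
    (hc : IsComponent C P (D.push Q)) : IsMetabolic Q := by
  obtain ⟨L, j, hL, hz, hj⟩ := hc.isMetabolic hP fun L hL ↦ by
    obtain ⟨F', -, -, i, r, h⟩ := D.exists_component L hL
    exact ⟨_, i, r, h⟩
  obtain ⟨L', hL', hT, i, r, hir⟩ := D.exists_component L hL
  have hri : r ≫ i = 𝟙 L := by
    refine (hL.eq_of_sub fun y hy ↦ ?_).symm
    by_cases hC : y ∈ C
    · exact hir.zeroNear_sub y hy hC
    · exact (hz y hy hC).of_id_left
  obtain ⟨k, hk⟩ := D.exists_pushMap_eq hL' hT Q.memP Q.supp_subset (i ≫ j)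
  have hk' (V : (Spec R).Opens) (s : Γ(GWCorr.push p (GWCorr.push h L'), V)) :
      mapSec p (pushMap h k) V s = mapSec p j V (mapSec p i V s) := by
    rw [← mapSec_comp]
    exact congr(mapSec p $hk V s)
  have hi (V : (Spec R).Opens) (s : Γ(GWCorr.push p L, V)) :
      mapSec p i V (mapSec p r V s) = s := mapSec_mapSec_id hri s
  have hr (V : (Spec R).Opens) (s : Γ(GWCorr.push p (GWCorr.push h L'), V)) :
      mapSec p r V (mapSec p i V s) = s := mapSec_mapSec_id hir.retract s
  have key (V : (Spec R).Opens) (hV : IsAffineOpen V) :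
      Function.Injective (mapSec p (pushMap h k) V) ∧
      (∀ s : Γ(GWCorr.push p (D.push Q).F, V),
        (∀ l, (D.push Q).form.toFun V s (mapSec p (pushMap h k) V l) = 0) ↔
          ∃ l, mapSec p (pushMap h k) V l = s) ∧
      (∀ l : Γ(GWCorr.push p (GWCorr.push h L'), V) →ₗ[Γ(Spec R, V)] Γ(Spec R, V),
        ∃ s, ∀ t, (D.push Q).form.toFun V s (mapSec p (pushMap h k) V t) = l t) := by
    obtain ⟨h₁, h₂, h₃⟩ := hj V hV
    refine ⟨fun l l' hl ↦ ?_, fun s ↦ ⟨fun hs ↦ ?_, ?_⟩, fun l ↦ ?_⟩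
    · rw [hk', hk'] at hl
      rw [← hr V l, ← hr V l', h₁ hl]
    · obtain ⟨l, hl⟩ := (h₂ s).mp fun l ↦ by
        have := hs (mapSec p r V l)
        rwa [hk', hi] at this
      exact ⟨mapSec p r V l, by rw [hk', hi, hl]⟩
    · rintro ⟨l, rfl⟩ l'
      rw [hk', hk']
      exact (h₂ _).mpr ⟨_, rfl⟩ _
    · obtain ⟨s, hs⟩ := h₃ (l.comp (mapSecₗ p V r))
      refine ⟨s, fun t ↦ ?_⟩
      rw [hk', hs]
      exact congr_arg l (hr V t)
  refine ⟨L', k, hL', fun V hV ↦ ⟨(key V hV).1, (key V hV).2.1, fun l ↦ ?_⟩⟩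
  exact (key V hV).2.2 (l.comp (pushComp p h L' V).symm.toLinearMap)

lemma isPushforward_push (Q : QuadSpace (h ≫ p) T') : IsPushforward h rfl Q (D.push Q) := by
  refine ⟨Iso.refl _, fun V s t ↦ ?_⟩
  rw [pushIso_hom_app, pushIso_hom_app]
  rfl

/-- Any direct image is isometric to the chosen one, so the maps on groups take the expected value
on all of them. -/
lemma isometric_of_isPushforward {P : QuadSpace p Set.univ} (hP : IsPushforward h rfl Q P) :
    Isometric (D.push Q) P := by
  obtain ⟨e, he⟩ := hP
  refine ⟨e, fun V s t ↦ ?_⟩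
  have := he V ((pushComp p h Q.F V).symm s) ((pushComp p h Q.F V).symm t)
  rw [pushIso_hom_app, pushIso_hom_app] at this
  exact this

end IsLocalPart

end LocalPart

/-! ### Universal properties of the Grothendieck–Witt and Witt groups -/

section Lift

variable {Y X : Scheme.{u}} {p : Y ⟶ X} {T : Set Y} {A : Type*} [AddCommGroup A]

/-- An invariant of quadratic spaces that is additive on orthogonal sums is defined on `GW`. -/
noncomputable def GW.lift (f : QuadSpace p T → A) (hi : ∀ Q Q', Isometric Q Q' → f Q = f Q')
    (hs : ∀ Q Q₁ Q₂, IsOrthogonalSum Q Q₁ Q₂ → f Q = f Q₁ + f Q₂) : GW p T →+ A :=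
  QuotientAddGroup.lift _ (FreeAbelianGroup.lift f) <| by
    rw [AddSubgroup.closure_le]
    rintro _ (⟨Q, Q', h, rfl⟩ | ⟨Q, Q₁, Q₂, h, rfl⟩)
    · simp [hi Q Q' h]
    · simp [hs Q Q₁ Q₂ h]

lemma GW.lift_mk (f : QuadSpace p T → A) (hi hs) (Q : QuadSpace p T) :
    GW.lift f hi hs (GW.mk Q) = f Q := FreeAbelianGroup.lift_apply_of f Q

/-- An invariant of quadratic spaces that is additive on orthogonal sums and trivial on metabolic
spaces is defined on the Witt group. -/
noncomputable def W.lift (f : QuadSpace p T → A) (hi : ∀ Q Q', Isometric Q Q' → f Q = f Q')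
    (hs : ∀ Q Q₁ Q₂, IsOrthogonalSum Q Q₁ Q₂ → f Q = f Q₁ + f Q₂)
    (hm : ∀ Q, IsMetabolic Q → f Q = 0) : W p T →+ A :=
  QuotientAddGroup.lift _ (GW.lift f hi hs) <| by
    rw [AddSubgroup.closure_le]
    rintro _ ⟨Q, hQ, rfl⟩
    exact (GW.lift_mk f hi hs Q).trans (hm Q hQ)

lemma W.lift_mk (f : QuadSpace p T → A) (hi hs hm) (Q : QuadSpace p T) :
    W.lift f hi hs hm (W.mk Q) = f Q := GW.lift_mk f hi hs Q

lemma GW.mk_eq_of_isometric {Q Q' : QuadSpace p T} (h : Isometric Q Q') : GW.mk Q = GW.mk Q' := by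
  rw [← sub_eq_zero]
  exact (QuotientAddGroup.eq_zero_iff _).mpr (AddSubgroup.subset_closure (.inl ⟨Q, Q', h, rfl⟩))

lemma GW.mk_eq_add {Q Q₁ Q₂ : QuadSpace p T} (h : IsOrthogonalSum Q Q₁ Q₂) :
    GW.mk Q = GW.mk Q₁ + GW.mk Q₂ := by
  rw [← sub_eq_zero]
  exact (QuotientAddGroup.eq_zero_iff _).mpr
    (AddSubgroup.subset_closure (.inr ⟨Q, Q₁, Q₂, h, rfl⟩))

variable (p T) in
/-- The projection from the Grothendieck–Witt group to the Witt group. -/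
noncomputable def GW.toW : GW p T →+ W p T := QuotientAddGroup.mk' _

lemma GW.toW_mk (Q : QuadSpace p T) : GW.toW p T (GW.mk Q) = W.mk Q := rfl

lemma GW.toW_surjective : Function.Surjective (GW.toW p T) := QuotientAddGroup.mk'_surjective _

lemma W.mk_eq_of_isometric {Q Q' : QuadSpace p T} (h : Isometric Q Q') : W.mk Q = W.mk Q' := by
  rw [← GW.toW_mk, GW.mk_eq_of_isometric h, GW.toW_mk]

lemma W.mk_eq_add {Q Q₁ Q₂ : QuadSpace p T} (h : IsOrthogonalSum Q Q₁ Q₂) :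
    W.mk Q = W.mk Q₁ + W.mk Q₂ := by
  rw [← GW.toW_mk, GW.mk_eq_add h, map_add, GW.toW_mk, GW.toW_mk]

lemma W.mk_eq_zero {Q : QuadSpace p T} (h : IsMetabolic Q) : W.mk Q = 0 :=
  (QuotientAddGroup.eq_zero_iff _).mpr (AddSubgroup.subset_closure ⟨Q, h, rfl⟩)

lemma GW.closure_range_mk : AddSubgroup.closure (Set.range (GW.mk (p := p) (T := T))) = ⊤ := by
  rw [eq_top_iff]
  intro z _
  obtain ⟨z, rfl⟩ := QuotientAddGroup.mk'_surjective _ z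
  induction z using FreeAbelianGroup.induction_on with
  | zero => exact zero_mem _
  | of Q => exact AddSubgroup.subset_closure ⟨Q, rfl⟩
  | neg Q h => exact neg_mem (h trivial)
  | add x y hx hy => exact add_mem (hx trivial) (hy trivial)

lemma W.closure_range_mk : AddSubgroup.closure (Set.range (W.mk (p := p) (T := T))) = ⊤ := by
  have : Set.range (W.mk (p := p) (T := T)) = GW.toW p T '' Set.range GW.mk := by
    rw [← Set.range_comp]
    rfl
  rw [this, ← AddMonoidHom.map_closure, GW.closure_range_mk, ← AddMonoidHom.range_eq_map,
    AddMonoidHom.range_eq_top]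
  exact GW.toW_surjective

/-- A zero space is its own double, which forces its class to vanish. -/
lemma isOrthogonalSum_self {Q : QuadSpace p T} (h : 𝟙 Q.F = 0) : IsOrthogonalSum Q Q Q := by
  refine isOrthogonalSum_iff.mpr ⟨0, 0, 0, 0, ?_, ?_, ?_, ?_, ?_, fun V s t ↦ ?_⟩
  iterate 2 rw [comp_zero, h]
  iterate 2 rw [comp_zero]
  · rw [comp_zero, add_zero, h]
  · have : s = 0 := by rw [← mapSec_id (p := p) s, h, mapSec_zero_hom]
    rw [this, mapSec_zero, map_zero, LinearMap.zero_apply, LinearMap.zero_apply, add_zero]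

end Lift

/-! ### Decomposition along the closed fibre -/

section Decomposition

/-- The maps `ψ i` read off the coordinates of an element of the direct sum, whence injectivity; the
ranges generate `H`, whence surjectivity. -/
lemma isDirectSumVia_of_retractions {ι : Type*} {G : ι → Type*} [∀ i, AddCommGroup (G i)]
    {H : Type*} [AddCommGroup H] (φ : ∀ i, G i →+ H) (ψ : ∀ i, H →+ G i)
    (h₁ : ∀ i, (ψ i).comp (φ i) = .id _) (h₂ : ∀ i j, i ≠ j → (ψ i).comp (φ j) = 0)
    (h₃ : ⨆ i, (φ i).range = ⊤) : IsDirectSumVia φ := by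
  classical
  have key (i) : (ψ i).comp (DirectSum.toAddMonoid φ) = DFinsupp.evalAddMonoidHom i := by
    refine DirectSum.addHom_ext' fun j ↦ ?_
    ext x
    obtain rfl | hij := eq_or_ne i j
    · have := DFunLike.congr_fun (h₁ i) x
      simp only [AddMonoidHom.comp_apply, DirectSum.toAddMonoid_of] at this ⊢
      rw [this]
      exact (DirectSum.of_eq_same _ _).symm
    · have := DFunLike.congr_fun (h₂ i j hij) x
      simp only [AddMonoidHom.comp_apply, DirectSum.toAddMonoid_of] at this ⊢
      rw [this]
      exact (DirectSum.of_eq_of_ne _ _ _ hij).symm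
  refine ⟨fun z z' hz ↦ ?_, ?_⟩
  · convert (?_ : z = z')
    refine DFinsupp.ext fun i ↦ ?_
    have := DFunLike.congr_fun (key i)
    exact (this z).symm.trans ((congr_arg (ψ i) (by convert hz)).trans (this z'))
  · have : (DirectSum.toAddMonoid φ).range = ⊤ := by
      rw [eq_top_iff, ← h₃, iSup_le_iff]
      rintro i _ ⟨x, rfl⟩
      exact ⟨DirectSum.of G i x, DirectSum.toAddMonoid_of _ _ _⟩
    convert AddMonoidHom.range_eq_top.mp this

variable {R : CommRingCat.{u}} [IsLocalRing R] {Y : Scheme.{u}} {p : Y ⟶ Spec R}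

namespace IsLocalPart

variable {Y' : Scheme.{u}} {h : Y' ⟶ Y} {T' : Set Y'} {C : Set Y} (D : IsLocalPart p h T' C)
include D

/-- The direct image on Grothendieck–Witt groups. -/
noncomputable def gwPush : GW (h ≫ p) T' →+ GW p Set.univ :=
  GW.lift (fun Q ↦ GW.mk (D.push Q)) (fun _ _ hQ ↦ GW.mk_eq_of_isometric (D.isometric_push hQ))
    fun _ _ _ hQ ↦ GW.mk_eq_add (D.isOrthogonalSum_push hQ)

/-- The direct image on Witt groups. -/
noncomputable def wPush : W (h ≫ p) T' →+ W p Set.univ :=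
  W.lift (fun Q ↦ W.mk (D.push Q)) (fun _ _ hQ ↦ W.mk_eq_of_isometric (D.isometric_push hQ))
    (fun _ _ _ hQ ↦ W.mk_eq_add (D.isOrthogonalSum_push hQ))
    fun _ hQ ↦ W.mk_eq_zero (D.isMetabolic_push hQ)

/-- The component of a quadratic space. -/
noncomputable def component (Q : QuadSpace p Set.univ) : QuadSpace (h ≫ p) T' :=
  (D.exists_isComponent Q).choose

lemma isComponent_component (Q : QuadSpace p Set.univ) : IsComponent C Q (D.push (D.component Q)) :=
  (D.exists_isComponent Q).choose_spec

lemma isometric_component {Q Q' : QuadSpace p Set.univ} (hQ : Isometric Q Q') :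
    Isometric (D.component Q) (D.component Q') :=
  D.isometric_of_push ((D.isComponent_component Q).isometric (D.isComponent_component Q') hQ)

lemma isOrthogonalSum_component {Q Q₁ Q₂ : QuadSpace p Set.univ} (hQ : IsOrthogonalSum Q Q₁ Q₂) :
    IsOrthogonalSum (D.component Q) (D.component Q₁) (D.component Q₂) :=
  D.isOrthogonalSum_of_push ((D.isComponent_component Q).isOrthogonalSum
    (D.isComponent_component Q₁) (D.isComponent_component Q₂) hQ)

/-- The projection to a component on Grothendieck–Witt groups. -/
noncomputable def gwComponent : GW p Set.univ →+ GW (h ≫ p) T' :=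
  GW.lift (fun Q ↦ GW.mk (D.component Q))
    (fun _ _ hQ ↦ GW.mk_eq_of_isometric (D.isometric_component hQ))
    fun _ _ _ hQ ↦ GW.mk_eq_add (D.isOrthogonalSum_component hQ)

/-- The projection to a component on Witt groups. -/
noncomputable def wComponent : W p Set.univ →+ W (h ≫ p) T' :=
  W.lift (fun Q ↦ W.mk (D.component Q))
    (fun _ _ hQ ↦ W.mk_eq_of_isometric (D.isometric_component hQ))
    (fun _ _ _ hQ ↦ W.mk_eq_add (D.isOrthogonalSum_component hQ))
    fun Q hQ ↦ W.mk_eq_zero (D.isMetabolic_of_isComponent hQ (D.isComponent_component Q))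

lemma isometric_component_push (Q : QuadSpace (h ≫ p) T') :
    Isometric (D.component (D.push Q)) Q :=
  D.isometric_of_push ((D.isComponent_component _).isometric (D.isComponent_push Q) (.refl _))

lemma id_component_push_eq_zero {Y₂ : Scheme.{u}} {h₂ : Y₂ ⟶ Y} {T₂ : Set Y₂} {C₂ : Set Y}
    (D₂ : IsLocalPart p h₂ T₂ C₂) (hC : Disjoint C C₂) (Q : QuadSpace (h₂ ≫ p) T₂) :
    𝟙 (D.component (D₂.push Q)).F = 0 := by
  have := (D.isComponent_component (D₂.push Q)).id_eq_zero fun y hy hC₁ ↦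
    D₂.zeroNear_push Q y hy (Set.disjoint_left.mp hC hC₁)
  set P := D.component (D₂.push Q)
  exact D.pushMap_injective P.memP P.supp_subset P.memP P.supp_subset
    ((pushMap_id h).trans (this.trans (pushMap_zero h).symm))

end IsLocalPart

variable {ι : Type*} {Y' : ι → Scheme.{u}} {h : ∀ i, Y' i ⟶ Y} {T' : ∀ i, Set (Y' i)}
  {C : ι → Set Y} (D : ∀ i, IsLocalPart p (h i) (T' i) (C i))
include D

/-- Every quadratic space is a sum of components. -/
lemma mk_mem_of_isLocalPart
    (hC : ∀ y, p y = IsLocalRing.closedPoint R → ∃ i, y ∈ C i) (Q : QuadSpace p Set.univ) :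
    GW.mk Q ∈ ⨆ i, (D i).gwPush.range := by
  -- The support meets the closed fibre in finitely many points, so finitely many parts contain all
  -- of them. The induction splits off one part at a time; the complement vanishes along that part
  -- and wherever the space did.
  obtain ⟨K, hK⟩ : ∃ K : Finset ι, ∀ y, p y = IsLocalRing.closedPoint R →
      (∀ i ∈ K, y ∉ C i) → ZeroNear (𝟙 Q.F) y := by
    classical
    choose f hf using hC
    refine ⟨Q.memP.finite_closedFibre.toFinset.attach.image fun y ↦ f y.1
      ((Set.Finite.mem_toFinset _).mp y.2).1, fun y hy hyK ↦ ?_⟩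
    by_contra h0
    refine hyK (f y hy) ?_ (hf y hy)
    exact Finset.mem_image.mpr ⟨⟨y, (Set.Finite.mem_toFinset _).mpr ⟨hy, h0⟩⟩,
      Finset.mem_attach _ _, rfl⟩
  classical
  induction K using Finset.induction generalizing Q with
  | empty =>
    have h0 : 𝟙 Q.F = 0 := Q.memP.eq_zero fun y hy ↦ hK y hy (by simp)
    have := GW.mk_eq_add (isOrthogonalSum_self h0)
    rw [left_eq_add.mp this]
    exact zero_mem _
  | insert i K hi ih =>
    obtain ⟨i₁, r, hc, hf⟩ := (D i).isComponent_component Q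
    obtain ⟨P₂, hs, h0, hz⟩ := hc.exists_complement
    rw [GW.mk_eq_add hs]
    refine add_mem ?_ (ih P₂ fun y hy hyK ↦ ?_)
    · have hiso : Isometric (Q.ofRetract (T' := Set.univ) i₁ r hc.retract
          (hc.isLocalProjection Q.memP)
          ((Q.memP.coherent.supp_subset_of_retract hc.retract).trans Q.supp_subset))
          ((D i).push ((D i).component Q)) :=
        hc.isComponent.isometric ((D i).isComponent_component Q) (.refl _)
      rw [GW.mk_eq_of_isometric hiso]
      exact AddSubgroup.mem_iSup_of_mem i ⟨GW.mk ((D i).component Q), GW.lift_mk _ _ _ _⟩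
    · by_cases hy' : y ∈ C i
      · exact hz y hy hy'
      · refine h0 y (hK y hy fun j hj ↦ ?_)
        obtain rfl | hj := Finset.mem_insert.mp hj
        exacts [hy', hyK j hj]

lemma gwComponent_comp_gwPush (i : ι) : (D i).gwComponent.comp (D i).gwPush = .id _ := by
  refine AddMonoidHom.eq_of_eqOn_dense GW.closure_range_mk ?_
  rintro _ ⟨Q, rfl⟩
  rw [AddMonoidHom.comp_apply, IsLocalPart.gwPush, GW.lift_mk, IsLocalPart.gwComponent, GW.lift_mk]
  exact GW.mk_eq_of_isometric ((D i).isometric_component_push Q)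

lemma gwComponent_comp_gwPush_of_ne (hd : Pairwise (Function.onFun Disjoint C)) {i j : ι}
    (hij : i ≠ j) : (D i).gwComponent.comp (D j).gwPush = 0 := by
  refine AddMonoidHom.eq_of_eqOn_dense GW.closure_range_mk ?_
  rintro _ ⟨Q, rfl⟩
  rw [AddMonoidHom.comp_apply, IsLocalPart.gwPush, GW.lift_mk, IsLocalPart.gwComponent, GW.lift_mk]
  have := GW.mk_eq_add
    (isOrthogonalSum_self ((D i).id_component_push_eq_zero (D j) (hd hij) Q))
  exact left_eq_add.mp this

lemma toW_comp_gwPush (i : ι) :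
    (GW.toW p Set.univ).comp (D i).gwPush = (D i).wPush.comp (GW.toW _ _) := by
  refine AddMonoidHom.eq_of_eqOn_dense GW.closure_range_mk ?_
  rintro _ ⟨Q, rfl⟩
  rw [AddMonoidHom.comp_apply, AddMonoidHom.comp_apply, GW.toW_mk, IsLocalPart.gwPush, GW.lift_mk,
    IsLocalPart.wPush, W.lift_mk, GW.toW_mk]

lemma toW_comp_gwComponent (i : ι) :
    (GW.toW _ _).comp (D i).gwComponent = (D i).wComponent.comp (GW.toW p Set.univ) := by
  refine AddMonoidHom.eq_of_eqOn_dense GW.closure_range_mk ?_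
  rintro _ ⟨Q, rfl⟩
  rw [AddMonoidHom.comp_apply, AddMonoidHom.comp_apply, GW.toW_mk, IsLocalPart.gwComponent,
    GW.lift_mk, IsLocalPart.wComponent, W.lift_mk, GW.toW_mk]

/-- The Grothendieck–Witt group is the direct sum of those of the local parts. -/
theorem isDirectSumVia_gwPush (hd : Pairwise (Function.onFun Disjoint C))
    (hC : ∀ y, p y = IsLocalRing.closedPoint R → ∃ i, y ∈ C i) :
    IsDirectSumVia fun i ↦ (D i).gwPush := by
  refine isDirectSumVia_of_retractions _ (fun i ↦ (D i).gwComponent) (gwComponent_comp_gwPush D)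
    (fun _ _ ↦ gwComponent_comp_gwPush_of_ne D hd) ?_
  rw [eq_top_iff, ← GW.closure_range_mk, AddSubgroup.closure_le]
  rintro _ ⟨Q, rfl⟩
  exact mk_mem_of_isLocalPart D hC Q

/-- The Witt group is the direct sum of those of the local parts. -/
theorem isDirectSumVia_wPush (hd : Pairwise (Function.onFun Disjoint C))
    (hC : ∀ y, p y = IsLocalRing.closedPoint R → ∃ i, y ∈ C i) :
    IsDirectSumVia fun i ↦ (D i).wPush := by
  refine isDirectSumVia_of_retractions _ (fun i ↦ (D i).wComponent) (fun i ↦ ?_)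
    (fun i j hij ↦ ?_) ?_
  -- Direct image and component commute with the surjection onto the Witt group, so the identities
  -- descend from `GW`.
  · refine (AddMonoidHom.cancel_right GW.toW_surjective).mp ?_
    rw [AddMonoidHom.comp_assoc, ← toW_comp_gwPush D, ← AddMonoidHom.comp_assoc,
      ← toW_comp_gwComponent D, AddMonoidHom.comp_assoc, gwComponent_comp_gwPush D]
    rfl
  · refine (AddMonoidHom.cancel_right GW.toW_surjective).mp ?_
    rw [AddMonoidHom.comp_assoc, ← toW_comp_gwPush D, ← AddMonoidHom.comp_assoc,
      ← toW_comp_gwComponent D, AddMonoidHom.comp_assoc, gwComponent_comp_gwPush_of_ne D hd hij,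
      AddMonoidHom.comp_zero, AddMonoidHom.zero_comp]
  · rw [eq_top_iff, ← W.closure_range_mk, AddSubgroup.closure_le]
    rintro _ ⟨Q, rfl⟩
    have hle : ⨆ i, (D i).gwPush.range ≤ (⨆ i, (D i).wPush.range).comap (GW.toW p Set.univ) := by
      rw [iSup_le_iff]
      rintro i _ ⟨z, rfl⟩
      exact AddSubgroup.mem_iSup_of_mem i
        ⟨GW.toW _ _ z, (DFunLike.congr_fun (toW_comp_gwPush D i) z).symm⟩
    exact hle (mk_mem_of_isLocalPart D hC Q)

end Decomposition

section Decomposition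

variable {R : CommRingCat.{u}} [IsLocalRing R] {Y : Scheme.{u}} {p : Y ⟶ Spec R}
  {ι : Type*} {Y' : ι → Scheme.{u}} {h : ∀ i, Y' i ⟶ Y} {T' : ∀ i, Set (Y' i)} {C : ι → Set Y}

/-- Direct image from a family of local parts decomposes the Grothendieck–Witt and Witt groups. -/
theorem exists_isDirectSumVia {p' : ∀ i, Y' i ⟶ Spec R} (hp : ∀ i, h i ≫ p = p' i)
    (D : ∀ i, IsLocalPart p (h i) (T' i) (C i)) (hd : Pairwise (Function.onFun Disjoint C))
    (hC : ∀ y, p y = IsLocalRing.closedPoint R → ∃ i, y ∈ C i) :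
    (∀ (i : ι) (Q' : QuadSpace (p' i) (T' i)), ∃ Q : QuadSpace p Set.univ,
      IsPushforward (h i) (hp i) Q' Q) ∧
    (∃ φ : ∀ i, GW (p' i) (T' i) →+ GW p Set.univ,
      (∀ (i : ι) (Q' : QuadSpace (p' i) (T' i)) (Q : QuadSpace p Set.univ),
        IsPushforward (h i) (hp i) Q' Q → φ i (GW.mk Q') = GW.mk Q) ∧ IsDirectSumVia φ) ∧
    (∃ φ : ∀ i, W (p' i) (T' i) →+ W p Set.univ,
      (∀ (i : ι) (Q' : QuadSpace (p' i) (T' i)) (Q : QuadSpace p Set.univ),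
        IsPushforward (h i) (hp i) Q' Q → φ i (W.mk Q') = W.mk Q) ∧ IsDirectSumVia φ) := by
  obtain rfl : (fun i ↦ h i ≫ p) = p' := funext hp
  exact ⟨fun i Q' ↦ ⟨_, (D i).isPushforward_push Q'⟩,
    ⟨fun i ↦ (D i).gwPush, fun i Q' Q hQ ↦ (GW.lift_mk _ _ _ _).trans
      (GW.mk_eq_of_isometric ((D i).isometric_of_isPushforward hQ)),
      isDirectSumVia_gwPush D hd hC⟩,
    ⟨fun i ↦ (D i).wPush, fun i Q' Q hQ ↦ (W.lift_mk _ _ _ _ _).trans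
      (W.mk_eq_of_isometric ((D i).isometric_of_isPushforward hQ)),
      isDirectSumVia_wPush D hd hC⟩⟩

end Decomposition

/-! ### Direct image along closed immersions -/

section ClosedImmersion

open TopologicalSpace Opposite

variable {T Y Y' X : Scheme.{u}}

/-- A morphism of sheaves of modules from its values on sections. -/
lemma exists_hom_of_sections {F G : Y.Modules} (φ : ∀ V : Y.Opens, Γ(F, V) →+ Γ(G, V))
    (hres : ∀ (V W : Y.Opens) (h : V ≤ W) (s : Γ(F, W)), φ V (res F h s) = res G h (φ W s))
    (hsmul : ∀ (V : Y.Opens) (a : Γ(Y, V)) (s : Γ(F, V)), φ V (a • s) = a • φ V s) :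
    ∃ ψ : F ⟶ G, ∀ V s, ψ.app V s = φ V s := by
  let α : F.presheaf ⟶ G.presheaf :=
    { app V := AddCommGrpCat.ofHom (φ V.unop)
      naturality V W f := by
        ext s
        exact hres _ _ (leOfHom f.unop) s }
  let β : F.val ⟶ G.val := PresheafOfModules.homMk α fun V a s ↦ hsmul V.unop a s
  exact ⟨(Scheme.Modules.fullyFaithfulToPresheafOfModules (X := Y)).preimage β, fun V s ↦ rfl⟩

lemma exists_preimage_eq (q : T ⟶ Y) [IsClosedImmersion q] (V : T.Opens) :
    ∃ W : Y.Opens, q ⁻¹ᵁ W = V := by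
  obtain ⟨W, hW, h⟩ := q.isClosedEmbedding.isInducing.isOpen_iff.mp V.2
  exact ⟨⟨W, hW⟩, Opens.ext h⟩

variable {M N : T.Modules}

/-- Direct image along a closed immersion is full. -/
lemma exists_hom_of_isClosedImmersion (q : T ⟶ Y) [IsClosedImmersion q]
    (φ : ∀ W : Y.Opens, Γ(M, q ⁻¹ᵁ W) →+ Γ(N, q ⁻¹ᵁ W))
    (hres : ∀ (V W : Y.Opens) (h : V ≤ W) (s : Γ(M, q ⁻¹ᵁ W)),
      φ V (res M (q.preimage_mono h) s) = res N (q.preimage_mono h) (φ W s))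
    (hsmul : ∀ (W : Y.Opens) (a : Γ(Y, W)) (s : Γ(M, q ⁻¹ᵁ W)),
      φ W (q.app W a • s) = q.app W a • φ W s) :
    ∃ ψ : M ⟶ N, ∀ W s, ψ.app (q ⁻¹ᵁ W) s = φ W s := by
  -- Every open set of `T` is a preimage, of the chosen `w V` among others. Compatibility with
  -- restriction makes the resulting value independent of the choice; this is `key`.
  choose w hw using exists_preimage_eq q
  let φ' (V : T.Opens) : Γ(M, V) →+ Γ(N, V) :=
    (res N (hw V).ge).comp ((φ (w V)).comp (res M (hw V).le))
  have hφ' (V : T.Opens) (s : Γ(M, V)) :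
      φ' V s = res N (hw V).ge (φ (w V) (res M (hw V).le s)) := rfl
  have key (W : Y.Opens) (V : T.Opens) (h : V ≤ q ⁻¹ᵁ W) (s : Γ(M, q ⁻¹ᵁ W)) :
      res N h (φ W s) = φ' V (res M h s) := by
    have h' : V ≤ q ⁻¹ᵁ (W ⊓ w V) := le_inf h (hw V).ge
    have e₁ := congr(res N h' $(hres _ _ (inf_le_left : W ⊓ w V ≤ W) s))
    have e₂ := congr(res N h' $(hres _ _ (inf_le_right : W ⊓ w V ≤ w V)
      (res M (hw V).le (res M h s))))
    rw [hφ']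
    simp only [res_res] at e₁ e₂ ⊢
    rw [← e₁, ← e₂]
  have key' (W : Y.Opens) (s : Γ(M, q ⁻¹ᵁ W)) : φ' (q ⁻¹ᵁ W) s = φ W s := by
    have := key W _ le_rfl s
    rwa [res_self, res_self, eq_comm] at this
  have hres' (V V' : T.Opens) (h : V ≤ V') (s : Γ(M, V')) :
      φ' V (res M h s) = res N h (φ' V' s) := by
    have := key (w V') V (h.trans (hw V').ge) (res M (hw V').le s)
    rw [res_res] at this
    rw [← this, hφ', res_res]
  obtain ⟨ψ, hψ⟩ := exists_hom_of_sections φ' hres' fun V a s ↦ by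
    -- Linearity is given only for functions from `Y`, but over preimages of affine open sets every
    -- function on `T` is one of these.
    refine section_ext fun t ht ↦ ?_
    have ht' : q t ∈ w V := (hw V).ge ht
    obtain ⟨_, ⟨W, hW, rfl⟩, htW, hWV⟩ :=
      Y.isBasis_affineOpens.exists_subset_of_mem_open ht' (w V).2
    have hle : q ⁻¹ᵁ W ≤ V := (q.preimage_mono hWV).trans (hw V).le
    obtain ⟨b, hb⟩ := q.app_surjective W hW (resO hle a)
    refine ⟨q ⁻¹ᵁ W, hle, htW, ?_⟩
    rw [← hres', res_smul, res_smul, ← hb, key', hsmul, ← key', hres']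
  exact ⟨ψ, fun W s ↦ (hψ _ _).trans (key' W s)⟩

lemma pushMap_injective_of_isClosedImmersion (q : T ⟶ Y) [IsClosedImmersion q] {φ ψ : M ⟶ N}
    (h : pushMap q φ = pushMap q ψ) : φ = ψ := by
  refine hom_ext_apply fun V s ↦ ?_
  obtain ⟨W, rfl⟩ := exists_preimage_eq q V
  exact congr(($h).app W (toPush q M W s))

lemma exists_pushMap_eq_of_isClosedImmersion (q : T ⟶ Y) [IsClosedImmersion q]
    (φ : push q M ⟶ push q N) : ∃ ψ : M ⟶ N, pushMap q ψ = φ := by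
  obtain ⟨ψ, hψ⟩ := exists_hom_of_isClosedImmersion q
    (fun W ↦ ((toPush q N W).symm.toAddMonoidHom.comp (φ.app W).hom).comp
      (toPush q M W).toAddMonoidHom) (fun V W h s ↦ app_res φ h _)
    fun W a s ↦ φ.app_smul a (toPush q M W s)
  exact ⟨ψ, hom_ext_apply fun W s ↦ hψ W s⟩

lemma pushMap_pushMap_injective (i : T ⟶ Y') (h : Y' ⟶ Y) [IsClosedImmersion (i ≫ h)]
    {φ ψ : M ⟶ N} (e : pushMap h (pushMap i φ) = pushMap h (pushMap i ψ)) : φ = ψ := by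
  refine pushMap_injective_of_isClosedImmersion (i ≫ h) (hom_ext_apply fun W s ↦ ?_)
  exact congr(($e).app W s)

lemma exists_pushMap_pushMap_eq (i : T ⟶ Y') (h : Y' ⟶ Y) [IsClosedImmersion (i ≫ h)]
    (φ : push h (push i M) ⟶ push h (push i N)) : ∃ ψ : M ⟶ N, pushMap h (pushMap i ψ) = φ := by
  obtain ⟨ψ, hψ⟩ := exists_hom_of_isClosedImmersion (M := M) (N := N) (i ≫ h)
    (fun W ↦ (φ.app W).hom) (fun V W h s ↦ app_res φ h _)
    fun W a s ↦ by
      rw [Scheme.Hom.comp_app]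
      exact φ.app_smul a s
  exact ⟨ψ, hom_ext_apply fun W s ↦ hψ W s⟩

/-- Direct images along `i` and along `i ≫ h` are both fully faithful, so direct image along `h` is
fully faithful on the sheaves coming from `i`. -/
lemma bijective_pushMap_of_iso (i : T ⟶ Y') (h : Y' ⟶ Y) [IsClosedImmersion i]
    [IsClosedImmersion (i ≫ h)] {F G : Y'.Modules} (e : F ≅ push i M) (e' : G ≅ push i N) :
    Function.Bijective (pushMap h : (F ⟶ G) → (push h F ⟶ push h G)) := by
  have conj {φ ψ : F ⟶ G} (hφ : e.inv ≫ φ ≫ e'.hom = e.inv ≫ ψ ≫ e'.hom) : φ = ψ := by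
    rwa [Iso.cancel_iso_inv_left, Iso.cancel_iso_hom_right] at hφ
  refine ⟨fun φ ψ hφ ↦ conj ?_, fun φ ↦ ?_⟩
  · obtain ⟨φ', h₁⟩ := exists_pushMap_eq_of_isClosedImmersion i (e.inv ≫ φ ≫ e'.hom)
    obtain ⟨ψ', h₂⟩ := exists_pushMap_eq_of_isClosedImmersion i (e.inv ≫ ψ ≫ e'.hom)
    rw [← h₁, ← h₂, pushMap_pushMap_injective i h (φ := φ') (ψ := ψ') ?_]
    rw [h₁, h₂, pushMap_comp, pushMap_comp, hφ, ← pushMap_comp, ← pushMap_comp]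
  · obtain ⟨ψ, hψ⟩ := exists_pushMap_pushMap_eq i h (pushMap h e.inv ≫ φ ≫ pushMap h e'.hom)
    refine ⟨e.hom ≫ pushMap i ψ ≫ e'.inv, ?_⟩
    have h₁ : pushMap h e.hom ≫ pushMap h e.inv = 𝟙 _ := by
      rw [← pushMap_comp, e.hom_inv_id, pushMap_id]
    have h₂ : pushMap h e'.hom ≫ pushMap h e'.inv = 𝟙 _ := by
      rw [← pushMap_comp, e'.hom_inv_id, pushMap_id]
    rw [pushMap_comp, pushMap_comp, hψ, Category.assoc, Category.assoc, h₂, Category.comp_id,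
      ← Category.assoc, h₁, Category.id_comp]

lemma section_eq_zero_of_preimage (q : T ⟶ Y) {W : Y.Opens} (hW : ∀ t, q t ∉ W)
    (s : Γ(M, q ⁻¹ᵁ W)) : s = 0 := section_ext fun t ht ↦ (hW t ht).elim

/-- Near a point of the image the multiplier lifts to `Y`; away from the closed image all sections
vanish and the multiplier `0` serves. -/
lemma reflectsMultiples_of_isClosedImmersion (q : T ⟶ Y) [IsClosedImmersion q] :
    ReflectsMultiples q M N := by
  intro W s s' t t' hst y hy
  by_cases hyq : y ∈ Set.range q
  · obtain ⟨z, rfl⟩ := hyq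
    obtain ⟨V, hV, a, hzV, hs, ht⟩ := hst z hy
    obtain ⟨W₁, rfl⟩ := exists_preimage_eq q V
    obtain ⟨_, ⟨W₂, hW₂, rfl⟩, hzW, hW⟩ :=
      Y.isBasis_affineOpens.exists_subset_of_mem_open (u := ↑(W ⊓ W₁)) ⟨hy, hzV⟩ (W ⊓ W₁).2
    have h₁ : W₂ ≤ W₁ := fun _ h ↦ (hW h).2
    have h₂ : W₂ ≤ W := fun _ h ↦ (hW h).1
    obtain ⟨b, hb⟩ := q.app_surjective W₂ hW₂ (resO (q.preimage_mono h₁) a)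
    refine ⟨W₂, h₂, b, hzW, ?_, ?_⟩
    · have := congr(res M (q.preimage_mono h₁) $hs)
      rw [map_eq_res, map_eq_res, res_res, res_smul, res_res, ← hb] at this
      exact this
    · have := congr(res N (q.preimage_mono h₁) $ht)
      rw [map_eq_res, map_eq_res, res_res, res_smul, res_res, ← hb] at this
      exact this
  · let O : Y.Opens := ⟨_, q.isClosedEmbedding.isClosed_range.isOpen_compl⟩
    have hO (t : T) : q t ∉ W ⊓ O := fun h ↦ h.2 ⟨t, rfl⟩
    exact ⟨W ⊓ O, inf_le_left, 0, ⟨hy, hyq⟩,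
      (section_eq_zero_of_preimage (M := M) q hO _).trans
        (section_eq_zero_of_preimage (M := M) q hO _).symm,
      (section_eq_zero_of_preimage (M := N) q hO _).trans
        (section_eq_zero_of_preimage (M := N) q hO _).symm⟩

lemma ReflectsMultiples.of_iso (i : T ⟶ Y') (h : Y' ⟶ Y) (hi : ReflectsMultiples (i ≫ h) M N)
    {F G : Y'.Modules} (e : F ≅ push i M) (e' : G ≅ push i N) : ReflectsMultiples h F G := by
  intro W s s' t t' hst
  have h₁ := LocallyMultiples.of_push (h := i) (W := h ⁻¹ᵁ W) (F' := M) (G' := N)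
    (hst.map e.hom e'.hom)
  have h₂ : LocallyMultiples (toPush h (push i M) W (e.hom.app _ s))
      (toPush h (push i M) W (e.hom.app _ s')) (toPush h (push i N) W (e'.hom.app _ t))
      (toPush h (push i N) W (e'.hom.app _ t')) := hi W _ _ _ _ h₁
  have h₃ := h₂.map (pushMap h e.inv) (pushMap h e'.inv)
  simp only [map_app_toPush, ← comp_app_apply, e.hom_inv_id, e'.hom_inv_id] at h₃
  exact h₃

lemma zeroNear_push_of_notMem_range (q : T ⟶ Y) (hq : IsClosed (Set.range q)) {y : Y}
    (hy : y ∉ Set.range q) : ZeroNear (𝟙 (push q M)) y := by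
  refine ⟨⟨_, hq.isOpen_compl⟩, hy, fun V hV ↦ (toPush q M V).surjective.forall.mpr fun s ↦ ?_⟩
  rw [id_app_apply, section_eq_zero_of_preimage q (fun t ht ↦ hV ht ⟨t, rfl⟩) s, map_zero]

lemma isFiniteLocallyFree_push_iff (h : Y' ⟶ Y) (p : Y ⟶ X) (F : Y'.Modules) :
    IsFiniteLocallyFree (push (h ≫ p) F) ↔ IsFiniteLocallyFree (push p (push h F)) := by
  refine forall₂_congr fun V _ ↦ ⟨fun ⟨h₁, h₂⟩ ↦ ?_, fun ⟨h₁, h₂⟩ ↦ ?_⟩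
  · exact ⟨Module.Finite.equiv (pushComp p h F V), Module.Projective.of_equiv (pushComp p h F V)⟩
  · exact ⟨Module.Finite.equiv (pushComp p h F V).symm,
      Module.Projective.of_equiv (pushComp p h F V).symm⟩

/-- The kernel of `q` is the ideal sheaf required by the support condition: its subscheme is
isomorphic to `T`. -/
lemma memP_push_of_isClosedImmersion (q : T ⟶ Y) [IsClosedImmersion q] (p : Y ⟶ X)
    [IsFinite (q ≫ p)] (hM : IsCoherent M) (hf : IsFiniteLocallyFree (push (q ≫ p) M)) :
    MemP p (push q M) where
  coherent := hM.push q
  finiteSupport := by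
    refine ⟨q.ker, ?_, fun W a ha ↦ (toPush q M W).surjective.forall.mpr fun s ↦ ?_⟩
    · have : inv q.toImage ≫ q ≫ p = q.ker.subschemeι ≫ p := by
        rw [IsIso.inv_comp_eq, ← Category.assoc]
        exact congr($(q.toImage_imageι.symm) ≫ p)
      rw [← this]
      infer_instance
    · have : q.app W.1 a = 0 := by simpa using ha
      rw [smul_toPush, this, zero_smul, map_zero]
  locallyFree := (isFiniteLocallyFree_push_iff q p M).mp hf

end ClosedImmersion

/-! ### Quasi-coherent sheaves annihilated by an ideal -/

section Annihilated

open TopologicalSpace Opposite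

variable {E B : CommRingCat.{u}}

/-- The global sections of a sheaf of modules on `Spec E`, as an `E`-module. -/
noncomputable abbrev globalSections (K : (Spec E).Modules) : ModuleCat.{u} E :=
  (modulesSpecToSheaf.obj K).presheaf.obj (.op ⊤)

/-- Quasi-coherent sheaves on an affine scheme with isomorphic modules of global sections are
isomorphic. -/
noncomputable def isoOfGlobalSections {K K' : (Spec E).Modules} (hK : K.IsQuasicoherent)
    (hK' : K'.IsQuasicoherent) (e : globalSections K ≅ globalSections K') : K ≅ K' :=
  have _i := (isQuasicoherent_iff_isIso_fromTildeΓ K).mp hK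
  have _i' := (isQuasicoherent_iff_isIso_fromTildeΓ K').mp hK'
  have e₁ : tilde (globalSections K) ≅ K := asIso K.fromTildeΓ
  have e₂ : tilde (globalSections K') ≅ K' := asIso K'.fromTildeΓ
  e₁.symm ≪≫ (tilde.functor E).mapIso e ≪≫ e₂

/-- Global sections of a direct image. -/
noncomputable def globalSectionsPush (φ : E ⟶ B) (K : (Spec B).Modules) :
    globalSections (push (Spec.map φ) K) ≅
      (ModuleCat.restrictScalars φ.hom).obj (globalSections K) :=
  (TopCat.Sheaf.forget _ _ ⋙ (evaluation _ _).obj (.op ⊤)).mapIso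
    ((pushforwardCompModulesSpecToSheafIso φ).app K)

lemma nonempty_iso_push_tilde (φ : E ⟶ B) {K : (Spec E).Modules} (hK : K.IsQuasicoherent)
    (N : ModuleCat.{u} B) (e : globalSections K ≅ (ModuleCat.restrictScalars φ.hom).obj N) :
    Nonempty (K ≅ push (Spec.map φ) (tilde N)) := by
  have hN : (push (Spec.map φ) (tilde N)).IsQuasicoherent :=
    (isQuasicoherent_iff_hasFractions _).mpr
      (HasFractions.push _ ((isQuasicoherent_iff_hasFractions _).mp inferInstance))
  let e₂ : N ≅ globalSections (tilde N) := tilde.isoTop N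
  exact ⟨isoOfGlobalSections hK hN (e ≪≫ (ModuleCat.restrictScalars φ.hom).mapIso e₂ ≪≫
    (globalSectionsPush φ (tilde N)).symm)⟩

/-- The global sections form an `E ⧸ I`-module. The direct image of its associated sheaf has the
same global sections as `K`, and these determine a quasi-coherent sheaf on an affine scheme. -/
lemma exists_push_iso_of_annihilated (K : (Spec E).Modules) (hK : K.IsQuasicoherent)
    (I : Ideal E) (h : ∀ a ∈ I, ∀ s : Γ(K, ⊤), a • s = 0) :
    ∃ K₀ : (Spec (.of (E ⧸ I))).Modules, K₀.IsQuasicoherent ∧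
      Nonempty (K ≅ push (Spec.map (CommRingCat.ofHom (Ideal.Quotient.mk I))) K₀) := by
  have ht : Module.IsTorsionBySet E (globalSections K) I := fun s a ↦ h a.1 a.2 s
  let m : Module (CommRingCat.of (E ⧸ I)) (globalSections K) := ht.module
  let N : ModuleCat.{u} (CommRingCat.of (E ⧸ I)) := ModuleCat.of _ (globalSections K)
  let φ : E ⟶ .of (E ⧸ I) := CommRingCat.ofHom (Ideal.Quotient.mk I)
  let l : globalSections K ≃ₗ[E] (ModuleCat.restrictScalars φ.hom).obj N :=
    { toFun s := s, invFun s := s, map_add' _ _ := rfl, map_smul' _ _ := rfl,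
      left_inv _ := rfl, right_inv _ := rfl }
  exact ⟨tilde N, inferInstance, nonempty_iso_push_tilde φ hK N l.toModuleIso⟩

lemma isCoherent_of_push {T Y : Scheme.{u}} [IsAffine T] (q : T ⟶ Y) {M : T.Modules}
    (hM : M.IsQuasicoherent) (h : Module.Finite Γ(Y, ⊤) Γ(push q M, ⊤)) : IsCoherent M := by
  suffices Module.Finite Γ(T, ⊤) Γ(M, ⊤) from isCoherent_of_finite_top hM
  obtain ⟨t, ht⟩ := h.fg_top
  classical
  let f : Γ(push q M, ⊤) → Γ(M, ⊤) := (toPush q M ⊤).symm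
  refine ⟨⟨t.image f, eq_top_iff.mpr ?_⟩⟩
  rw [Finset.coe_image]
  rintro s -
  obtain ⟨s, rfl⟩ : ∃ x, f x = s := (toPush q M ⊤).symm.surjective s
  have hs : s ∈ Submodule.span Γ(Y, ⊤) (t : Set Γ(push q M, ⊤)) := by
    rw [ht]; exact Submodule.mem_top
  induction hs using Submodule.span_induction with
  | mem x hx => exact Submodule.subset_span ⟨x, hx, rfl⟩
  | zero => exact zero_mem _
  | add x y _ _ hx hy => exact add_mem hx hy
  | smul r x _ hx => exact Submodule.smul_mem _ (q.app ⊤ r) hx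

end Annihilated

/-! ### Restriction to an affine open set -/

section Restriction

open TopologicalSpace Opposite

variable {Y : Scheme.{u}} {W : Y.Opens} (hW : IsAffineOpen W) (F : Y.Modules)

/-- The restriction map from a sheaf to the direct image of its restriction to an affine open
set. -/
noncomputable def toPushRestrict : F ⟶ push hW.fromSpec (F.restrict hW.fromSpec) :=
  (Scheme.Modules.restrictAdjunction hW.fromSpec).unit.app F

lemma image_preimage_fromSpec (V : Y.Opens) : V ⊓ W = hW.fromSpec ''ᵁ (hW.fromSpec ⁻¹ᵁ V) := by
  rw [Scheme.Hom.image_preimage_eq_opensRange_inf, hW.opensRange_fromSpec, inf_comm]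

/-- The sections of the direct image of the restriction. -/
noncomputable def pushRestrictSections (V : Y.Opens) :
    Γ(F, V ⊓ W) →+ Γ(push hW.fromSpec (F.restrict hW.fromSpec), V) :=
  (toPush hW.fromSpec (F.restrict hW.fromSpec) V).toAddMonoidHom.comp
    (specSections F hW (hW.fromSpec ⁻¹ᵁ V) (V ⊓ W) (image_preimage_fromSpec hW V))

lemma pushRestrictSections_bijective (V : Y.Opens) :
    Function.Bijective (pushRestrictSections hW F V) :=
  (toPush hW.fromSpec (F.restrict hW.fromSpec) V).bijective.comp (specSections_bijective ..)

lemma toPushRestrict_app (V : Y.Opens) (s : Γ(F, V)) :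
    (toPushRestrict hW F).app V s = pushRestrictSections hW F V (res F inf_le_left s) := by
  have : (toPushRestrict hW F).app V s =
    toPush hW.fromSpec (F.restrict hW.fromSpec) V
      (res F (V := hW.fromSpec ''ᵁ (hW.fromSpec ⁻¹ᵁ V))
        ((image_preimage_fromSpec hW V).ge.trans inf_le_left) s) :=
    congr($(Scheme.Modules.restrictAdjunction_unit_app_app hW.fromSpec F V) s)
  rw [this]
  refine congr_arg (toPush hW.fromSpec (F.restrict hW.fromSpec) V) ?_
  exact (res_res (F := F) _ _ s).symm

lemma bijective_toPushRestrict_app (V : Y.Opens) (h : V ≤ W) :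
    Function.Bijective ((toPushRestrict hW F).app V) := by
  have : ⇑((toPushRestrict hW F).app V).hom =
      pushRestrictSections hW F V ∘ res F inf_le_left := funext (toPushRestrict_app hW F V)
  exact this ▸ (pushRestrictSections_bijective hW F V).comp (res_bijective _ (le_inf le_rfl h))

end Restriction

/-! ### Splitting off the part of a sheaf on an affine open set -/

section Split

open TopologicalSpace Opposite

variable {Y : Scheme.{u}} {W D : Y.Opens} (hW : IsAffineOpen W) (F : Y.Modules)

/-- If `F` vanishes on the intersection of `W` and `D`, and these cover `Y`, then the part of `F` on
`W` is a direct summand. -/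
lemma exists_section_toPushRestrict (hWD : W ⊔ D = ⊤) (h0 : ∀ y ∈ W ⊓ D, ZeroNear (𝟙 F) y) :
    ∃ i : push hW.fromSpec (F.restrict hW.fromSpec) ⟶ F, i ≫ toPushRestrict hW F = 𝟙 _ ∧
      ∀ (V : Y.Opens) (t : Γ(push hW.fromSpec (F.restrict hW.fromSpec), V)),
        res F (inf_le_left : V ⊓ D ≤ V) (i.app V t) = 0 := by
  let N := push hW.fromSpec (F.restrict hW.fromSpec)
  have hcov (V : Y.Opens) : V ≤ (V ⊓ W) ⊔ (V ⊓ D) := by rw [← inf_sup_left, hWD, inf_top_eq]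
  -- Extension by zero: sections on `V ⊓ W` glue with `0` on `V ⊓ D`, since `F` vanishes on the
  -- overlap.
  have hex (V : Y.Opens) (t : Γ(N, V)) : ∃ s : Γ(F, V), (toPushRestrict hW F).app V s = t ∧
      res F (inf_le_left : V ⊓ D ≤ V) s = 0 := by
    obtain ⟨s₁, hs₁⟩ := (pushRestrictSections_bijective hW F V).2 t
    obtain ⟨s, h₁, h₂⟩ := exists_glue (F := F) inf_le_left inf_le_left (hcov V) s₁ 0 (by
      rw [map_zero]
      have hz : ∀ y ∈ (V ⊓ W) ⊓ (V ⊓ D), ZeroNear (𝟙 F) y := fun y hy ↦ h0 y ⟨hy.1.2, hy.2.2⟩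
      exact section_eq_zero_of_zeroNear hz _)
    exact ⟨s, by rw [toPushRestrict_app, h₁, hs₁], h₂⟩
  have huniq (V : Y.Opens) (s s' : Γ(F, V))
      (h : (toPushRestrict hW F).app V s = (toPushRestrict hW F).app V s')
      (hs : res F (inf_le_left : V ⊓ D ≤ V) s = 0)
      (hs' : res F (inf_le_left : V ⊓ D ≤ V) s' = 0) : s = s' := by
    rw [toPushRestrict_app, toPushRestrict_app] at h
    exact section_ext_of_sup inf_le_left inf_le_left (hcov V)
      ((pushRestrictSections_bijective hW F V).1 h) (hs.trans hs'.symm)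
  choose σ h₁ h₂ using hex
  let φ (V : Y.Opens) : Γ(N, V) →+ Γ(F, V) := AddMonoidHom.mk' (σ V) fun s t ↦ by
    refine huniq V _ _ ?_ (h₂ V _) ?_
    · rw [map_add, h₁, h₁, h₁]
    · rw [map_add, h₂, h₂, add_zero]
  obtain ⟨i, hi⟩ := exists_hom_of_sections (F := N) (G := F) φ
    (fun V V' h s ↦ by
      refine huniq V _ _ ?_ (h₂ V _) ?_
      · rw [app_res]
        refine (h₁ V _).trans ?_
        exact congr_arg (res N h) (h₁ V' s).symm
      · have := congr_arg (res F (inf_le_inf_right D h)) (h₂ V' s)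
        rw [res_res, map_zero] at this
        rw [res_res]
        exact this)
    (fun V a s ↦ by
      refine huniq V _ _ ?_ (h₂ V _) ?_
      · rw [Scheme.Modules.Hom.app_smul]
        refine (h₁ V _).trans ?_
        exact congr_arg (a • ·) (h₁ V s).symm
      · rw [res_smul]
        exact (congr_arg _ (h₂ V s)).trans (smul_zero _))
  refine ⟨i, hom_ext_apply fun V s ↦ ?_, fun V t ↦ ?_⟩
  · rw [comp_app_apply, hi]
    exact h₁ V s
  · rw [hi]
    exact h₂ V t

/-- Near points of `W` the restriction map is bijective, so the projection is the identity there.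
Near points of `D` extension by zero vanishes, so the summand does. -/
lemma exists_isSheafComponent_of_split {R : CommRingCat.{u}} [IsLocalRing R] {p : Y ⟶ Spec R}
    {C : Set Y} (hWD : W ⊔ D = ⊤) (h0 : ∀ y ∈ W ⊓ D, ZeroNear (𝟙 F) y)
    (hC : ∀ y, p y = IsLocalRing.closedPoint R → ¬ ZeroNear (𝟙 F) y → (y ∈ W ↔ y ∈ C)) :
    ∃ i : push hW.fromSpec (F.restrict hW.fromSpec) ⟶ F,
      IsSheafComponent p C i (toPushRestrict hW F) := by
  obtain ⟨i, hi, hD⟩ := exists_section_toPushRestrict hW F hWD h0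
  refine ⟨i, hi, fun y hy hyC ↦ ?_, fun y hy hyC ↦ ?_⟩
  · by_cases hz : ZeroNear (𝟙 F) y
    · exact hz.of_id_left
    refine ⟨W, (hC y hy hz).mpr hyC, fun V hV s ↦ ?_⟩
    rw [sub_app_apply, id_app_apply, comp_app_apply, sub_eq_zero]
    apply (bijective_toPushRestrict_app hW F V hV).1
    rw [← comp_app_apply i, hi, id_app_apply]
  · by_cases hz : ZeroNear (𝟙 F) y
    · exact hz.of_retract hi
    have hyD : y ∈ D := by
      have : y ∈ W ⊔ D := hWD ▸ trivial
      exact this.resolve_left fun h ↦ hyC ((hC y hy hz).mp h)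
    refine ⟨D, hyD, fun V hV s ↦ ?_⟩
    have h₀ : i.app V s = 0 :=
      (res_bijective (inf_le_left : V ⊓ D ≤ V) (le_inf le_rfl hV)).1
        ((hD V s).trans (map_zero _).symm)
    rw [← hi, comp_app_apply, h₀, map_zero]

end Split

/-! ### Finite schemes over a local base -/

section Finite

open TopologicalSpace Opposite

variable {R B : CommRingCat.{u}} {Y : Scheme.{u}} {F : Y.Modules}

lemma exists_specMap_of_isFinite (f : Spec B ⟶ Spec R) [IsFinite f] :
    ∃ φ : R ⟶ B, φ.hom.Finite ∧ f = Spec.map φ := by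
  have h : Spec.map (Spec.preimage f) = f := Spec.map_preimage f
  exact ⟨Spec.preimage f, (IsFinite.SpecMap_iff _).mp (h.symm ▸ inferInstance), h.symm⟩

lemma isMaximal_iff_of_finite [IsLocalRing R] {φ : R ⟶ B} (hφ : φ.hom.Finite) (b : Spec B) :
    b.asIdeal.IsMaximal ↔ Spec.map φ b = IsLocalRing.closedPoint R := by
  algebraize [φ.hom]
  have hc : (Spec.map φ b).asIdeal = b.asIdeal.comap (algebraMap R B) := rfl
  refine ⟨fun h ↦ ?_, fun h ↦ ?_⟩
  · have := Ideal.isMaximal_comap_of_isIntegral_of_isMaximal (R := R) b.asIdeal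
    exact PrimeSpectrum.ext (hc.trans (IsLocalRing.eq_maximalIdeal this))
  · have : b.asIdeal.IsPrime := b.2
    refine Ideal.isMaximal_of_isIntegral_of_isMaximal_comap (R := R) b.asIdeal ?_
    rw [← hc, h]
    exact IsLocalRing.maximalIdeal.isMaximal R

/-- The support of an object of `P(p)` lies in an affine scheme finite over the base. -/
lemma MemP.exists_specMap {p : Y ⟶ Spec R} (h : MemP p F) :
    ∃ (B : CommRingCat.{u}) (q : Spec B ⟶ Y), IsClosedImmersion q ∧ IsFinite (q ≫ p) ∧
      ∀ y ∉ Set.range q, ZeroNear (𝟙 F) y := by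
  obtain ⟨I, hI, h0⟩ := h.finiteSupport
  have : IsAffine I.subscheme := isAffine_of_isAffineHom (I.subschemeι ≫ p)
  refine ⟨_, I.subscheme.isoSpec.inv ≫ I.subschemeι, inferInstance, ?_, fun y hy ↦ ?_⟩
  · rw [Category.assoc]
    infer_instance
  · refine zeroNear_of_notMem_range h.coherent.hasFractions h0 ?_
    rintro ⟨z, rfl⟩
    obtain ⟨z, rfl⟩ := I.subscheme.isoSpec.inv.surjective z
    exact hy ⟨z, by simp⟩

/-- Over a henselian local base, any part of the closed fibre of the support is cut out by an
open set. -/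
lemma exists_isAffineOpen_separating [HenselianLocalRing R] {p : Y ⟶ Spec R} (h : MemP p F)
    (C : Set Y) {W₀ : Y.Opens} (hW₀ : IsAffineOpen W₀)
    (hC : ∀ y, p y = IsLocalRing.closedPoint R → ¬ ZeroNear (𝟙 F) y → y ∈ C → y ∈ W₀) :
    ∃ W D : Y.Opens, IsAffineOpen W ∧ W ≤ W₀ ∧ W ⊔ D = ⊤ ∧ (∀ y ∈ W ⊓ D, ZeroNear (𝟙 F) y) ∧
      ∀ y, p y = IsLocalRing.closedPoint R → ¬ ZeroNear (𝟙 F) y → (y ∈ W ↔ y ∈ C) := by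
  obtain ⟨B, q, hq, hqp, h0⟩ := h.exists_specMap
  obtain ⟨φ, hφ, hqφ⟩ := exists_specMap_of_isFinite (q ≫ p)
  algebraize [φ.hom]
  -- The maximal ideals of `B` are the points over the closed point, so an idempotent selects the
  -- chosen part of the closed fibre.
  obtain ⟨e, he, he'⟩ := exists_isIdempotentElem_forall_notMem_iff R (B := B)
    {m | ∃ b : Spec B, b.asIdeal = m ∧ q b ∈ C ∧ q b ∈ W₀}
  have he' (b : Spec B) (hb : p (q b) = IsLocalRing.closedPoint R) :
      e ∉ b.asIdeal ↔ q b ∈ C ∧ q b ∈ W₀ := by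
    have hb' : Spec.map φ b = IsLocalRing.closedPoint R := by rw [← hqφ]; exact hb
    rw [he' _ ((isMaximal_iff_of_finite hφ b).mpr hb')]
    refine ⟨?_, fun h ↦ ⟨b, rfl, h⟩⟩
    rintro ⟨b', h, h'⟩
    rwa [← PrimeSpectrum.ext h]
  let O : (Spec B).Opens := PrimeSpectrum.basicOpen e
  have hmem (b : Spec B) : b ∈ O ↔ e ∉ b.asIdeal := Iff.rfl
  have hOc : ((O : Set (Spec B))ᶜ) = (PrimeSpectrum.basicOpen (1 - e) : Set (PrimeSpectrum B)) := by
    ext b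
    change ¬ (e ∉ b.asIdeal) ↔ 1 - e ∉ b.asIdeal
    rw [not_not]
    refine ⟨fun h₁ h₂ ↦ b.2.ne_top ((Ideal.eq_top_iff_one _).mpr ?_), fun h₁ ↦ ?_⟩
    · simpa using add_mem h₂ h₁
    · have h₂ : e * (1 - e) ∈ b.asIdeal := by
        rw [mul_sub, mul_one, he.eq, sub_self]; exact zero_mem _
      exact (b.2.mem_or_mem h₂).resolve_right h₁
  have hcl : IsClosed (O : Set (Spec B)) := by
    rw [← isOpen_compl_iff, hOc]
    exact (PrimeSpectrum.basicOpen (1 - e)).2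
  -- The open set `Oᶜ ∪ q⁻¹ W₀` contains the closed fibre of a finite scheme over a local base,
  -- hence is everything.
  have hOW : O ≤ q ⁻¹ᵁ W₀ := by
    have := eq_univ_of_closedFibre_subset (q ≫ p) (hcl.isOpen_compl.union (q ⁻¹ᵁ W₀).2) fun b hb ↦ by
      by_cases hbO : b ∈ O
      · exact Or.inr ((he' b hb).mp hbO).2
      · exact Or.inl hbO
    intro b hb
    have hb' : b ∈ (O : Set (Spec B))ᶜ ∪ (q ⁻¹ᵁ W₀ : Set (Spec B)) := this ▸ Set.mem_univ b
    exact hb'.resolve_left fun h ↦ h hb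
  let e₁ : Γ(Spec B, ⊤) := (Scheme.ΓSpecIso B).inv e
  have he₁ : (Spec B).basicOpen e₁ = O := by
    rw [basicOpen_eq_of_affine]
  -- Lifting the idempotent to a function `a` on `W₀` extends `O` to an affine open set of `Y`.
  obtain ⟨a, ha⟩ := q.app_surjective W₀ hW₀ (resO le_top e₁)
  have hqW : q ⁻¹ᵁ Y.basicOpen a = O := by
    rw [Scheme.preimage_basicOpen, ha]
    refine ((Spec B).basicOpen_res e₁ (homOfLE le_top).op).trans ?_
    rw [he₁]
    exact inf_eq_right.mpr hOW
  -- `D` is the complement of the closed set `q(O)`. A point of both `W` and `D` is outside the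
  -- image of `q`, where `F` vanishes.
  refine ⟨Y.basicOpen a, ⟨(q '' O)ᶜ, (q.isClosedEmbedding.isClosedMap _ hcl).isOpen_compl⟩,
    hW₀.basicOpen a, Y.basicOpen_le a, ?_, ?_, fun y hy hz ↦ ?_⟩
  · refine eq_top_iff.mpr fun y _ ↦ ?_
    by_cases hy : y ∈ q '' O
    · obtain ⟨b, hb, rfl⟩ := hy
      left
      change b ∈ q ⁻¹ᵁ Y.basicOpen a
      rwa [hqW]
    · exact Or.inr hy
  · rintro y ⟨hy, hy'⟩
    refine h0 y ?_
    rintro ⟨b, rfl⟩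
    exact hy' ⟨b, hqW.le hy, rfl⟩
  · obtain ⟨b, rfl⟩ : y ∈ Set.range q := by
      by_contra h
      exact hz (h0 y h)
    have h₁ : q b ∈ Y.basicOpen a ↔ b ∈ O := by rw [← hqW]; rfl
    rw [h₁, hmem, he' b hy, and_iff_left_iff_imp]
    exact hC _ hy hz

/-- The component of an object of `P(p)` over a part of the closed fibre inside an affine open
set. -/
lemma MemP.exists_isSheafComponent [HenselianLocalRing R] {p : Y ⟶ Spec R} (h : MemP p F)
    (C : Set Y) {W₀ : Y.Opens} (hW₀ : IsAffineOpen W₀)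
    (hC : ∀ y, p y = IsLocalRing.closedPoint R → ¬ ZeroNear (𝟙 F) y → y ∈ C → y ∈ W₀) :
    ∃ (W : Y.Opens) (hW : IsAffineOpen W)
      (i : push hW.fromSpec (F.restrict hW.fromSpec) ⟶ F), W ≤ W₀ ∧
      (∀ y, p y = IsLocalRing.closedPoint R → ¬ ZeroNear (𝟙 F) y → (y ∈ W ↔ y ∈ C)) ∧
      IsSheafComponent p C i (toPushRestrict hW F) := by
  obtain ⟨W, D, hW, hle, hWD, h0, hWC⟩ := exists_isAffineOpen_separating h C hW₀ hC
  obtain ⟨i, hi⟩ := exists_isSheafComponent_of_split hW F hWD h0 hWC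
  exact ⟨W, hW, i, hle, hWC, hi⟩

end Finite

/-! ### Objects of `P(p)` as direct images from affine schemes finite over the base -/

section FiniteModel

open TopologicalSpace Opposite

lemma finite_mk_annihilator_prod {R E M N : Type*} [CommRing R] [IsNoetherianRing R] [CommRing E]
    [AddCommGroup M] [Module E M] [AddCommGroup N] [Module E N] (ρ : R →+* E)
    (hM : @Module.Finite R M _ _ (Module.compHom M ρ))
    (hN : @Module.Finite R N _ _ (Module.compHom N ρ)) :
    ((Ideal.Quotient.mk (Module.annihilator E (M × N))).comp ρ).Finite := by
  let _ := ρ.toAlgebra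
  let _ := Module.compHom M ρ
  let _ := Module.compHom N ρ
  have : IsScalarTower R E M := .of_algebraMap_smul fun _ _ ↦ rfl
  have : IsScalarTower R E N := .of_algebraMap_smul fun _ _ ↦ rfl
  exact finite_quotient_annihilator R (E := E) (M := M × N)

/-- Serves to pass from sections of `p_* F` over `Γ(Spec R, ⊤)` to sections over an affine open set
of `Y`, as modules over `R` itself. -/
lemma finite_compHom_of_surjective {R R' E M M' : Type*} [CommRing R] [CommRing R'] [CommRing E]
    [AddCommGroup M] [Module E M] [AddCommGroup M'] [Module R' M'] [Module.Finite R' M']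
    (τ : R →+* R') (hτ : Function.Surjective τ) (σ : R' →+* E) (g : M' →+ M)
    (hg : Function.Surjective g) (h : ∀ a m, g (a • m) = σ a • g m) :
    @Module.Finite R M _ _ (Module.compHom M (σ.comp τ)) := by
  let _ := Module.compHom M (σ.comp τ)
  have hsm (r : R) (m : M) : r • m = σ (τ r) • m := rfl
  obtain ⟨t, ht⟩ := Module.Finite.fg_top (R := R') (M := M')
  classical
  refine ⟨⟨t.image g, eq_top_iff.mpr ?_⟩⟩
  rw [Finset.coe_image]
  rintro m -
  obtain ⟨m, rfl⟩ := hg m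
  have hm : m ∈ Submodule.span R' (t : Set M') := by rw [ht]; exact Submodule.mem_top
  induction hm using Submodule.span_induction with
  | mem x hx => exact Submodule.subset_span ⟨x, hx, rfl⟩
  | zero => rw [map_zero]; exact zero_mem _
  | add x y _ _ hx hy => rw [map_add]; exact add_mem hx hy
  | smul r x _ hx =>
    obtain ⟨r, rfl⟩ := hτ r
    rw [h, ← hsm]
    exact Submodule.smul_mem _ r hx

variable {R : CommRingCat.{u}} {Y Y' T : Scheme.{u}} {F G : Y.Modules} {p : Y ⟶ Spec R}

/-- Direct images along a composition. -/
noncomputable def pushPushIso (i : T ⟶ Y') (h : Y' ⟶ Y) (M : T.Modules) :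
    push h (push i M) ≅ push (i ≫ h) M := (Scheme.Modules.pushforwardComp i h).app M

section Restrict

variable {W : Y.Opens} (hW : IsAffineOpen W)

/-- `W` and the open set where `F` vanishes cover the closed fibre, hence `Y`. So `F` splits along
this cover, with component over `W` equal to all of `F`. -/
lemma MemP.isIso_toPushRestrict [IsLocalRing R] (h : MemP p F)
    (hu : ∀ y, p y = IsLocalRing.closedPoint R → ¬ ZeroNear (𝟙 F) y → y ∈ W) :
    IsIso (toPushRestrict hW F) := by
  let D : Y.Opens := ⟨_, isOpen_setOf_zeroNear (𝟙 F)⟩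
  have hWD : W ⊔ D = ⊤ := eq_top_iff.mpr fun y _ ↦
    h.forall_of_closedFibre (P := fun y ↦ y ∈ W ⊔ D) (W ⊔ D).2 (fun y hy ↦ Or.inr hy)
      (fun y hy ↦ by
        by_cases hz : ZeroNear (𝟙 F) y
        · exact Or.inr hz
        · exact Or.inl (hu y hy hz)) y
  obtain ⟨i, hi⟩ := exists_isSheafComponent_of_split (p := p) (C := Set.univ) hW F hWD
    (fun y hy ↦ hy.2) fun y hy hz ↦ iff_of_true (hu y hy hz) trivial
  exact ⟨i, (h.eq_of_sub fun y hy ↦ hi.zeroNear_sub y hy trivial).symm, hi.retract⟩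

/-- The ring homomorphism that corresponds to the restriction of `p` to an affine open set. -/
noncomputable def coeffHom (p : Y ⟶ Spec R) (W : Y.Opens) : R ⟶ Γ(Y, W) :=
  (Scheme.ΓSpecIso R).inv ≫ p.appLE ⊤ W le_top

lemma specMap_coeffHom (p : Y ⟶ Spec R) : Spec.map (coeffHom p W) = hW.fromSpec ≫ p := by
  rw [← IsAffineOpen.SpecMap_appLE_fromSpec p (isAffineOpen_top _) hW le_top,
    IsAffineOpen.fromSpec_top, Scheme.isoSpec_Spec_inv, coeffHom, Spec.map_comp]

lemma MemP.finite_sections {W : Y.Opens} (hW : IsAffineOpen W) [IsLocalRing R] (h : MemP p F)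
    (hu : ∀ y, p y = IsLocalRing.closedPoint R → ¬ ZeroNear (𝟙 F) y → y ∈ W) :
    @Module.Finite R Γ(F, W) _ _ (Module.compHom Γ(F, W) (coeffHom p W).hom) := by
  have := h.isIso_toPushRestrict hW hu
  have hf := (h.locallyFree ⊤ (isAffineOpen_top _)).1
  have hτ : Function.Surjective (Scheme.ΓSpecIso R).inv.hom :=
    (ConcreteCategory.bijective_of_isIso (Scheme.ΓSpecIso R).inv).2
  let g : Γ(push p F, ⊤) →+ Γ(F, W) := (res F le_top).comp (toPush p F ⊤).symm.toAddMonoidHom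
  have hg : Function.Surjective g := by
    refine Function.Surjective.comp (fun s ↦ ?_) (toPush p F ⊤).symm.surjective
    have hle : (⊤ : Y.Opens) ⊓ W ≤ W := inf_le_right
    obtain ⟨t, ht⟩ := (bijective_app (toPushRestrict hW F) ⊤).2
      (pushRestrictSections hW F ⊤ (res F hle s))
    rw [toPushRestrict_app] at ht
    have ht' := (pushRestrictSections_bijective hW F ⊤).1 ht
    rw [← res_res le_top hle] at ht'
    exact ⟨t, (res_bijective hle (le_inf le_top le_rfl)).1 ht'⟩
  exact finite_compHom_of_surjective (Scheme.ΓSpecIso R).inv.hom hτ (p.appLE ⊤ W le_top).hom g hg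
    fun a s ↦ res_smul (F := F) _ (p.app ⊤ a) _

end Restrict

lemma notMem_of_zeroNear (hF : HasFractions F) {W : Y.Opens} (hW : IsAffineOpen W)
    (b : Spec Γ(Y, W)) (hz : ZeroNear (𝟙 F) (hW.fromSpec b)) (s : Γ(F, W)) :
    ∃ a ∉ b.asIdeal, a • s = 0 := by
  obtain ⟨O, hy, hO⟩ := hz
  have hbW : hW.fromSpec b ∈ W := by
    rw [← SetLike.mem_coe, ← hW.range_fromSpec]
    exact ⟨b, rfl⟩
  obtain ⟨a, ha, hya⟩ := hW.exists_basicOpen_le ⟨_, hy⟩ hbW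
  have hb : a ∉ b.asIdeal := by
    have : b ∈ hW.fromSpec ⁻¹ᵁ Y.basicOpen a := hya
    rw [hW.fromSpec_preimage_basicOpen] at this
    exact this
  obtain ⟨n, hn⟩ := (hF W hW a).2 s (hO _ ha _)
  exact ⟨a ^ n, fun h ↦ hb (b.2.mem_of_pow_mem n h), hn⟩

lemma MemP.exists_push_iso [IsLocalRing R] (h : MemP p F) {W : Y.Opens} (hW : IsAffineOpen W)
    (hu : ∀ y, p y = IsLocalRing.closedPoint R → ¬ ZeroNear (𝟙 F) y → y ∈ W) (I : Ideal Γ(Y, W))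
    (hI : ∀ a ∈ I, ∀ s : Γ(F, W), a • s = 0) :
    ∃ M : (Spec (.of (Γ(Y, W) ⧸ I))).Modules, IsCoherent M ∧
      Nonempty (F ≅ push (Spec.map (CommRingCat.ofHom (Ideal.Quotient.mk I)) ≫ hW.fromSpec) M) := by
  have := h.isIso_toPushRestrict hW hu
  obtain ⟨M, hM, ⟨e⟩⟩ := exists_push_iso_of_annihilated (F.restrict hW.fromSpec)
    ((hasFractions_iff_forall_restrict F).mp h.coherent.hasFractions W hW) I fun a ha s ↦ by
      obtain ⟨s, rfl⟩ := (specSections_bijective F hW ⊤ W (image_top_fromSpec hW)).2 s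
      have := specSections_smul F hW ⊤ W (image_top_fromSpec hW) le_rfl a s
      rw [← this, resO_self, hI a ha, map_zero]
  let q := Spec.map (CommRingCat.ofHom (Ideal.Quotient.mk I)) ≫ hW.fromSpec
  let e' : F ≅ push q M := asIso (toPushRestrict hW F) ≪≫
    (Scheme.Modules.pushforward hW.fromSpec).mapIso e ≪≫ pushPushIso _ _ M
  refine ⟨M, isCoherent_of_push (q ≫ p) hM ?_, ⟨e'⟩⟩
  have h₁ : MemP p (push q M) := h.of_iso e'.symm
  exact ((isFiniteLocallyFree_push_iff q p M).mpr h₁.locallyFree ⊤ (isAffineOpen_top _)).1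

/-- Two objects of `P(p)` with supports near an affine open set, over a noetherian local base, are
direct images from one affine scheme finite over the base, whose points lie in the supports. -/
lemma exists_finite_model [IsNoetherianRing R] [IsLocalRing R] [IsSeparated p] (hF : MemP p F)
    (hG : MemP p G) {W : Y.Opens} (hW : IsAffineOpen W)
    (hFu : ∀ y, p y = IsLocalRing.closedPoint R → ¬ ZeroNear (𝟙 F) y → y ∈ W)
    (hGu : ∀ y, p y = IsLocalRing.closedPoint R → ¬ ZeroNear (𝟙 G) y → y ∈ W) :
    ∃ (B : CommRingCat.{u}) (q : Spec B ⟶ Y) (M N : (Spec B).Modules),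
      IsClosedImmersion q ∧ IsFinite (q ≫ p) ∧ IsCoherent M ∧ IsCoherent N ∧
      Nonempty (F ≅ push q M) ∧ Nonempty (G ≅ push q N) ∧
      ∀ b, ¬ ZeroNear (𝟙 F) (q b) ∨ ¬ ZeroNear (𝟙 G) (q b) := by
  -- One annihilator for both modules puts both sheaves on the same scheme. The quotient is finite
  -- over the noetherian ring `R`, as it acts faithfully on a finite `R`-module.
  let I := Module.annihilator Γ(Y, W) (Γ(F, W) × Γ(G, W))
  have hI {a : Γ(Y, W)} (ha : a ∈ I) (s : Γ(F, W) × Γ(G, W)) : a • s = 0 :=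
    Module.mem_annihilator.mp ha s
  obtain ⟨M, hM, ⟨eM⟩⟩ := hF.exists_push_iso hW hFu I fun a ha s ↦
    congr_arg Prod.fst (hI ha (s, 0))
  obtain ⟨N, hN, ⟨eN⟩⟩ := hG.exists_push_iso hW hGu I fun a ha s ↦
    congr_arg Prod.snd (hI ha (0, s))
  let m := CommRingCat.ofHom (Ideal.Quotient.mk I)
  let q := Spec.map m ≫ hW.fromSpec
  have hfin := finite_mk_annihilator_prod _ (hF.finite_sections hW hFu) (hG.finite_sections hW hGu)
  have hqp : q ≫ p = Spec.map (coeffHom p W ≫ m) := by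
    rw [Spec.map_comp, specMap_coeffHom, Category.assoc]
  have hqf : IsFinite (q ≫ p) := by
    rw [hqp, IsFinite.SpecMap_iff]
    exact hfin
  have : IsClosedImmersion (Spec.map m) :=
    IsClosedImmersion.spec_of_surjective _ Ideal.Quotient.mk_surjective
  -- `q` is a monomorphism, a closed immersion followed by an open one, and finite because `q ≫ p`
  -- is finite and `p` separated.
  have hq : IsClosedImmersion q :=
    (IsClosedImmersion.iff_isFinite_and_mono q).mpr ⟨IsFinite.of_comp q p, inferInstance⟩
  refine ⟨_, q, M, N, hq, hqf, hM, hN, ⟨eM⟩, ⟨eN⟩, fun b ↦ ?_⟩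
  by_contra! hb
  have := hF.coherent.finite W hW
  have := hG.coherent.finite W hW
  -- A prime containing the annihilator of a finite module is in its support. If both sheaves
  -- vanished near `q b`, every section would be killed by a function outside this prime.
  have hb' : Spec.map m b ∈ Module.support Γ(Y, W) (Γ(F, W) × Γ(G, W)) := by
    rw [Module.support_eq_zeroLocus]
    intro a (ha : a ∈ I)
    have : Ideal.Quotient.mk I a ∈ b.asIdeal := by
      rw [Ideal.Quotient.eq_zero_iff_mem.mpr ha]
      exact zero_mem _
    exact this
  obtain ⟨⟨s, t⟩, hst⟩ := Module.mem_support_iff_exists_annihilator.mp hb'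
  obtain ⟨a₁, h₁, e₁⟩ := notMem_of_zeroNear hF.coherent.hasFractions hW _ hb.1 s
  obtain ⟨a₂, h₂, e₂⟩ := notMem_of_zeroNear hG.coherent.hasFractions hW _ hb.2 t
  have h₁₂ : a₁ * a₂ ∈ (Spec.map m b).asIdeal := hst <| by
    rw [Submodule.mem_annihilator_span_singleton]
    have e₁' : (a₁ * a₂) • s = 0 := by rw [mul_comm, mul_smul, e₁, smul_zero]
    have e₂' : (a₁ * a₂) • t = 0 := by rw [mul_smul, e₂, smul_zero]
    exact Prod.ext e₁' e₂'
  exact ((Spec.map m b).2.mem_or_mem h₁₂).elim h₁ h₂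

end FiniteModel

/-! ### Affine open sets in fibre products -/

section AffineNhd

open TopologicalSpace Opposite

variable {S X : Scheme.{u}} {R A : CommRingCat.{u}} [IsLocalRing R] (f : Spec R ⟶ S)

lemma range_subset_of_closedPoint_mem {U : S.Opens} (h : f (IsLocalRing.closedPoint R) ∈ U) :
    Set.range f ⊆ U := by
  rintro _ ⟨z, rfl⟩
  exact ((IsLocalRing.specializes_closedPoint z).map f.continuous).mem_open U.2 h

/-- If `u` maps into `S₀`, so does all of `Spec R`, since every point specializes to `u`; the
product over `S₀` is then affine and open. Otherwise no point qualifies and the empty set serves. -/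
lemma exists_isAffineOpen_of_le_preimage (g : X ⟶ S) {X₀ : X.Opens} (hX : IsAffineOpen X₀)
    {S₀ : S.Opens} (hS : IsAffineOpen S₀) (h : X₀ ≤ g ⁻¹ᵁ S₀) :
    ∃ W : (pullback f g).Opens, IsAffineOpen W ∧ ∀ y : ↥(pullback f g),
      pullback.fst f g y = IsLocalRing.closedPoint R → pullback.snd f g y ∈ X₀ → y ∈ W := by
  by_cases hu : f (IsLocalRing.closedPoint R) ∈ S₀
  · have hf : Set.range f ⊆ Set.range S₀.ι := by
      rw [Scheme.Opens.range_ι]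
      exact range_subset_of_closedPoint_mem f hu
    have hg : Set.range (X₀.ι ≫ g) ⊆ Set.range S₀.ι := by
      rw [Scheme.Opens.range_ι]
      rintro _ ⟨z, rfl⟩
      exact h z.2
    let f' := IsOpenImmersion.lift S₀.ι f hf
    let g' := IsOpenImmersion.lift S₀.ι (X₀.ι ≫ g) hg
    have e₁ : f' ≫ S₀.ι = 𝟙 _ ≫ f := by
      rw [Category.id_comp]; exact IsOpenImmersion.lift_fac _ _ _
    have e₂ : g' ≫ S₀.ι = X₀.ι ≫ g := IsOpenImmersion.lift_fac _ _ _
    have : IsAffine X₀ := hX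
    have : IsAffine S₀ := hS
    refine ⟨_, isAffineOpen_opensRange (pullback.map f' g' f g (𝟙 _) X₀.ι S₀.ι e₁ e₂),
      fun y _ hy ↦ ?_⟩
    change y ∈ Set.range (pullback.map f' g' f g (𝟙 _) X₀.ι S₀.ι e₁ e₂)
    rw [Scheme.Pullback.range_map]
    exact ⟨⟨_, rfl⟩, by rw [Scheme.Opens.range_ι]; exact hy⟩
  · refine ⟨⊥, isAffineOpen_bot _, fun y hy hy' ↦ (hu ?_).elim⟩
    have : f (pullback.fst f g y) = g (pullback.snd f g y) := by
      rw [← Scheme.Hom.comp_apply, pullback.condition, Scheme.Hom.comp_apply]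
    rw [← hy, this]
    exact h hy'

lemma exists_isAffineOpen_over_point (g : X ⟶ S) (x : X) :
    ∃ W : (pullback f g).Opens, IsAffineOpen W ∧ ∀ y : ↥(pullback f g),
      pullback.fst f g y = IsLocalRing.closedPoint R → pullback.snd f g y = x → y ∈ W := by
  obtain ⟨_, ⟨S₀, hS, rfl⟩, hxS, -⟩ :=
    S.isBasis_affineOpens.exists_subset_of_mem_open (Set.mem_univ (g x)) isOpen_univ
  obtain ⟨_, ⟨X₀, hX, rfl⟩, hxX, hle⟩ :=
    X.isBasis_affineOpens.exists_subset_of_mem_open (u := ↑(g ⁻¹ᵁ S₀)) hxS (g ⁻¹ᵁ S₀).2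
  obtain ⟨W, hW, h⟩ := exists_isAffineOpen_of_le_preimage f g hX hS hle
  exact ⟨W, hW, fun y hy hyx ↦ h y hy (hyx ▸ hxX)⟩

lemma henselAtι_specializes (x : X) (z : henselAt X x) : henselAtι X x z ⤳ x := by
  have : henselAtι X x z ∈ Set.range (X.fromSpecStalk x) := ⟨_, rfl⟩
  rwa [Scheme.range_fromSpecStalk] at this

/-- All points of `X^h_x` map to generalizations of `x`, so the affine scheme `X^h_x` maps into any
affine neighbourhood of `g x`. -/
lemma exists_isAffineOpen_closedFibre (g : X ⟶ S) (x : X) :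
    ∃ W : (pullback f (henselAtι X x ≫ g)).Opens, IsAffineOpen W ∧
      ∀ y : ↥(pullback f (henselAtι X x ≫ g)),
        henselFst f g x y = IsLocalRing.closedPoint R → y ∈ W := by
  obtain ⟨_, ⟨S₀, hS, rfl⟩, hxS, -⟩ :=
    S.isBasis_affineOpens.exists_subset_of_mem_open (Set.mem_univ (g x)) isOpen_univ
  have : IsAffine (henselAt X x) := inferInstanceAs (IsAffine (Spec _))
  have hle : ⊤ ≤ (henselAtι X x ≫ g) ⁻¹ᵁ S₀ := fun z _ ↦
    ((henselAtι_specializes x z).map g.continuous).mem_open S₀.2 hxS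
  obtain ⟨W, hW, h⟩ := exists_isAffineOpen_of_le_preimage f (henselAtι X x ≫ g)
    (isAffineOpen_top _) hS hle
  exact ⟨W, hW, fun y hy ↦ h y hy trivial⟩

end AffineNhd

/-! ### Finite schemes that are jointly embedded -/

section Joint

open scoped TensorProduct

variable {R A B : CommRingCat.{u}} (φ : R ⟶ B) (ψ : A ⟶ B)

lemma hom_ext_of_adjoin {Z : Scheme.{u}}
    (h : @Algebra.adjoin R B _ _ φ.hom.toAlgebra (Set.range ψ.hom) = ⊤) {a b : Z ⟶ Spec B}
    (h₁ : a ≫ Spec.map φ = b ≫ Spec.map φ) (h₂ : a ≫ Spec.map ψ = b ≫ Spec.map ψ) : a = b := by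
  refine ext_of_isAffine ?_
  algebraize [φ.hom]
  rw [← cancel_epi (Scheme.ΓSpecIso B).inv]
  have key {E : CommRingCat.{u}} (χ : E ⟶ B) (h : a ≫ Spec.map χ = b ≫ Spec.map χ) :
      χ ≫ (Scheme.ΓSpecIso B).inv ≫ a.appTop = χ ≫ (Scheme.ΓSpecIso B).inv ≫ b.appTop := by
    have := congr((Scheme.ΓSpecIso E).inv ≫ ($h).appTop)
    simp only [Scheme.Hom.comp_appTop, ← Category.assoc] at this
    rw [← Scheme.ΓSpecIso_inv_naturality] at this
    simpa only [Category.assoc] using this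
  ext x
  have hx : x ∈ Algebra.adjoin R (Set.range ψ.hom) := h ▸ trivial
  induction hx using Algebra.adjoin_induction with
  | mem x hx =>
    obtain ⟨y, rfl⟩ := hx
    exact congr($(key ψ h₂) y)
  | algebraMap r => exact congr($(key φ h₁) r)
  | add x y _ _ hx hy => rw [map_add, map_add, hx, hy]
  | mul x y _ _ hx hy => rw [map_mul, map_mul, hx, hy]

/-- The hypothesis makes `Spec B → Spec (R ⊗ A)` a monomorphism. It is also finite, hence a closed
immersion, so `R ⊗ A → B` is surjective. -/
lemma adjoin_eq_top_of_jointly_mono (hφ : φ.hom.Finite)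
    (h : ∀ (Z : Scheme.{u}) (a b : Z ⟶ Spec B), a ≫ Spec.map φ = b ≫ Spec.map φ →
      a ≫ Spec.map ψ = b ≫ Spec.map ψ → a = b) :
    @Algebra.adjoin R B _ _ φ.hom.toAlgebra (Set.range ψ.hom) = ⊤ := by
  algebraize [φ.hom]
  let T : CommRingCat.{u} := .of (TensorProduct ℤ R A)
  let i₁ : R ⟶ T := CommRingCat.ofHom (Algebra.TensorProduct.includeLeft (S := ℤ)).toRingHom
  let i₂ : A ⟶ T := CommRingCat.ofHom Algebra.TensorProduct.includeRight.toRingHom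
  let π : T ⟶ B := CommRingCat.ofHom
    (Algebra.TensorProduct.productMap φ.hom.toIntAlgHom ψ.hom.toIntAlgHom).toRingHom
  have hπ (r : R) (a : A) : π.hom (r ⊗ₜ[ℤ] a) = φ.hom r * ψ.hom a :=
    Algebra.TensorProduct.productMap_apply_tmul _ _ r a
  have h₁ : i₁ ≫ π = φ := by
    ext r
    exact (hπ r 1).trans (by rw [map_one, mul_one])
  have h₂ : i₂ ≫ π = ψ := by
    ext a
    exact (hπ 1 a).trans (by rw [map_one, one_mul])
  have : Mono (Spec.map π) := ⟨fun a b hab ↦ by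
    refine h _ a b ?_ ?_
    · rw [← h₁, Spec.map_comp, reassoc_of% hab]
    · rw [← h₂, Spec.map_comp, reassoc_of% hab]⟩
  have : IsFinite (Spec.map π) := by
    rw [IsFinite.SpecMap_iff]
    refine RingHom.Finite.of_comp_finite (f := i₁.hom) ?_
    rw [← CommRingCat.hom_comp, h₁]
    exact hφ
  have : IsClosedImmersion (Spec.map π) :=
    (IsClosedImmersion.iff_isFinite_and_mono _).mpr ⟨inferInstance, inferInstance⟩
  have hs : Function.Surjective π.hom := by
    have h₃ := (IsClosedImmersion.isAffine_surjective_of_isAffine (Spec.map π)).2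
    have h₄ : Function.Surjective (π ≫ (Scheme.ΓSpecIso B).inv).hom := by
      rw [Scheme.ΓSpecIso_inv_naturality]
      exact h₃.comp (ConcreteCategory.bijective_of_isIso (Scheme.ΓSpecIso T).inv).2
    intro b
    obtain ⟨t, ht⟩ := h₄ ((Scheme.ΓSpecIso B).inv b)
    exact ⟨t, (ConcreteCategory.bijective_of_isIso (Scheme.ΓSpecIso B).inv).1 ht⟩
  refine eq_top_iff.mpr fun b _ ↦ ?_
  obtain ⟨t, rfl⟩ := hs b
  induction t using TensorProduct.induction_on with
  | zero => rw [map_zero]; exact zero_mem _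
  | add x y hx hy => rw [map_add]; exact add_mem (hx trivial) (hy trivial)
  | tmul r a =>
    rw [hπ]
    exact mul_mem (Subalgebra.algebraMap_mem _ r) (Algebra.subset_adjoin ⟨a, rfl⟩)

end Joint

/-! ### Finite schemes over a henselization -/

section Henselization

open TopologicalSpace Opposite

variable {S X : Scheme.{u}} {R : CommRingCat.{u}} (f : Spec R ⟶ S) (g : X ⟶ S) (x : X)

lemma henselMap_snd : henselMap f g x ≫ pullback.snd f g =
    pullback.snd f (henselAtι X x ≫ g) ≫ henselAtι X x := pullback.lift_snd _ _ _

lemma snd_henselMap_apply (y : ↥(pullback f (henselAtι X x ≫ g))) :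
    pullback.snd f g (henselMap f g x y) =
      henselAtι X x (pullback.snd f (henselAtι X x ≫ g) y) := by
  rw [← Scheme.Hom.comp_apply, henselMap_snd, Scheme.Hom.comp_apply]

lemma mem_localLocus_iff (u : Spec R) (y : ↥(pullback f (henselAtι X x ≫ g))) :
    y ∈ localLocus f g u x ↔
      ((henselMap f g x ≫ pullback.fst f g) y = u → pullback.snd f g (henselMap f g x y) = x) := by
  rw [snd_henselMap_apply, henselMap_fst]
  rfl

/-- The homomorphism from the local ring at `x` to its henselization. -/
noncomputable def toHenselization :
    X.presheaf.stalk x ⟶ CommRingCat.of (henselization (X.presheaf.stalk x)) :=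
  CommRingCat.ofHom (algebraMap (X.presheaf.stalk x) (henselization (X.presheaf.stalk x)))

variable {x} in
lemma specMap_comp_henselAtι {B : CommRingCat.{u}}
    (σ : CommRingCat.of (henselization (X.presheaf.stalk x)) ⟶ B) :
    (show Spec B ⟶ henselAt X x from Spec.map σ) ≫ henselAtι X x =
      Spec.map (toHenselization x ≫ σ) ≫ X.fromSpecStalk x := by
  rw [Spec.map_comp, Category.assoc]
  rfl

variable {x} in
lemma exists_specMap_henselAt {B : CommRingCat.{u}} (t : Spec B ⟶ henselAt X x) :
    ∃ σ : CommRingCat.of (henselization (X.presheaf.stalk x)) ⟶ B, t = Spec.map σ :=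
  ⟨Spec.preimage t, (Spec.map_preimage (R := .of (henselization (X.presheaf.stalk x))) t).symm⟩

instance : IsSeparated (henselAtι X x) :=
  inferInstanceAs (IsSeparated (Spec.map (toHenselization x) ≫ X.fromSpecStalk x))

instance [IsSeparated g] : IsSeparated (henselMap f g x ≫ pullback.fst f g) := by
  rw [henselMap_fst]
  infer_instance

instance [IsSeparated g] : IsSeparated (henselMap f g x) :=
  IsSeparated.of_comp _ (pullback.fst f g)

variable {x} in
lemma eq_closedPoint_of_fromSpecStalk_eq {z : Spec (X.presheaf.stalk x)}
    (h : X.fromSpecStalk x z = x) : z = IsLocalRing.closedPoint (X.presheaf.stalk x) :=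
  (X.fromSpecStalk x).isEmbedding.injective (h.trans Scheme.fromSpecStalk_closedPoint.symm)

variable {x} in
/-- If the closed points of `Spec B` lie over the point `x`, then the maximal ideal of the local
ring at `x` generates an ideal in the radical. -/
lemma map_maximalIdeal_le_jacobson {B : CommRingCat.{u}} (ψ : X.presheaf.stalk x ⟶ B)
    (h : ∀ b : Spec B, b.asIdeal.IsMaximal → X.fromSpecStalk x (Spec.map ψ b) = x) :
    (IsLocalRing.maximalIdeal (X.presheaf.stalk x)).map ψ.hom ≤ Ideal.jacobson ⊥ := by
  refine le_sInf fun m hm ↦ Ideal.map_le_iff_le_comap.mpr ?_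
  have := eq_closedPoint_of_fromSpecStalk_eq (h ⟨m, hm.2.isPrime⟩ hm.2)
  exact (congr_arg PrimeSpectrum.asIdeal this).ge

variable {f g x} {B : CommRingCat.{u}}

/-- As `i` is a closed immersion, `B` is generated over `R` by the image of the henselization. By
`adjoin_range_algebraMap_eq_top` the image of the local ring already suffices, so the composite is a
monomorphism; being finite as well, it is a closed immersion. -/
lemma isClosedImmersion_comp_henselMap [IsLocalRing R] [IsSeparated g]
    (i : Spec B ⟶ pullback f (henselAtι X x ≫ g)) [IsClosedImmersion i]
    [IsFinite (i ≫ henselMap f g x ≫ pullback.fst f g)]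
    (hi : ∀ b, i b ∈ localLocus f g (IsLocalRing.closedPoint R) x) :
    IsClosedImmersion (i ≫ henselMap f g x) := by
  obtain ⟨φ, hφ, hiφ⟩ := exists_specMap_of_isFinite (i ≫ henselMap f g x ≫ pullback.fst f g)
  obtain ⟨σ, hσ⟩ := exists_specMap_henselAt (i ≫ pullback.snd f (henselAtι X x ≫ g))
  let α := toHenselization x
  have hα : Spec.map (α ≫ σ) ≫ X.fromSpecStalk x =
      (i ≫ henselMap f g x) ≫ pullback.snd f g := by
    rw [Category.assoc, henselMap_snd, ← Category.assoc, hσ]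
    exact (specMap_comp_henselAtι σ).symm
  have hJ := map_maximalIdeal_le_jacobson (α ≫ σ) fun b hb ↦ by
    rw [← Scheme.Hom.comp_apply, hα, Category.assoc, Scheme.Hom.comp_apply, Scheme.Hom.comp_apply]
    refine (mem_localLocus_iff f g x _ _).mp (hi b) ?_
    rw [← Scheme.Hom.comp_apply, hiφ]
    exact (isMaximal_iff_of_finite hφ b).mp hb
  have h₁ : @Algebra.adjoin R B _ _ φ.hom.toAlgebra (Set.range σ.hom) = ⊤ := by
    refine adjoin_eq_top_of_jointly_mono φ σ hφ fun Z a b h₁ h₂ ↦ ?_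
    rw [← cancel_mono i]
    refine pullback.hom_ext ?_ ?_
    · rw [← hiφ, henselMap_fst] at h₁
      simpa only [Category.assoc] using h₁
    · have : a ≫ i ≫ pullback.snd f (henselAtι X x ≫ g) =
          b ≫ i ≫ pullback.snd f (henselAtι X x ≫ g) := by rw [hσ]; exact h₂
      simpa only [Category.assoc] using this
  have h₂ : @Algebra.adjoin R B _ _ φ.hom.toAlgebra (Set.range (α ≫ σ).hom) = ⊤ := by
    let _ := φ.hom.toAlgebra
    let _ := (α ≫ σ).hom.toAlgebra
    have : Module.Finite R B := hφ
    let σ' : henselization (X.presheaf.stalk x) →ₐ[X.presheaf.stalk x] B :=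
      { σ.hom with commutes' _ := rfl }
    exact adjoin_range_algebraMap_eq_top R hJ σ' h₁
  have hm : Mono (i ≫ henselMap f g x) := ⟨fun {Z} a b hab ↦ by
    refine hom_ext_of_adjoin φ (α ≫ σ) h₂ ?_ ?_
    · rw [← hiφ]
      have := congr($hab ≫ pullback.fst f g)
      simpa only [Category.assoc] using this
    · rw [← cancel_mono (X.fromSpecStalk x), Category.assoc, Category.assoc, hα]
      have := congr($hab ≫ pullback.snd f g)
      simpa only [Category.assoc] using this⟩
  have : IsFinite ((i ≫ henselMap f g x) ≫ pullback.fst f g) := by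
    rw [Category.assoc]; infer_instance
  exact (IsClosedImmersion.iff_isFinite_and_mono _).mpr
    ⟨IsFinite.of_comp _ (pullback.fst f g), hm⟩

/-- A morphism from an affine scheme factors through the spectrum of the local ring at `x` if the
closed points go to `x`. -/
lemma exists_specMap_comp_fromSpecStalk (t : Spec B ⟶ X)
    (ht : ∀ b : Spec B, b.asIdeal.IsMaximal → t b = x) :
    ∃ ψ : X.presheaf.stalk x ⟶ B, Spec.map ψ ≫ X.fromSpecStalk x = t := by
  obtain ⟨_, ⟨V, hV, rfl⟩, hxV, -⟩ :=
    X.isBasis_affineOpens.exists_subset_of_mem_open (Set.mem_univ x) isOpen_univ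
  have hV : IsAffineOpen V := hV
  have hmax (b : Spec B) : ∃ m : Spec B, m.asIdeal.IsMaximal ∧ b.asIdeal ≤ m.asIdeal := by
    obtain ⟨m, hm, hle⟩ := Ideal.exists_le_maximal b.asIdeal b.2.ne_top
    exact ⟨⟨m, hm.isPrime⟩, hm, hle⟩
  have htV : Set.range t ⊆ Set.range hV.fromSpec := by
    rw [hV.range_fromSpec]
    rintro _ ⟨b, rfl⟩
    obtain ⟨m, hm, hle⟩ := hmax b
    have : b ⤳ m := (PrimeSpectrum.le_iff_specializes b m).mp hle
    exact (this.map t.continuous).mem_open V.2 (by rw [ht m hm]; exact hxV)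
  let θ := Spec.preimage (IsOpenImmersion.lift hV.fromSpec t htV)
  have hθ : Spec.map θ ≫ hV.fromSpec = t := by
    rw [Spec.map_preimage, IsOpenImmersion.lift_fac]
  let γ := X.presheaf.germ V x hxV
  have hγ : Spec.map γ ≫ hV.fromSpec = X.fromSpecStalk x := by
    rw [← hV.fromSpecStalk_eq_fromSpecStalk hxV]
    rfl
  have hloc := hV.isLocalization_stalk ⟨x, hxV⟩
  -- A function not vanishing at `x` vanishes at no closed point of `Spec B`, hence becomes a unit.
  have hunit (s : (hV.primeIdealOf ⟨x, hxV⟩).asIdeal.primeCompl) : IsUnit (θ.hom s) := by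
    by_contra hs
    obtain ⟨m, hm, hsm⟩ := exists_max_ideal_of_mem_nonunits hs
    refine s.2 ?_
    let b : Spec B := ⟨m, hm.isPrime⟩
    have h₁ : hV.fromSpec (Spec.map θ b) = hV.fromSpec (hV.primeIdealOf ⟨x, hxV⟩) := by
      rw [hV.fromSpec_primeIdealOf, ← Scheme.Hom.comp_apply, hθ]
      exact ht b hm
    have h₂ := congr_arg PrimeSpectrum.asIdeal (hV.fromSpec.isOpenEmbedding.injective h₁)
    exact h₂.le hsm
  let _ : Algebra Γ(X, V) (X.presheaf.stalk x) := γ.hom.toAlgebra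
  have hloc' : IsLocalization.AtPrime (X.presheaf.stalk x)
    (hV.primeIdealOf ⟨x, hxV⟩).asIdeal := hloc
  let ψ : X.presheaf.stalk x ⟶ B := CommRingCat.ofHom
    (IsLocalization.lift (S := X.presheaf.stalk x)
      (M := (hV.primeIdealOf ⟨x, hxV⟩).asIdeal.primeCompl) (g := θ.hom) hunit)
  refine ⟨ψ, ?_⟩
  have : γ ≫ ψ = θ := CommRingCat.hom_ext (IsLocalization.lift_comp hunit)
  rw [← hγ, ← Category.assoc, ← Spec.map_comp, this, hθ]

/-- Over a henselian base, a closed subscheme whose closed points lie over `x` lifts to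
the henselization. -/
lemma exists_lift_henselMap [HenselianLocalRing R] [IsSeparated g] (q : Spec B ⟶ pullback f g)
    [IsClosedImmersion q] [IsFinite (q ≫ pullback.fst f g)]
    (hq : ∀ b, pullback.fst f g (q b) = IsLocalRing.closedPoint R → pullback.snd f g (q b) = x) :
    ∃ i : Spec B ⟶ pullback f (henselAtι X x ≫ g), IsClosedImmersion i ∧
      i ≫ henselMap f g x = q := by
  obtain ⟨φ, hφ, hqφ⟩ := exists_specMap_of_isFinite (q ≫ pullback.fst f g)
  have hmax (b : Spec B) (hb : b.asIdeal.IsMaximal) : (q ≫ pullback.snd f g) b = x := by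
    refine hq b ?_
    rw [← Scheme.Hom.comp_apply, hqφ]
    exact (isMaximal_iff_of_finite hφ b).mp hb
  obtain ⟨ψ, hψ⟩ := exists_specMap_comp_fromSpecStalk (q ≫ pullback.snd f g) hmax
  have hJ := map_maximalIdeal_le_jacobson ψ fun b hb ↦ by
    rw [← Scheme.Hom.comp_apply, hψ, hmax b hb]
  -- Here the henselian property of the base enters: the map from the local ring extends to its
  -- henselization because `B` is finite over `R`.
  obtain ⟨σ, hσ⟩ : ∃ σ : CommRingCat.of (henselization (X.presheaf.stalk x)) ⟶ B,
      toHenselization x ≫ σ = ψ := by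
    algebraize [φ.hom, ψ.hom]
    obtain ⟨σ⟩ := nonempty_henselization_algHom R hJ
    exact ⟨CommRingCat.ofHom σ.toRingHom, CommRingCat.hom_ext σ.comp_algebraMap⟩
  let t : Spec B ⟶ henselAt X x := Spec.map σ
  have ht : t ≫ henselAtι X x = q ≫ pullback.snd f g := by
    rw [← hψ, ← hσ]
    exact specMap_comp_henselAtι σ
  let i : Spec B ⟶ pullback f (henselAtι X x ≫ g) := pullback.lift (q ≫ pullback.fst f g) t (by
    rw [Category.assoc, pullback.condition, ← Category.assoc, ← ht, Category.assoc])
  have hi : i ≫ henselMap f g x = q := by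
    refine pullback.hom_ext ?_ ?_
    · rw [Category.assoc, henselMap_fst, pullback.lift_fst]
    · rw [Category.assoc, henselMap_snd, pullback.lift_snd_assoc, ht]
  have : IsClosedImmersion (i ≫ henselMap f g x) := hi ▸ inferInstance
  exact ⟨i, IsClosedImmersion.of_comp i (henselMap f g x), hi⟩

end Henselization

/-! ### The henselization as a local part -/

section LocalPart

open TopologicalSpace Opposite

lemma IsSheafComponent.of_iso {R : CommRingCat.{u}} [IsLocalRing R] {Y : Scheme.{u}}
    {p : Y ⟶ Spec R} {C : Set Y} {F G G' : Y.Modules} {i : G ⟶ F} {r : F ⟶ G}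
    (h : IsSheafComponent p C i r) (e : G' ≅ G) :
    IsSheafComponent p C (e.hom ≫ i) (r ≫ e.inv) where
  retract := by
    rw [Category.assoc, ← Category.assoc i, h.retract, Category.id_comp, e.hom_inv_id]
  zeroNear_sub y hy hC := by
    rw [Category.assoc, e.inv_hom_id_assoc]
    exact h.zeroNear_sub y hy hC
  zeroNear_id y hy hC := (h.zeroNear_id y hy hC).of_retract e.hom_inv_id

lemma ZeroNear.of_iso {Y : Scheme.{u}} {F G : Y.Modules} (e : F ≅ G) {y : Y}
    (h : ZeroNear (𝟙 G) y) : ZeroNear (𝟙 F) y := h.of_retract e.hom_inv_id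

/-- At a point of the support of `L` outside `T`, necessarily in the closed fibre, `F` vanishes. So
`j` kills the component of `L` at this point, and injectivity on global sections forces that
component to be zero. -/
lemma supp_subset_of_injective {R : CommRingCat.{u}} [HenselianLocalRing R] {Y : Scheme.{u}}
    {p : Y ⟶ Spec R} {L F : Y.Modules} {T : Set Y}
    (hT : ∀ y ∉ T, p y = IsLocalRing.closedPoint R) (j : L ⟶ F) (hL : MemP p L) (hF : MemP p F)
    (hFT : supp F ⊆ T)
    (hj : ∀ V : (Spec R).Opens, IsAffineOpen V → Function.Injective (mapSec p j V)) :
    supp L ⊆ T := by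
  intro y hy
  by_contra hyT
  obtain ⟨_, ⟨W₀, hW₀, rfl⟩, hyW₀, -⟩ :=
    Y.isBasis_affineOpens.exists_subset_of_mem_open (Set.mem_univ y) isOpen_univ
  obtain ⟨W, hW, i, -, hWC, hi⟩ := hL.exists_isSheafComponent {y} hW₀
    fun z _ _ (hz : z = y) ↦ hz ▸ hyW₀
  have hyL := hL.coherent.mem_supp_iff.mp hy
  have hij : i ≫ j = 0 := (hL.of_retract i _ hi.retract).eq_zero fun z hz ↦ by
    by_cases hzy : z = y
    · subst hzy
      have : z ∉ supp F := fun h ↦ hyT (hFT h)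
      exact (hF.coherent.zeroNear_of_notMem_supp this).of_id_right
    · exact (hi.zeroNear_id z hz hzy).of_id_left
  have h0 (s : Γ(push p (push hW.fromSpec (L.restrict hW.fromSpec)), ⊤)) : s = 0 := by
    have h₁ : mapSec p i ⊤ s = 0 := hj ⊤ (isAffineOpen_top _) <| by
      rw [← mapSec_comp, hij]
      exact (map_zero (((Scheme.Modules.pushforward p).map j).app ⊤).hom).symm
    rw [← mapSec_mapSec_id (p := p) hi.retract s, h₁]
    exact map_zero (((Scheme.Modules.pushforward p).map (toPushRestrict hW L)).app ⊤).hom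
  have hle : (⊤ : Y.Opens) ⊓ W ≤ W := inf_le_right
  have h1 (s : Γ(L, W)) : s = 0 := by
    refine (res_bijective (F := L) hle (le_inf le_top le_rfl)).1
      ((pushRestrictSections_bijective hW L ⊤).1 ?_)
    rw [map_zero, map_zero]
    exact h0 _
  refine hyL ⟨W, (hWC y (hT y hyT) hyL).mpr rfl, fun V hV s ↦ ?_⟩
  exact hL.coherent.hasFractions.eq_zero_of_res hW le_rfl (fun s ↦ by rw [h1 s, map_zero]) hV _

variable {S X : Scheme.{u}} {R : CommRingCat.{u}} [IsNoetherianRing R] [HenselianLocalRing R]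
  (f : Spec R ⟶ S) (g : X ⟶ S) [IsSeparated g] (x : X)

/-- Places two sheaves on one finite scheme that is closed both in `U ×_S X^h_x` and in `U ×_S X`;
statements about direct image then reduce to closed immersions. -/
lemma exists_finite_model_henselMap {F G : (pullback f (henselAtι X x ≫ g)).Modules}
    (hF : MemP (henselMap f g x ≫ pullback.fst f g) F)
    (hFT : supp F ⊆ localLocus f g (IsLocalRing.closedPoint R) x)
    (hG : MemP (henselMap f g x ≫ pullback.fst f g) G)
    (hGT : supp G ⊆ localLocus f g (IsLocalRing.closedPoint R) x) :
    ∃ (B : CommRingCat.{u}) (i : Spec B ⟶ pullback f (henselAtι X x ≫ g))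
      (M N : (Spec B).Modules),
      IsClosedImmersion i ∧ IsClosedImmersion (i ≫ henselMap f g x) ∧
      IsFinite (i ≫ henselMap f g x ≫ pullback.fst f g) ∧
      (∀ b, i b ∈ localLocus f g (IsLocalRing.closedPoint R) x) ∧ IsCoherent M ∧
      Nonempty (F ≅ push i M) ∧ Nonempty (G ≅ push i N) := by
  obtain ⟨W, hW, hWu⟩ := exists_isAffineOpen_closedFibre f g x
  rw [← henselMap_fst] at hWu
  obtain ⟨B, i, M, N, hi, hip, hM, -, e, e', hb⟩ := exists_finite_model hF hG hW
    (fun y hy _ ↦ hWu y hy) fun y hy _ ↦ hWu y hy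
  have hb' (b : Spec B) : i b ∈ localLocus f g (IsLocalRing.closedPoint R) x :=
    (hb b).elim (fun h ↦ hFT (hF.coherent.mem_supp_iff.mpr h))
      fun h ↦ hGT (hG.coherent.mem_supp_iff.mpr h)
  exact ⟨B, i, M, N, hi, isClosedImmersion_comp_henselMap i hb', hip, hb', hM, e, e'⟩

/-- The component over `x` has a finite model all of whose points lie in its support. Its closed
points thus lie over `x`, and the model lifts to the henselization. -/
lemma exists_component_henselMap {F : (pullback f g).Modules} (hF : MemP (pullback.fst f g) F) :
    ∃ F' : (pullback f (henselAtι X x ≫ g)).Modules,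
      MemP (henselMap f g x ≫ pullback.fst f g) F' ∧
      supp F' ⊆ localLocus f g (IsLocalRing.closedPoint R) x ∧
      ∃ (i : push (henselMap f g x) F' ⟶ F) (r : F ⟶ push (henselMap f g x) F'),
        IsSheafComponent (pullback.fst f g) {y | pullback.snd f g y = x} i r := by
  obtain ⟨W₀, hW₀, hWx⟩ := exists_isAffineOpen_over_point f g x
  obtain ⟨W, hW, i, hle, hWC, hi⟩ := hF.exists_isSheafComponent {y | pullback.snd f g y = x} hW₀
    fun y hy _ hyx ↦ hWx y hy hyx
  have hG := hF.of_retract i _ hi.retract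
  have hGx (y) (hy : pullback.fst f g y = IsLocalRing.closedPoint R)
      (hz : ¬ ZeroNear (𝟙 (push hW.fromSpec (F.restrict hW.fromSpec))) y) :
      pullback.snd f g y = x := by
    by_contra h
    exact hz (hi.zeroNear_id y hy h)
  have hGW (y) (hy : pullback.fst f g y = IsLocalRing.closedPoint R)
      (hz : ¬ ZeroNear (𝟙 (push hW.fromSpec (F.restrict hW.fromSpec))) y) : y ∈ W₀ :=
    hWx y hy (hGx y hy hz)
  obtain ⟨B, q, M, -, hq, hqp, hM, -, ⟨e⟩, -, hb⟩ := exists_finite_model hG hG hW₀ hGW hGW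
  have hqx (b : Spec B) (hb' : pullback.fst f g (q b) = IsLocalRing.closedPoint R) :
      pullback.snd f g (q b) = x := hGx _ hb' ((hb b).elim id id)
  obtain ⟨j, hj, rfl⟩ := exists_lift_henselMap q hqx
  rw [Category.assoc] at hqp
  have hLF := (hG.of_iso e.symm).locallyFree
  refine ⟨push j M, memP_push_of_isClosedImmersion j _ hM ?_, fun y hy ↦ ?_, _, _,
    hi.of_iso (pushPushIso j (henselMap f g x) M ≪≫ e.symm)⟩
  · rw [← Category.assoc]
    exact (isFiniteLocallyFree_push_iff _ _ M).mpr hLF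
  · obtain ⟨b, rfl⟩ : y ∈ Set.range j := by
      by_contra h
      exact notMem_supp_of_zeroNear
        (zeroNear_push_of_notMem_range j j.isClosedEmbedding.isClosed_range h) hy
    exact (mem_localLocus_iff f g x _ _).mpr fun h ↦ hqx b h

/-- The quadratic spaces on the henselization at `x` are those concentrated, over the closed point,
over `x`. -/
lemma isLocalPart_henselMap : IsLocalPart (pullback.fst f g) (henselMap f g x)
    (localLocus f g (IsLocalRing.closedPoint R) x) {y | pullback.snd f g y = x} where
  bijective F G hF hFT hG hGT := by
    obtain ⟨B, i, M, N, _, _, -, -, -, ⟨e⟩, ⟨e'⟩⟩ :=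
      exists_finite_model_henselMap f g x hF hFT hG hGT
    exact bijective_pushMap_of_iso i _ e e'
  memP F hF hFT := by
    obtain ⟨B, i, M, -, _, _, hip, -, hM, ⟨e⟩, -⟩ :=
      exists_finite_model_henselMap f g x hF hFT hF hFT
    rw [← Category.assoc] at hip
    have hLF := (isFiniteLocallyFree_push_iff i _ M).mpr (hF.of_iso e.symm).locallyFree
    rw [← Category.assoc] at hLF
    exact (memP_push_of_isClosedImmersion (i ≫ henselMap f g x) _ hM hLF).of_iso
      ((Scheme.Modules.pushforward _).mapIso e ≪≫ pushPushIso i (henselMap f g x) M)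
  reflectsMultiples F hF hFT := by
    obtain ⟨B, i, M, -, _, _, -, -, -, ⟨e⟩, -⟩ :=
      exists_finite_model_henselMap f g x hF hFT hF hFT
    exact ReflectsMultiples.of_iso i _ (reflectsMultiples_of_isClosedImmersion _) e e
  zeroNear F hF hFT y hy hC := by
    obtain ⟨B, i, M, -, _, _, -, hi, -, ⟨e⟩, -⟩ :=
      exists_finite_model_henselMap f g x hF hFT hF hFT
    refine ZeroNear.of_iso ((Scheme.Modules.pushforward _).mapIso e ≪≫
      pushPushIso i (henselMap f g x) M) (zeroNear_push_of_notMem_range _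
        (i ≫ henselMap f g x).isClosedEmbedding.isClosed_range ?_)
    rintro ⟨b, rfl⟩
    exact hC ((mem_localLocus_iff f g x _ _).mp (hi b) hy)
  exists_component F hF := exists_component_henselMap f g x hF
  supp_subset L F j hL hF hFT hj := by
    -- The local locus contains every point off the closed fibre.
    refine supp_subset_of_injective (fun y hy ↦ ?_) j hL hF hFT hj
    by_contra h
    exact hy ((mem_localLocus_iff f g x _ _).mpr fun h' ↦ (h h').elim)

end LocalPart

/-! ### The support condition over closed points of the base -/

section Support

open TopologicalSpace Opposite

/-- The residue field at `b` is finite over that of `u`, hence integral over that of `s`, and `s` is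
closed in `S`. -/
lemma isIntegralHom_fromSpecResidueField_comp {R B : CommRingCat.{u}} [IsLocalRing R]
    {S : Scheme.{u}} {f : Spec R ⟶ S} (hs : IsClosed {f (IsLocalRing.closedPoint R)})
    (hi : (f.residueFieldMap (IsLocalRing.closedPoint R)).hom.IsIntegral)
    (t : Spec B ⟶ Spec R) [IsFinite t] (b : Spec B) (hb : t b = IsLocalRing.closedPoint R) :
    IsIntegralHom ((Spec B).fromSpecResidueField b ≫ t ≫ f) := by
  obtain ⟨φ, hφ, ht⟩ := exists_specMap_of_isFinite t
  have hbc : IsClosed {b} := by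
    have := (isMaximal_iff_of_finite hφ b).mpr (ht ▸ hb)
    exact (PrimeSpectrum.isClosed_singleton_iff_isMaximal b).mpr this
  have := isClosed_singleton_iff_isClosedImmersion.mp hbc
  rw [← hb] at hs hi
  have := isClosed_singleton_iff_isClosedImmersion.mp hs
  have h₁ : Spec.map (t.residueFieldMap b) ≫ (Spec R).fromSpecResidueField (t b) =
    (Spec B).fromSpecResidueField b ≫ t :=
    Scheme.Hom.SpecMap_residueFieldMap_fromSpecResidueField t b
  have h₂ : Spec.map (f.residueFieldMap (t b)) ≫ S.fromSpecResidueField (f (t b)) =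
    (Spec R).fromSpecResidueField (t b) ≫ f :=
    Scheme.Hom.SpecMap_residueFieldMap_fromSpecResidueField f _
  have : IsFinite (Spec.map (t.residueFieldMap b) ≫ (Spec R).fromSpecResidueField (t b)) := by
    rw [h₁]; infer_instance
  have := IsFinite.of_comp (Spec.map (t.residueFieldMap b)) ((Spec R).fromSpecResidueField (t b))
  have : IsIntegralHom (Spec.map (f.residueFieldMap (t b))) := IsIntegralHom.SpecMap_iff.mpr hi
  rw [← Category.assoc, ← h₁, Category.assoc, ← h₂]
  infer_instance

/-- A point of the support over `u` has residue field integral over `S`, hence over `X` as `g` is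
separated. Its image in `X` is therefore closed; since it specializes to `x`, it is `x`. -/
lemma supp_subset_localLocus {S X : Scheme.{u}} {R : CommRingCat.{u}} [IsLocalRing R]
    (f : Spec R ⟶ S) (g : X ⟶ S) [IsSeparated g]
    (hs : IsClosed {f (IsLocalRing.closedPoint R)})
    (hi : (f.residueFieldMap (IsLocalRing.closedPoint R)).hom.IsIntegral) (x : X)
    {F : (pullback f (henselAtι X x ≫ g)).Modules} (hF : MemP (henselFst f g x) F) :
    supp F ⊆ localLocus f g (IsLocalRing.closedPoint R) x := by
  obtain ⟨B, q, -, _, h0⟩ := hF.exists_specMap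
  intro y hy hyu
  obtain ⟨b, rfl⟩ : y ∈ Set.range q := by
    by_contra h
    exact notMem_supp_of_zeroNear (h0 y h) hy
  have hint := isIntegralHom_fromSpecResidueField_comp hs hi (q ≫ henselFst f g x) b hyu
  let t := (Spec B).fromSpecResidueField b ≫ q ≫ pullback.snd f (henselAtι X x ≫ g) ≫ henselAtι X x
  have ht : t ≫ g = (Spec B).fromSpecResidueField b ≫ (q ≫ henselFst f g x) ≫ f := by
    simp only [t, Category.assoc, pullback.condition]
  have : IsIntegralHom (t ≫ g) := ht ▸ hint
  have : IsIntegralHom t := MorphismProperty.of_postcomp @IsIntegralHom t g ‹_› ‹_›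
  have hr : Set.range t = {henselAtι X x (pullback.snd f (henselAtι X x ≫ g) (q b))} := by
    have : Set.range t = (q ≫ pullback.snd f (henselAtι X x ≫ g) ≫ henselAtι X x) ''
        Set.range ((Spec B).fromSpecResidueField b) := by
      rw [← Set.range_comp]; rfl
    rw [this, Scheme.range_fromSpecResidueField, Set.image_singleton]
    rfl
  have hc := t.isClosedMap.isClosed_range
  rw [hr] at hc
  exact ((henselAtι_specializes x _).mem_closed hc rfl).symm

end Support

end GWCorr

/-! ### The decomposition over the points of `X` -/

theorem mainTheorem6 {S X : Scheme.{u}} {R : CommRingCat.{u}} [IsNoetherian S]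
    [IsNoetherianRing R] [HenselianLocalRing R] (f : Spec R ⟶ S) (g : X ⟶ S)
    [IsSeparated g] [LocallyOfFiniteType g] [QuasiCompact g] :
    -- the direct image along `U ×_S X^h_x ⟶ U ×_S X` of a quadratic space is a quadratic space
    (∀ (x : X) (Q' : GWCorr.QuadSpace (GWCorr.henselFst f g x)
        (GWCorr.localLocus f g (IsLocalRing.closedPoint R) x)),
      ∃ Q : GWCorr.QuadSpace (pullback.fst f g) Set.univ,
        GWCorr.IsPushforward (GWCorr.henselMap f g x) (GWCorr.henselMap_fst f g x) Q' Q) ∧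
    -- direct image induces `⨁ x, GWCor(U, X^h_x) ≅ GWCor(U, X)`
    (∃ φ : ∀ x : X, GWCorr.GWCorAt f g (IsLocalRing.closedPoint R) x →+ GWCorr.GWCor f g,
      (∀ (x : X) (Q' : GWCorr.QuadSpace (GWCorr.henselFst f g x)
          (GWCorr.localLocus f g (IsLocalRing.closedPoint R) x))
          (Q : GWCorr.QuadSpace (pullback.fst f g) Set.univ),
        GWCorr.IsPushforward (GWCorr.henselMap f g x) (GWCorr.henselMap_fst f g x) Q' Q →
          φ x (GWCorr.GW.mk Q') = GWCorr.GW.mk Q) ∧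
      GWCorr.IsDirectSumVia φ) ∧
    -- direct image induces `⨁ x, WCor(U, X^h_x) ≅ WCor(U, X)`
    (∃ φ : ∀ x : X, GWCorr.WCorAt f g (IsLocalRing.closedPoint R) x →+ GWCorr.WCor f g,
      (∀ (x : X) (Q' : GWCorr.QuadSpace (GWCorr.henselFst f g x)
          (GWCorr.localLocus f g (IsLocalRing.closedPoint R) x))
          (Q : GWCorr.QuadSpace (pullback.fst f g) Set.univ),
        GWCorr.IsPushforward (GWCorr.henselMap f g x) (GWCorr.henselMap_fst f g x) Q' Q →
          φ x (GWCorr.W.mk Q') = GWCorr.W.mk Q) ∧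
      GWCorr.IsDirectSumVia φ) ∧
    -- if the closed point of `U` maps to a closed point of `S` with algebraic residue field
    -- extension, then all objects of `P(U ×_S X^h_x → U)` satisfy the support condition
    (IsClosed {f (IsLocalRing.closedPoint R)} →
      (f.residueFieldMap (IsLocalRing.closedPoint R)).hom.IsIntegral →
      ∀ (x : X) (F : (pullback f (GWCorr.henselAtι X x ≫ g)).Modules),
        GWCorr.MemP (GWCorr.henselFst f g x) F →
          GWCorr.supp F ⊆ GWCorr.localLocus f g (IsLocalRing.closedPoint R) x)
 := by
  refine ⟨?_, ?_, ?_, fun hs hi x F ↦ GWCorr.supp_subset_localLocus f g hs hi x⟩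
  all_goals
    have H := GWCorr.exists_isDirectSumVia (GWCorr.henselMap_fst f g)
      (GWCorr.isLocalPart_henselMap f g)
      -- The parts are the fibres of the projection to `X`, which are disjoint and cover everything.
      (fun x y hxy ↦ Set.disjoint_left.mpr fun z (hx : _ = x) (hy : _ = y) ↦ hxy (hx.symm.trans hy))
      fun y _ ↦ ⟨pullback.snd f g y, rfl⟩
  exacts [H.1, H.2.1, H.2.2]
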